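/- **Setting.** A set of $m$ indivisible items is to be allocated to $n$ agents. Agent $i$ has utility $u_i(j)$ for item $j$, and utilities are additive: $u_i(S)=\sum_{j\in S}u_i(j)$. An allocation is a partition $(M_1,\dots,M_n)$ of the items into $n$ (possibly empty) bundles; it is *envy-free* if $u_i(M_i)\ge u_i(M_{i'})$ for all agents $i,i'$, and *balanced* if all bundles have the same size. A probability distribution $\mathcal U$ on $[0,1]$ is *polynomially bounded at 1* if there are constants $\underline\theta,\overline\theta,q>0$ with $$\underline\theta\,\alpha^q\le \Pr_{u\sim\mathcal U}[u>1-\alpha]\le\overline\theta\,\alpha^q\qquad\text{for all }\alpha\in(0,1].$$ The utilities $u_i(j)$ are drawn independently from $\mathcal U$. A property holds *with high probability* if its probability tends to $1$ as $n\to\infty$. An algorithm is a program for a random access machine that works on natural numbers and on real numbers, with addition, subtraction and comparison at unit cost; it is *polynomial-time* if on all inputs the number of its steps is bounded by a polynomial in $n+m$. **Threshold matching with removal**, with a real threshold $\tau$, for $m=rn$. For each agent $i$, the candidate set of $i$ is initially $\{j : u_i(j)\ge\tau\}$. For each other agent $i'$ in turn, as long as the sum of the $r$ largest values $u_{i'}(j)$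 over $j$ in the candidate set of $i$ (of all of them, if there are fewer than $r$) exceeds $r\tau$, remove from the candidate set of $i$ an item that $i'$ values most. Then return an allocation that gives each agent exactly $r$ items, all from her final candidate set, if there is one, and NULL otherwise. Ties and choices are arbitrary. **Theorem.** Let $\mathcal U$ be polynomially bounded at 1, with constants $\underline\theta,\overline\theta,q$. Let $r=r(n)\ge 2$ be integers, which may depend on $n$ in any way, and let $m=rn$. 1. With high probability, there exists an envy-free allocation. 2. There is a polynomial-time algorithm, which is given only $n$, $m$ and the utilities and depends neither on $\mathcal U$ nor on $r(\cdot)$, that on every input returns either NULL or a balanced envy-free allocation, and that with high probability returns a balanced envy-free allocation. 3. Threshold matching with removal can be carried out in polynomial time (for all $n\ge1$, $r\ge 0$, all utilities, and all $\tau\ge0$, where $\tau$ is part of the input). If $r\le e^{n^{0.1}}$ for all large $n$ and $\tau=1-\left(\frac{64\log m}{\underline\theta n}\right)^{1/q}$, then with high probability the procedure has a result, and every result that it can return is a balanced envy-free allocation. -/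

import Mathlib

open MeasureTheory Filter Topology

namespace FairDivision

/-! ### Utility distributions -/

/-- `U` is `(θ, q)`-polynomially bounded below at 1. -/
def PolyBoundedBelowAtOne (U : Measure ℝ) (θ q : ℝ) : Prop :=
  ∀ α ∈ Set.Ioc (0 : ℝ) 1, θ * α ^ q ≤ U.real (Set.Ioi (1 - α))

/-- `U` is `(θ, q)`-polynomially bounded above at 1. -/
def PolyBoundedAboveAtOne (U : Measure ℝ) (θ q : ℝ) : Prop :=
  ∀ α ∈ Set.Ioc (0 : ℝ) 1, U.real (Set.Ioi (1 - α)) ≤ θ * α ^ q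

/-- `U` is a probability distribution on `[0, 1]`. -/
def IsUtilityDistribution (U : Measure ℝ) : Prop :=
  IsProbabilityMeasure U ∧ U (Set.Icc 0 1)ᶜ = 0

/-- `U` is polynomially bounded at 1 (the same exponent below and above). -/
def PolyBoundedAtOne (U : Measure ℝ) : Prop :=
  ∃ θl > 0, ∃ θu > 0, ∃ q > 0,
    PolyBoundedBelowAtOne U θl q ∧ PolyBoundedAboveAtOne U θu q

/-- The joint law of the `n * m` utilities: independent, each with law `U`. -/
noncomputable def utilityLaw (U : Measure ℝ) (n m : ℕ) : Measure (Fin n × Fin m → ℝ) :=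
  Measure.pi fun _ => U

/-- With `n` agents, `r n * n` items and i.i.d. utilities with law `U`, the property `E` of the
utilities (`u i j` is the utility of agent `i` for item `j`) holds with high probability: the
probability that it fails tends to 0. (For a non-measurable property this is the stronger
reading: the outer measure of the failure event tends to 0.) -/
def WithHighProbability (U : Measure ℝ) (r : ℕ → ℕ)
    (E : (n : ℕ) → (Fin n → Fin (r n * n) → ℝ) → Prop) : Prop :=
  Tendsto (fun n => utilityLaw U n (r n * n) {ω | ¬ E n (Function.curry ω)}) atTop (𝓝 0)

/-! ### Allocations -/

/-- An allocation (an ordered partition of the items into `n` bundles, possibly empty), given by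
the owner of each item. -/
abbrev Allocation (n m : ℕ) : Type := Fin m → Fin n

/-- The bundle of agent `i`. -/
def bundle {n m : ℕ} (A : Allocation n m) (i : Fin n) : Finset (Fin m) :=
  Finset.univ.filter fun j => A j = i

/-- No agent prefers another bundle to her own; utilities are additive. -/
def EnvyFree {n m : ℕ} (u : Fin n → Fin m → ℝ) (A : Allocation n m) : Prop :=
  ∀ i i', ∑ j ∈ bundle A i', u i j ≤ ∑ j ∈ bundle A i, u i j

/-- Every agent receives the same number of items. -/
def IsBalanced {n m : ℕ} (A : Allocation n m) : Prop :=
  ∀ i i', (bundle A i).card = (bundle A i').card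

/-! ### Threshold matching with removal -/

/-- The sum of the `r` largest elements of the multiset `{v j | j ∈ S}` (of all its elements if
there are fewer than `r`). -/
noncomputable def sumTop {m : ℕ} (r : ℕ) (v : Fin m → ℝ) (S : Finset (Fin m)) : ℝ :=
  (((S.val.map v).sort (· ≥ ·)).take r).sum

/-- `WhileRemoval r τ v S T`: the loop "while `sumTop r v S > r * τ`, remove from `S` an element
at which `v` is maximal" can turn `S` into `T`; ties are broken arbitrarily. -/
inductive WhileRemoval {m : ℕ} (r : ℕ) (τ : ℝ) (v : Fin m → ℝ) :
    Finset (Fin m) → Finset (Fin m) → Prop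
  | done (S : Finset (Fin m)) (h : sumTop r v S ≤ r * τ) : WhileRemoval r τ v S S
  | remove (S T : Finset (Fin m)) (j : Fin m) (h : r * τ < sumTop r v S) (hj : j ∈ S)
      (hmax : ∀ k ∈ S, v k ≤ v j) (hT : WhileRemoval r τ v (S.erase j) T) :
      WhileRemoval r τ v S T

/-- The removal loop performed for the agents of the list `L`, one after the other. -/
inductive ForRemoval {n m : ℕ} (r : ℕ) (τ : ℝ) (u : Fin n → Fin m → ℝ) :
    List (Fin n) → Finset (Fin m) → Finset (Fin m) → Prop
  | nil (S : Finset (Fin m)) : ForRemoval r τ u [] S S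
  | cons (i' : Fin n) (L : List (Fin n)) (S S' S'' : Finset (Fin m))
      (h : WhileRemoval r τ (u i') S S') (hL : ForRemoval r τ u L S' S'') :
      ForRemoval r τ u (i' :: L) S S''

open Classical in
/-- `C i` is the candidate set of agent `i` after the removal phase: start from the items that
`i` values at least `τ`, and run the removal loop for every agent `i' ≠ i`. -/
def IsCandidateFamily {n m : ℕ} (r : ℕ) (τ : ℝ) (u : Fin n → Fin m → ℝ)
    (C : Fin n → Finset (Fin m)) : Prop :=
  ∀ i, ForRemoval r τ u ((List.finRange n).filter fun i' => i' ≠ i)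
    (Finset.univ.filter fun j => τ ≤ u i j) (C i)

/-- `A` is a perfect `r`-matching of the bipartite graph in which agent `i` is joined to the items
in `C i`: every item has degree 1 and every agent has degree `r`. -/
def IsPerfectMatching {n m : ℕ} (r : ℕ) (C : Fin n → Finset (Fin m)) (A : Allocation n m) : Prop :=
  (∀ j, j ∈ C (A j)) ∧ ∀ i, (bundle A i).card = r

/-- `out` is a possible result of threshold matching with removal with threshold `τ`; `none` is
the answer NULL. -/
def ThresholdMatchingWithRemoval {n m : ℕ} (r : ℕ) (τ : ℝ) (u : Fin n → Fin m → ℝ)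
    (out : Option (Allocation n m)) : Prop :=
  ∃ C, IsCandidateFamily r τ u C ∧
    match out with
    | some A => IsPerfectMatching r C A
    | none => ¬ ∃ A, IsPerfectMatching r C A

/-- The threshold `1 - (64 log m / (θ n)) ^ (1 / q)` for `m = r * n` items. -/
noncomputable def threshold (θ q : ℝ) (n r : ℕ) : ℝ :=
  1 - (64 * Real.log (r * n : ℕ) / (θ * n)) ^ (1 / q)

/-! ### Algorithms

A random access machine over the reals, presented as a language of `while` programs. A program is
a finite text, the same for all inputs. It works on natural numbers, which serve as counters and
addresses, and on real numbers. The only operations are addition, subtraction and comparison, each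
at unit cost, and there is no conversion from reals to natural numbers. So numbers do not grow
faster than under repeated doubling, and a polynomial number of steps is a polynomial amount of
work. -/

/-- The memory: variables for natural numbers, and two-dimensional arrays of natural numbers and
of real numbers (each named by a number). -/
structure Memory where
  var : ℕ → ℕ
  natArray : ℕ → ℕ → ℕ → ℕ
  realArray : ℕ → ℕ → ℕ → ℝ

/-- Natural number expressions; `get a e f` is the entry `(e, f)` of array `a`. -/
inductive NatExpr
  | const (k : ℕ)
  | var (x : ℕ)
  | get (a : ℕ) (e f : NatExpr)
  | add (e f : NatExpr)
  | sub (e f : NatExpr)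

/-- Real expressions. -/
inductive RealExpr
  | const (c : ℚ)
  | get (a : ℕ) (e f : NatExpr)
  | add (x y : RealExpr)
  | sub (x y : RealExpr)

/-- Tests. -/
inductive Test
  | natLe (e f : NatExpr)
  | realLe (x y : RealExpr)
  | not (b : Test)
  | and (b c : Test)

/-- Programs. -/
inductive Program
  | skip
  | setVar (x : ℕ) (e : NatExpr)
  | setNat (a : ℕ) (e f : NatExpr) (value : NatExpr)
  | setReal (a : ℕ) (e f : NatExpr) (value : RealExpr)
  | seq (c d : Program)
  | ite (b : Test) (c d : Program)
  | while (b : Test) (c : Program)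

/-- The value of an expression; subtraction of natural numbers is truncated at 0. -/
def NatExpr.eval (s : Memory) : NatExpr → ℕ
  | .const k => k
  | .var x => s.var x
  | .get a e f => s.natArray a (e.eval s) (f.eval s)
  | .add e f => e.eval s + f.eval s
  | .sub e f => e.eval s - f.eval s

noncomputable def RealExpr.eval (s : Memory) : RealExpr → ℝ
  | .const c => c
  | .get a e f => s.realArray a (e.eval s) (f.eval s)
  | .add x y => x.eval s + y.eval s
  | .sub x y => x.eval s - y.eval s

def Test.Holds (s : Memory) : Test → Prop
  | .natLe e f => e.eval s ≤ f.eval s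
  | .realLe x y => x.eval s ≤ y.eval s
  | .not b => ¬ b.Holds s
  | .and b c => b.Holds s ∧ c.Holds s

/-- Replace the entry `(i, j)` of array `a` by `v`. -/
def updateArray {α : Type} (M : ℕ → ℕ → ℕ → α) (a i j : ℕ) (v : α) : ℕ → ℕ → ℕ → α :=
  fun a' i' j' => if a' = a ∧ i' = i ∧ j' = j then v else M a' i' j'

/-- `Exec c s t s'`: the program `c`, started in memory `s`, halts after exactly `t` steps, in
memory `s'`. Every assignment and every test costs one step. -/
inductive Exec : Program → Memory → ℕ → Memory → Prop
  | skip (s : Memory) : Exec .skip s 1 s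
  | setVar (s : Memory) (x : ℕ) (e : NatExpr) :
      Exec (.setVar x e) s 1 { s with var := Function.update s.var x (e.eval s) }
  | setNat (s : Memory) (a : ℕ) (e f value : NatExpr) :
      Exec (.setNat a e f value) s 1
        { s with natArray := updateArray s.natArray a (e.eval s) (f.eval s) (value.eval s) }
  | setReal (s : Memory) (a : ℕ) (e f : NatExpr) (value : RealExpr) :
      Exec (.setReal a e f value) s 1
        { s with realArray := updateArray s.realArray a (e.eval s) (f.eval s) (value.eval s) }
  | seq (c d : Program) (s s' s'' : Memory) (t t' : ℕ) (hc : Exec c s t s')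
      (hd : Exec d s' t' s'') : Exec (.seq c d) s (t + t') s''
  | iteTrue (b : Test) (c d : Program) (s s' : Memory) (t : ℕ) (hb : b.Holds s)
      (hc : Exec c s t s') : Exec (.ite b c d) s (t + 1) s'
  | iteFalse (b : Test) (c d : Program) (s s' : Memory) (t : ℕ) (hb : ¬ b.Holds s)
      (hd : Exec d s t s') : Exec (.ite b c d) s (t + 1) s'
  | whileTrue (b : Test) (c : Program) (s s' s'' : Memory) (t t' : ℕ) (hb : b.Holds s)
      (hc : Exec c s t s') (hw : Exec (.while b c) s' t' s'') :
      Exec (.while b c) s (t + t' + 1) s''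
  | whileFalse (b : Test) (c : Program) (s : Memory) (hb : ¬ b.Holds s) :
      Exec (.while b c) s 1 s

/-- The input: the numbers of agents and items in variables 0 and 1, the utilities in real
array 0, and one real parameter `x` in entry `(0, 0)` of real array 1; all else is 0. -/
noncomputable def inputMemory (n m : ℕ) (x : ℝ) (u : Fin n → Fin m → ℝ) : Memory where
  var k := if k = 0 then n else if k = 1 then m else 0
  natArray _ _ _ := 0
  realArray a i j :=
    if a = 0 then (if h : i < n ∧ j < m then u ⟨i, h.1⟩ ⟨j, h.2⟩ else 0)
    else if a = 1 ∧ i = 0 ∧ j = 0 then x else 0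

/-- The output: NULL if variable 0 is 0; the allocation with owners in row 0 of natural number
array 0 if variable 0 is 1. -/
def HasOutput {n m : ℕ} (s : Memory) : Option (Allocation n m) → Prop
  | none => s.var 0 = 0
  | some A => s.var 0 = 1 ∧ ∀ j : Fin m, s.natArray 0 0 j = A j

/-- On utilities `u` and parameter `x`, the program `c` halts within `T` steps with output
`out`. -/
def ComputesWithin {n m : ℕ} (c : Program) (T : ℕ) (x : ℝ) (u : Fin n → Fin m → ℝ)
    (out : Option (Allocation n m)) : Prop :=
  ∃ t ≤ T, ∃ s, Exec c (inputMemory n m x u) t s ∧ HasOutput s out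

end FairDivision

open FairDivision

/-! Put N = n^(1/10). The cases r ≤ e^N and r > e^N are settled by different allocations.

Small r. Whatever the threshold τ, a matching returned after the removals is envy-free: each agent
gets r items worth at least τ to her, and no r items left in another agent's candidate set are worth
more than r * τ to her (`IsCandidateFamily.envyFree`). So it must be shown that a perfect r-matching
survives the removals. With τ = 1 - α as in the theorem, an agent values an item at least τ with
probability at least 64 log m / n, and a union bound over violators of Hall's condition shows that
Hall's condition holds even if every vertex loses up to two edges (`RobustHall`, `hall_term_le`). On
the other hand, i' removes an item from the set of i only if the r best items for i' in it have mean
value above 1 - α. Then more than 2r/3 of these have value above 1 - 3α for both agents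
(`card_filter_of_lt_sumTop`). Values above 1 - 3α have probability O(N^(-9)). For r ≥ 3 the overlap
has at least three items, and by a first moment bound no two agents have so many in common, so
nothing is removed. For r = 2 the overlap is a 4-cycle of the sparse graph of values above 1 - 3α.
Such cycles may occur, but two touching ones form a graph with more edges than vertices, and with
high probability there is none. Hence each vertex loses at most two edges
(`ncard_neighbors_on_cycles_le`, `IsTypical.exists_isPerfectMatching`).

Large r. Cut the items into r blocks of n, and give agent k item k of each block. In each block one
ordered pair (a, a') of agents, chosen periodically, exchanges items if a prefers this. For i ≠ i'
the advantage of i over i' has nonnegative mean in every block, and a fixed positive mean in the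
roughly r / n² blocks where (i, i') is the trading pair. The blocks are independent, so by
Chebyshev's inequality envy has probability O(n^6 / r), which tends to 0
(`eventually_envyFree_blockAllocation`).

Algorithm. Neither the distribution nor the threshold needs to be known: the program tries the block
allocation and checks it for envy, and then runs threshold matching with every nonnegative utility
as threshold. The least utility that is at least τ leads to the same initial sets as τ
(`IsTypical.exists_utility_threshold`). Programs are written with loops bounded by n or m, so that
their running time is polynomial by construction (`Code.exec_compile`). Matchings are found by an
auction with integral prices, which stops after m² bids or exhibits a violation of Hall's condition.
-/

namespace FairDivision

/-! ### Sums of the largest values -/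

section SumTop

variable {m : ℕ} {v : Fin m → ℝ}

theorem sumTop_zero (v : Fin m → ℝ) (S : Finset (Fin m)) : sumTop 0 v S = 0 := by
  simp [sumTop]

theorem sumTop_empty (r : ℕ) (v : Fin m → ℝ) : sumTop r v ∅ = 0 := by
  simp [sumTop]

/-- A maximal value may be put at the head of the sorted list. This recursion is how `sumTop` is
used everywhere: it reduces the sum to a greedy choice, as in the program that computes it. -/
theorem sumTop_succ (r : ℕ) {S : Finset (Fin m)} {j : Fin m} (hj : j ∈ S)
    (hmax : ∀ k ∈ S, v k ≤ v j) :
    sumTop (r + 1) v S = v j + sumTop r v (S.erase j) := by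
  have h : S.val.map v = v j ::ₘ ((S.erase j).val.map v) := by
    rw [← Multiset.map_cons, Finset.erase_val, Multiset.cons_erase hj]
  unfold sumTop
  rw [h, Multiset.sort_cons]
  · simp
  · intro b hb
    obtain ⟨k, hk, rfl⟩ := Multiset.mem_map.1 hb
    exact hmax k (Finset.mem_of_mem_erase hk)

theorem exists_argmax {S : Finset (Fin m)} (v : Fin m → ℝ) (hS : S.Nonempty) :
    ∃ j ∈ S, ∀ k ∈ S, v k ≤ v j :=
  S.exists_max_image v hS

/-- Exchange argument: split off a maximizer of S, and from T the same item if it is there and any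
other item otherwise. Exactly r items are required, because with negative values a smaller set can
have a larger sum. -/
theorem sum_le_sumTop (r : ℕ) {S T : Finset (Fin m)} (hT : T ⊆ S) (hcard : T.card = r) :
    ∑ j ∈ T, v j ≤ sumTop r v S := by
  induction r generalizing S T with
  | zero =>
    rw [Finset.card_eq_zero.1 hcard, sumTop_zero]
    simp
  | succ r ih =>
    have hTne : T.Nonempty := Finset.card_pos.1 (by omega)
    obtain ⟨j, hj, hmax⟩ := exists_argmax v (hTne.mono hT)
    rw [sumTop_succ r hj hmax]
    obtain ⟨t, ht, hsub⟩ : ∃ t ∈ T, T.erase t ⊆ S.erase j := by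
      by_cases hjT : j ∈ T
      · exact ⟨j, hjT, Finset.erase_subset_erase j hT⟩
      · obtain ⟨t, ht⟩ := hTne
        refine ⟨t, ht, fun k hk => Finset.mem_erase.2 ⟨?_, hT (Finset.mem_of_mem_erase hk)⟩⟩
        rintro rfl
        exact hjT (Finset.mem_of_mem_erase hk)
    have h1 := ih hsub (by rw [Finset.card_erase_of_mem ht]; omega)
    rw [← Finset.add_sum_erase T v ht]
    exact add_le_add (hmax t (hT ht)) h1

theorem exists_sum_eq_sumTop (r : ℕ) (v : Fin m → ℝ) (S : Finset (Fin m)) :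
    ∃ T ⊆ S, T.card ≤ r ∧ ∑ j ∈ T, v j = sumTop r v S := by
  induction r generalizing S with
  | zero => exact ⟨∅, by simp, by simp, by simp [sumTop_zero]⟩
  | succ r ih =>
    rcases S.eq_empty_or_nonempty with rfl | hS
    · exact ⟨∅, by simp, by simp, by simp [sumTop_empty]⟩
    obtain ⟨j, hj, hmax⟩ := exists_argmax v hS
    obtain ⟨T, hTS, hT, hsum⟩ := ih (S.erase j)
    have hjT : j ∉ T := fun h => by simpa using hTS h
    refine ⟨insert j T, ?_, ?_, ?_⟩
    · exact Finset.insert_subset hj (hTS.trans (Finset.erase_subset _ _))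
    · rw [Finset.card_insert_of_notMem hjT]; omega
    · rw [Finset.sum_insert hjT, sumTop_succ r hj hmax, hsum]

/-- If the mean of the `r` largest values is close to the maximal possible value 1, then most of
these values are close to 1. -/
theorem card_filter_of_lt_sumTop {r : ℕ} {α : ℝ} {S : Finset (Fin m)} (hα : 0 < α)
    (hα' : 3 * α ≤ 1) (hv : ∀ j ∈ S, v j ≤ 1) (h : r * (1 - α) < sumTop r v S) :
    2 * r < 3 * (S.filter fun j => 1 - 3 * α < v j).card := by
  obtain ⟨T, hTS, hT, hsum⟩ := exists_sum_eq_sumTop r v S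
  set G := T.filter fun j => 1 - 3 * α < v j with hG
  have hGS : G.card ≤ (S.filter fun j => 1 - 3 * α < v j).card :=
    Finset.card_le_card (Finset.filter_subset_filter _ hTS)
  suffices 2 * r < 3 * G.card by omega
  have h1 : ∑ j ∈ G, v j ≤ G.card := by
    have := Finset.sum_le_card_nsmul G v 1 fun j hj => hv j (hTS (Finset.mem_filter.1 hj).1)
    simpa using this
  have h2 : ∑ j ∈ T.filter (fun j => ¬ 1 - 3 * α < v j), v j
      ≤ (T.filter (fun j => ¬ 1 - 3 * α < v j)).card * (1 - 3 * α) := by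
    have := Finset.sum_le_card_nsmul (T.filter (fun j => ¬ 1 - 3 * α < v j)) v (1 - 3 * α)
      fun j hj => not_lt.1 (Finset.mem_filter.1 hj).2
    simpa using this
  have h3 := Finset.sum_filter_add_sum_filter_not T (fun j => 1 - 3 * α < v j) v
  have h4 := Finset.card_filter_add_card_filter_not (s := T) (fun j => 1 - 3 * α < v j)
  rw [← hG] at h3 h4
  have h5 : ((T.filter (fun j => ¬ 1 - 3 * α < v j)).card : ℝ) ≤ r - G.card := by
    have : (T.filter (fun j => ¬ 1 - 3 * α < v j)).card + G.card ≤ r := by omega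
    have : ((T.filter (fun j => ¬ 1 - 3 * α < v j)).card : ℝ) + G.card ≤ r := by exact_mod_cast this
    linarith
  have h6 := mul_le_mul_of_nonneg_right h5 (by linarith : (0 : ℝ) ≤ 1 - 3 * α)
  -- With g = `G.card`, the bounds give r(1 - α) < g + (r - g)(1 - 3α), which simplifies to 2αr <
  -- 3αg.
  have h7 : α * (2 * r) < α * (3 * G.card) := by nlinarith
  have h8 := lt_of_mul_lt_mul_left h7 hα.le
  exact_mod_cast h8

end SumTop

/-! ### The removal phase, and envy-freeness of its result -/

section Removal

variable {n m : ℕ} {r : ℕ} {τ : ℝ} {v : Fin m → ℝ} {u : Fin n → Fin m → ℝ}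

theorem WhileRemoval.subset {S T : Finset (Fin m)} (h : WhileRemoval r τ v S T) : T ⊆ S := by
  induction h with
  | done S h => exact subset_rfl
  | remove S T j h hj hmax hT ih => exact ih.trans (Finset.erase_subset _ _)

theorem WhileRemoval.sumTop_le {S T : Finset (Fin m)} (h : WhileRemoval r τ v S T) :
    sumTop r v T ≤ r * τ := by
  induction h with
  | done S h => exact h
  | remove S T j h hj hmax hT ih => exact ih

/-- S' is the set at the moment when j is removed. This snapshot is all that the probabilistic
argument needs to know about a removal. -/
theorem WhileRemoval.of_removed {S T : Finset (Fin m)} (h : WhileRemoval r τ v S T) {j : Fin m}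
    (hjS : j ∈ S) (hjT : j ∉ T) :
    ∃ S' ⊆ S, j ∈ S' ∧ r * τ < sumTop r v S' ∧ ∀ k ∈ S', v k ≤ v j := by
  induction h with
  | done S h => exact absurd hjS hjT
  | remove S T k h hk hmax hT ih =>
    by_cases hjk : j = k
    · subst hjk
      exact ⟨S, subset_rfl, hjS, h, hmax⟩
    · obtain ⟨S', hS', h'⟩ := ih (Finset.mem_erase.2 ⟨hjk, hjS⟩) hjT
      exact ⟨S', hS'.trans (Finset.erase_subset _ _), h'⟩

/-- The loop ends at the latest with the empty set, whose sum 0 is at most r * τ; this is where τ ≥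
0 is needed. -/
theorem exists_whileRemoval (r : ℕ) (hτ : 0 ≤ τ) (v : Fin m → ℝ) (S : Finset (Fin m)) :
    ∃ T, WhileRemoval r τ v S T := by
  induction hc : S.card generalizing S with
  | zero =>
    rw [Finset.card_eq_zero.1 hc]
    exact ⟨∅, .done _ (by rw [sumTop_empty]; positivity)⟩
  | succ c ih =>
    obtain ⟨j, hj, hmax⟩ := exists_argmax v (Finset.card_pos.1 (by omega : 0 < S.card))
    by_cases h : sumTop r v S ≤ r * τ
    · exact ⟨S, .done _ h⟩
    · obtain ⟨T, hT⟩ := ih (S.erase j) (by rw [Finset.card_erase_of_mem hj]; omega)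
      exact ⟨T, .remove S T j (not_le.1 h) hj hmax hT⟩

theorem ForRemoval.subset {L : List (Fin n)} {S T : Finset (Fin m)}
    (h : ForRemoval r τ u L S T) : T ⊆ S := by
  induction h with
  | nil S => exact subset_rfl
  | cons i' L S S' S'' h hL ih => exact ih.trans h.subset

/-- S' is the set right after the turn of i'; later turns only shrink it. The bound stays with S'
because `sumTop` is not monotone for values of arbitrary sign, but it still bounds every r-subset of
T. -/
theorem ForRemoval.exists_sumTop_le {L : List (Fin n)} {S T : Finset (Fin m)}
    (h : ForRemoval r τ u L S T) {i' : Fin n} (hi : i' ∈ L) :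
    ∃ S', T ⊆ S' ∧ sumTop r (u i') S' ≤ r * τ := by
  induction h with
  | nil S => simp at hi
  | cons k L S S' S'' h hL ih =>
    rcases List.mem_cons.1 hi with rfl | hi
    · exact ⟨S', hL.subset, h.sumTop_le⟩
    · exact ih hi

theorem ForRemoval.of_removed {L : List (Fin n)} {S T : Finset (Fin m)}
    (h : ForRemoval r τ u L S T) {j : Fin m} (hjS : j ∈ S) (hjT : j ∉ T) :
    ∃ i' ∈ L, ∃ S' ⊆ S, j ∈ S' ∧ r * τ < sumTop r (u i') S' ∧ ∀ k ∈ S', u i' k ≤ u i' j := by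
  induction h with
  | nil S => exact absurd hjS hjT
  | cons k L S S' S'' h hL ih =>
    by_cases hj : j ∈ S'
    · obtain ⟨i', hi', S₁, hS₁, h'⟩ := ih hj hjT
      exact ⟨i', List.mem_cons_of_mem _ hi', S₁, hS₁.trans h.subset, h'⟩
    · exact ⟨k, List.mem_cons_self, h.of_removed hjS hj⟩

theorem exists_forRemoval (r : ℕ) (hτ : 0 ≤ τ) (u : Fin n → Fin m → ℝ) (L : List (Fin n))
    (S : Finset (Fin m)) : ∃ T, ForRemoval r τ u L S T := by
  induction L generalizing S with
  | nil => exact ⟨S, .nil S⟩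
  | cons i' L ih =>
    obtain ⟨S', h⟩ := exists_whileRemoval r hτ (u i') S
    obtain ⟨T, hT⟩ := ih S'
    exact ⟨T, .cons i' L S S' T h hT⟩

/-- The relation is built from the first agent of the list, whereas a loop invariant extends the
processed list at its end. -/
theorem ForRemoval.append_singleton {L : List (Fin n)} {S S' T : Finset (Fin m)} {i' : Fin n}
    (h : ForRemoval r τ u L S S') (h' : WhileRemoval r τ (u i') S' T) :
    ForRemoval r τ u (L ++ [i']) S T := by
  induction h with
  | nil S => exact .cons i' [] S T T h' (.nil T)
  | cons k L S S₁ S₂ hk hL ih => exact .cons k _ S S₁ T hk (ih h')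

theorem exists_isCandidateFamily (r : ℕ) (hτ : 0 ≤ τ) (u : Fin n → Fin m → ℝ) :
    ∃ C, IsCandidateFamily r τ u C := by
  classical
  exact Classical.skolem.1 fun i => exists_forRemoval r hτ u _ _

theorem exists_thresholdMatchingWithRemoval (r : ℕ) (hτ : 0 ≤ τ) (u : Fin n → Fin m → ℝ) :
    ∃ out, ThresholdMatchingWithRemoval r τ u out := by
  obtain ⟨C, hC⟩ := exists_isCandidateFamily r hτ u
  by_cases h : ∃ A, IsPerfectMatching r C A
  · obtain ⟨A, hA⟩ := h
    exact ⟨some A, C, hC, hA⟩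
  · exact ⟨none, C, hC, h⟩

theorem IsPerfectMatching.isBalanced {C : Fin n → Finset (Fin m)} {A : Allocation n m}
    (h : IsPerfectMatching r C A) : IsBalanced A := fun i i' => by rw [h.2, h.2]

/-- Whatever the threshold is, the result of the procedure is envy-free: an agent values each of
her own items at least `τ`, and every other bundle at most `r * τ`. -/
theorem IsCandidateFamily.envyFree {C : Fin n → Finset (Fin m)} {A : Allocation n m}
    (hC : IsCandidateFamily r τ u C) (h : IsPerfectMatching r C A) : EnvyFree u A := by
  classical
  intro i i'
  by_cases hii : i' = i
  · rw [hii]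
  have hsub : ∀ k, bundle A k ⊆ C k := by
    intro k j hj
    have := h.1 j
    rwa [(Finset.mem_filter.1 hj).2] at this
  have h1 : (r : ℝ) * τ ≤ ∑ j ∈ bundle A i, u i j := by
    rw [← h.2 i, ← nsmul_eq_mul]
    refine Finset.card_nsmul_le_sum _ _ _ fun j hj => ?_
    exact (Finset.mem_filter.1 ((hC i).subset (hsub i hj))).2
  obtain ⟨S', hS', hle⟩ := (hC i').exists_sumTop_le (i' := i) (by simpa using fun h => hii h.symm)
  exact ((sum_le_sumTop r ((hsub i').trans hS') (h.2 i')).trans hle).trans h1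

end Removal

/-! ### Hall's condition and perfect r-matchings -/

section Hall

/-- The bipartite graph `E` has no obstruction to a perfect `r`-matching, even after the removal of
few edges from it. -/
def RobustHall {n m : ℕ} (r : ℕ) (E : Fin n → Fin m → Prop) : Prop :=
  ∀ (X : Finset (Fin n)) (Y : Finset (Fin m)) (R : Finset (Fin n × Fin m)), X.Nonempty →
    Y.card = r * (n - X.card) + 1 → R.card ≤ 2 * X.card → R.card ≤ 2 * Y.card →
      ∃ i ∈ X, ∃ j ∈ Y, (i, j) ∉ R ∧ E i j

/-- Replace each agent by r copies and apply Hall's marriage theorem to the items. As there are as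
many copies as items, the injection is a bijection, so every agent gets exactly r items. -/
theorem exists_isPerfectMatching_of_hall {n r : ℕ} (C : Fin n → Finset (Fin (r * n)))
    (h : ∀ Y : Finset (Fin (r * n)),
      Y.card ≤ r * (Finset.univ.filter fun i => ∃ j ∈ Y, j ∈ C i).card) :
    ∃ A, IsPerfectMatching r C A := by
  classical
  let t : Fin (r * n) → Finset (Fin n × Fin r) := fun j =>
    (Finset.univ.filter fun i => j ∈ C i) ×ˢ Finset.univ
  have ht : ∀ Y : Finset (Fin (r * n)), Y.card ≤ (Y.biUnion t).card := by
    intro Y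
    have : Y.biUnion t = (Finset.univ.filter fun i => ∃ j ∈ Y, j ∈ C i) ×ˢ Finset.univ := by
      ext ⟨i, k⟩
      simp [t]
    rw [this, Finset.card_product, Finset.card_univ, Fintype.card_fin]
    exact (h Y).trans_eq (mul_comm _ _)
  obtain ⟨f, hf, hft⟩ := (Finset.all_card_le_biUnion_card_iff_exists_injective t).1 ht
  have hbij : Function.Bijective f := by
    rw [Fintype.bijective_iff_injective_and_card]
    refine ⟨hf, ?_⟩
    simp [mul_comm]
  refine ⟨fun j => (f j).1, fun j => ?_, fun i => ?_⟩
  · have := hft j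
    simp only [t, Finset.mem_product, Finset.mem_filter] at this
    exact this.1.2
  · have : (bundle (fun j => (f j).1) i).card = (Finset.univ : Finset (Fin r)).card := by
      symm
      refine Finset.card_bij (fun k _ => (Equiv.ofBijective f hbij).symm (i, k)) ?_ ?_ ?_
      · intro k _
        simp only [bundle, Finset.mem_filter, Finset.mem_univ, true_and]
        rw [Equiv.ofBijective_apply_symm_apply f hbij]
      · intro k _ k' _ hk
        simpa using hk
      · intro j hj
        refine ⟨(f j).2, Finset.mem_univ _, ?_⟩
        rw [Equiv.symm_apply_eq, Equiv.ofBijective_apply]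
        rw [← (Finset.mem_filter.1 hj).2]
    simpa using this

/-- Suppose that Y violates Hall's condition for C, and let X be the agents without candidates in Y.
All edges of E between X and Y have been deleted, so they form a set R with at most two edges at
each vertex of either side, which `RobustHall` excludes. -/
theorem RobustHall.exists_isPerfectMatching {n r : ℕ} {E : Fin n → Fin (r * n) → Prop}
    (hE : RobustHall r E) (C : Fin n → Finset (Fin (r * n)))
    (hC : ∀ i, {j | E i j ∧ j ∉ C i}.ncard ≤ 2) (hC' : ∀ j, {i | E i j ∧ j ∉ C i}.ncard ≤ 2) :
    ∃ A, IsPerfectMatching r C A := by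
  classical
  refine exists_isPerfectMatching_of_hall C fun Y₀ => ?_
  by_contra! hlt
  set N := Finset.univ.filter fun i => ∃ j ∈ Y₀, j ∈ C i with hN
  have hNn : N.card < n := by
    by_contra! hn
    have h1 := Nat.mul_le_mul_left r hn
    have h2 : Y₀.card ≤ r * n := by simpa using Finset.card_le_univ Y₀
    omega
  -- Shrinking the violator keeps it a violator, so its size can be made the exact value in
  -- `RobustHall`.
  obtain ⟨Y, hYY, hY⟩ := Finset.exists_subset_card_eq (s := Y₀) (n := r * N.card + 1) (by omega)
  have hXc : Nᶜ.card = n - N.card := by rw [Finset.card_compl, Fintype.card_fin]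
  set R := (Nᶜ ×ˢ Y).filter fun e => E e.1 e.2 ∧ e.2 ∉ C e.1 with hR
  -- Counting edges by one endpoint. It is stated for arbitrary types in order to be used for the
  -- agents and, after a flip, for the items.
  have key : ∀ {α β : Type} [DecidableEq α] [DecidableEq β] (X : Finset α) (Q : Finset (α × β))
      (f : α → Set β), (∀ a, (f a).ncard ≤ 2) → (∀ a, (f a).Finite) → (∀ e ∈ Q, e.1 ∈ X ∧ e.2 ∈ f e.1) →
      Q.card ≤ 2 * X.card := by
    intro α β _ _ X Q f hf hfin hQ
    refine (Finset.card_le_mul_card_image_of_maps_to (f := Prod.fst) (s := Q) (t := X)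
      (fun e he => (hQ e he).1) 2 fun a ha => ?_)
    rw [← Set.ncard_coe_finset]
    refine le_trans ?_ (hf a)
    refine Set.ncard_le_ncard_of_injOn Prod.snd ?_ ?_ (hfin a)
    · intro e he
      simp only [Finset.coe_filter, Set.mem_ofPred_eq] at he
      have := (hQ e he.1).2
      rwa [he.2] at this
    · intro e he e' he' h
      simp only [Finset.coe_filter, Set.mem_ofPred_eq] at he he'
      exact Prod.ext (he.2.trans he'.2.symm) h
  have hR1 : R.card ≤ 2 * Nᶜ.card := by
    refine key Nᶜ R (fun i => {j | E i j ∧ j ∉ C i}) hC (fun _ => Set.toFinite _) fun e he => ?_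
    simp only [hR, Finset.mem_filter, Finset.mem_product] at he
    exact ⟨he.1.1, he.2⟩
  have hR2 : R.card ≤ 2 * Y.card := by
    rw [← Finset.card_map (Equiv.prodComm _ _).toEmbedding]
    refine key Y _ (fun j => {i | E i j ∧ j ∉ C i}) hC' (fun _ => Set.toFinite _) fun e he => ?_
    simp only [hR, Finset.mem_map_equiv, Finset.mem_filter, Finset.mem_product] at he
    exact ⟨he.1.2, he.2⟩
  obtain ⟨i, hi, j, hj, hij, hEij⟩ := hE Nᶜ Y R
    (Finset.card_pos.1 (by omega)) (by rw [hXc, hY]; congr 2; omega) hR1 hR2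
  have hjC : j ∉ C i := by
    intro hjC
    rw [Finset.mem_compl] at hi
    exact hi (Finset.mem_filter.2 ⟨Finset.mem_univ _, j, hYY hj, hjC⟩)
  exact hij (Finset.mem_filter.2 ⟨Finset.mem_product.2 ⟨hi, hj⟩, hEij, hjC⟩)

end Hall

/-! ### Touching 4-cycles in bipartite graphs -/

section Patterns

variable {α β : Type*}

/-- The bipartite graph `G` contains a copy of the bipartite graph `E`. -/
def ContainsCopy {a b : ℕ} (G : α → β → Prop) (E : Finset (Fin a × Fin b)) : Prop :=
  ∃ (f : Fin a → α) (g : Fin b → β), Function.Injective f ∧ Function.Injective g ∧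
    ∀ e ∈ E, G (f e.1) (g e.2)

theorem ContainsCopy.of_flip {a b : ℕ} {G : α → β → Prop} {E : Finset (Fin a × Fin b)}
    (h : ContainsCopy (flip G) E) : ContainsCopy G (E.map (Equiv.prodComm _ _).toEmbedding) := by
  obtain ⟨f, g, hf, hg, h⟩ := h
  refine ⟨g, f, hg, hf, fun e he => ?_⟩
  rw [Finset.mem_map_equiv] at he
  exact h _ he

/-- Two 4-cycles that share two opposite vertices and one more. -/
def cyclesSharingPath : Finset (Fin 3 × Fin 2) := Finset.univ

/-- Two 4-cycles that share an edge. -/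
def cyclesSharingEdge : Finset (Fin 3 × Fin 3) :=
  {(0, 0), (1, 0), (2, 0), (0, 1), (1, 1), (2, 2), (0, 2)}

/-- Two 4-cycles that share a vertex. -/
def cyclesSharingVertex : Finset (Fin 4 × Fin 3) :=
  {(0, 0), (1, 0), (2, 0), (3, 0), (0, 1), (1, 1), (2, 2), (3, 2)}

/-- `G` contains two different 4-cycles that share a vertex of the second kind. -/
def HasTouchingCycles (G : α → β → Prop) : Prop :=
  ContainsCopy G cyclesSharingPath ∨ ContainsCopy G cyclesSharingEdge ∨
    ContainsCopy G cyclesSharingVertex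

theorem injective_two {x y : α} (h : x ≠ y) : Function.Injective ![x, y] := by
  intro i j hij
  fin_cases i <;> fin_cases j <;> simp_all

theorem injective_three {x y z : α} (h₁ : x ≠ y) (h₂ : x ≠ z) (h₃ : y ≠ z) :
    Function.Injective ![x, y, z] := by
  intro i j hij
  fin_cases i <;> fin_cases j <;> simp_all

theorem injective_four {x y z w : α} (h₁ : x ≠ y) (h₂ : x ≠ z) (h₃ : y ≠ z) (h₄ : x ≠ w)
    (h₅ : y ≠ w) (h₆ : z ≠ w) : Function.Injective ![x, y, z, w] := by
  intro i j hij
  fin_cases i <;> fin_cases j <;> simp_all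

/-- The set consists of the neighbors a of b for which the edge ab lies on a 4-cycle. One 4-cycle
through b accounts for two of them; a third one lies on another 4-cycle through b, and the two
cycles touch. -/
theorem ncard_neighbors_on_cycles_le {G : α → β → Prop} (hG : ¬ HasTouchingCycles G) (b : β) :
    {a | ∃ a', a' ≠ a ∧ ∃ b', b' ≠ b ∧ G a b ∧ G a' b ∧ G a b' ∧ G a' b'}.ncard ≤ 2 := by
  by_contra! hlt
  apply hG
  obtain ⟨x, y, z, hx, hy, hz, hxy, hxz, hyz⟩ := (Set.two_lt_ncard_iff
    (Set.finite_of_ncard_pos (by omega))).1 hlt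
  obtain ⟨x', hx', d, hd, h1, h2, h3, h4⟩ := hx
  have main : ∀ c, c ≠ x → c ≠ x' →
      (∃ a', a' ≠ c ∧ ∃ b', b' ≠ b ∧ G c b ∧ G a' b ∧ G c b' ∧ G a' b') →
        HasTouchingCycles G := by
    rintro c hcx hcx' ⟨c', hc', e, he, g1, g2, g3, g4⟩
    -- If the vertices opposite to b coincide, then x, x' and c are all joined to b and d. Otherwise
    -- the second cycle shares with the first an edge at b, if c' is x or x', or only the vertex b.
    by_cases hed : e = d
    · subst hed
      refine Or.inl ⟨![x, x', c], ![b, e], injective_three hx'.symm hcx.symm hcx'.symm,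
        injective_two he.symm, ?_⟩
      rintro ⟨i, j⟩ -
      fin_cases i <;> fin_cases j <;> simp_all
    by_cases hc'x : c' = x
    · subst hc'x
      refine Or.inr (Or.inl ⟨![c', x', c], ![b, d, e],
        injective_three hx'.symm hcx.symm hcx'.symm, injective_three hd.symm he.symm
          (Ne.symm hed), ?_⟩)
      simp [cyclesSharingEdge, *]
    by_cases hc'x' : c' = x'
    · subst hc'x'
      refine Or.inr (Or.inl ⟨![c', x, c], ![b, d, e],
        injective_three hx' hcx'.symm hcx.symm, injective_three hd.symm he.symm
          (Ne.symm hed), ?_⟩)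
      simp [cyclesSharingEdge, *]
    refine Or.inr (Or.inr ⟨![x, x', c, c'], ![b, d, e],
      injective_four hx'.symm hcx.symm hcx'.symm (Ne.symm hc'x) (Ne.symm hc'x') hc'.symm,
      injective_three hd.symm he.symm (Ne.symm hed), ?_⟩)
    simp [cyclesSharingVertex, *]
  -- At most one of y and z is the partner x' of x on its cycle; the other one lies outside that
  -- cycle.
  by_cases hyx' : y = x'
  · exact main z hxz.symm (by rw [← hyx']; exact hyz.symm) hz
  · exact main y hxy.symm hyx' hy

end Patterns

/-! ### Typical utilities make the procedure succeed -/

section Success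

variable {n : ℕ}

/-- The properties of the utilities that make threshold matching with removal successful, for
every threshold that is at least `1 - α`. -/
structure IsTypical (r : ℕ) (α τ : ℝ) (u : Fin n → Fin (r * n) → ℝ) : Prop where
  le_one : ∀ i j, u i j ≤ 1
  robustHall : RobustHall r fun i j => τ ≤ u i j
  not_hasTouchingCycles : r = 2 → ¬ HasTouchingCycles fun i j => 1 - 3 * α < u i j
  not_hasTouchingCycles_flip :
    r = 2 → ¬ HasTouchingCycles (flip fun i j => 1 - 3 * α < u i j)
  card_common : 3 ≤ r → ∀ i i', i ≠ i' →
    3 * (Finset.univ.filter fun j => 1 - 3 * α < u i j ∧ 1 - 3 * α < u i' j).card ≤ 2 * r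

/-- A removed edge ij comes with an agent i' who shares with i the item j and, in all, more than
2r/3 items that both value above 1 - 3α. For r ≥ 3 this is ruled out. For r = 2 there are at least
two shared items, so ij lies on a 4-cycle, and at most two edges are lost at each vertex. -/
theorem IsTypical.exists_isPerfectMatching {r : ℕ} {α τ : ℝ} {u : Fin n → Fin (r * n) → ℝ}
    (h : IsTypical r α τ u) (hr : 2 ≤ r) (hα : 0 < α) (hα' : 3 * α ≤ 1) (hτ : 1 - α ≤ τ)
    {C : Fin n → Finset (Fin (r * n))} (hC : IsCandidateFamily r τ u C) :
    ∃ A, IsPerfectMatching r C A := by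
  classical
  have key : ∀ i j, τ ≤ u i j → j ∉ C i → ∃ i', i' ≠ i ∧ 1 - 3 * α < u i j ∧
      1 - 3 * α < u i' j ∧ 2 * r <
        3 * (Finset.univ.filter fun j => 1 - 3 * α < u i j ∧ 1 - 3 * α < u i' j).card := by
    intro i j hj hjC
    obtain ⟨i', hi', S', hS', hjS', hlt, hmax⟩ :=
      (hC i).of_removed (Finset.mem_filter.2 ⟨Finset.mem_univ _, hj⟩) hjC
    have hcard := card_filter_of_lt_sumTop hα hα' (fun j _ => h.le_one i' j)
      (lt_of_le_of_lt (mul_le_mul_of_nonneg_left hτ (Nat.cast_nonneg r)) hlt)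
    refine ⟨i', by simpa using hi', by linarith, ?_, ?_⟩
    -- The removed item is one that i' values most at that moment, and some item then present has
    -- value above 1 - 3α for i'.
    · obtain ⟨k, hk⟩ := Finset.card_pos.1 (by omega :
        0 < (S'.filter fun j => 1 - 3 * α < u i' j).card)
      rw [Finset.mem_filter] at hk
      exact hk.2.trans_le (hmax k hk.1)
    · refine hcard.trans_le (Nat.mul_le_mul_left 3 (Finset.card_le_card fun k hk => ?_))
      rw [Finset.mem_filter] at hk
      have := (Finset.mem_filter.1 (hS' hk.1)).2
      exact Finset.mem_filter.2 ⟨Finset.mem_univ _, by linarith, hk.2⟩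
  refine h.robustHall.exists_isPerfectMatching C ?_ ?_ <;> rcases hr.eq_or_lt' with hr | hr
  · refine fun i => le_trans (Set.ncard_le_ncard ?_ (Set.toFinite _))
      (ncard_neighbors_on_cycles_le (h.not_hasTouchingCycles_flip hr) i)
    rintro j ⟨hj, hjC⟩
    obtain ⟨i', hi', h1, h2, h3⟩ := key i j hj hjC
    obtain ⟨j', hj', hne⟩ := Finset.exists_mem_ne
      (s := Finset.univ.filter fun j => 1 - 3 * α < u i j ∧ 1 - 3 * α < u i' j) (by omega) j
    have h4 := (Finset.mem_filter.1 hj').2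
    exact ⟨j', hne, i', hi', h1, h4.1, h2, h4.2⟩
  · refine fun i => le_of_eq_of_le ?_ (Nat.zero_le 2)
    rw [Set.ncard_eq_zero (Set.toFinite _), Set.eq_empty_iff_forall_notMem]
    rintro j ⟨hj, hjC⟩
    obtain ⟨i', hi', h1, h2, h3⟩ := key i j hj hjC
    exact absurd (h.card_common hr i i' hi'.symm) (by omega)
  · refine fun j => le_trans (Set.ncard_le_ncard ?_ (Set.toFinite _))
      (ncard_neighbors_on_cycles_le (h.not_hasTouchingCycles hr) j)
    rintro i ⟨hj, hjC⟩
    obtain ⟨i', hi', h1, h2, h3⟩ := key i j hj hjC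
    obtain ⟨j', hj', hne⟩ := Finset.exists_mem_ne
      (s := Finset.univ.filter fun j => 1 - 3 * α < u i j ∧ 1 - 3 * α < u i' j) (by omega) j
    have h4 := (Finset.mem_filter.1 hj').2
    exact ⟨i', hi', j', hne, h1, h2, h4.1, h4.2⟩
  · refine fun j => le_of_eq_of_le ?_ (Nat.zero_le 2)
    rw [Set.ncard_eq_zero (Set.toFinite _), Set.eq_empty_iff_forall_notMem]
    rintro i ⟨hj, hjC⟩
    obtain ⟨i', hi', h1, h2, h3⟩ := key i j hj hjC
    exact absurd (h.card_common hr i i' hi'.symm) (by omega)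

/-- The candidate sets depend on the threshold through the initial sets and the removals only, so
that a threshold may be raised to the next utility. -/
theorem IsTypical.raise_threshold {r : ℕ} {α τ τ' : ℝ} {u : Fin n → Fin (r * n) → ℝ}
    (h : IsTypical r α τ u) (hτ : ∀ i j, τ ≤ u i j ↔ τ' ≤ u i j) : IsTypical r α τ' u where
  le_one := h.le_one
  robustHall := by simpa only [hτ] using h.robustHall
  not_hasTouchingCycles := h.not_hasTouchingCycles
  not_hasTouchingCycles_flip := h.not_hasTouchingCycles_flip
  card_common := h.card_common

/-- The smallest utility that is at least `τ` serves the same purpose as the threshold `τ`. -/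
theorem IsTypical.exists_utility_threshold {r : ℕ} {α τ : ℝ} {u : Fin n → Fin (r * n) → ℝ}
    (h : IsTypical r α τ u) (hr : 0 < r) (hn : 0 < n) :
    ∃ i j, τ ≤ u i j ∧ IsTypical r α (u i j) u := by
  classical
  have hne : (Finset.univ.filter fun e : Fin n × Fin (r * n) => τ ≤ u e.1 e.2).Nonempty := by
    -- For the set of all agents, Y has r * 0 + 1 = 1 element; Hall's condition then says that some
    -- utility reaches τ.
    obtain ⟨i, -, j, -, -, hij⟩ := h.robustHall Finset.univ {⟨0, Nat.mul_pos hr hn⟩} ∅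
      ⟨⟨0, hn⟩, Finset.mem_univ _⟩ (by simp) (by simp) (by simp)
    exact ⟨(i, j), Finset.mem_filter.2 ⟨Finset.mem_univ _, hij⟩⟩
  obtain ⟨e, he, hmin⟩ := Finset.exists_min_image _ (fun e => u e.1 e.2) hne
  refine ⟨e.1, e.2, (Finset.mem_filter.1 he).2,
    h.raise_threshold fun i j => ⟨fun hij => ?_, fun hij => ?_⟩⟩
  · exact hmin (i, j) (Finset.mem_filter.2 ⟨Finset.mem_univ _, hij⟩)
  · exact (Finset.mem_filter.1 he).2.trans hij

end Success

/-! ### First moment bounds for random utilities -/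

section FirstMoment

variable {U : Measure ℝ} {n m : ℕ}

instance [IsProbabilityMeasure U] : IsProbabilityMeasure (utilityLaw U n m) := by
  unfold utilityLaw
  infer_instance

theorem utilityLaw_real_forall_mem [IsProbabilityMeasure U] (F : Finset (Fin n × Fin m))
    (B : Set ℝ) : (utilityLaw U n m).real {ω | ∀ e ∈ F, ω e ∈ B} = U.real B ^ F.card := by
  classical
  have h : {ω : Fin n × Fin m → ℝ | ∀ e ∈ F, ω e ∈ B}
      = Set.univ.pi fun e => if e ∈ F then B else Set.univ := by
    ext ω
    simp only [Set.mem_ofPred_eq, Set.mem_pi, Set.mem_univ, true_imp_iff]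
    refine forall_congr' fun e => ?_
    by_cases he : e ∈ F <;> simp [he]
  rw [h, measureReal_def, utilityLaw, Measure.pi_pi, ENNReal.toReal_prod]
  have h2 : ∀ e, (U (if e ∈ F then B else Set.univ)).toReal = if e ∈ F then U.real B else 1 := by
    intro e
    split_ifs <;> simp [measureReal_def]
  simp_rw [h2]
  rw [Finset.prod_ite_mem, Finset.univ_inter, Finset.prod_const]

/-- The union bound, for events that are indexed by a finite set. -/
theorem utilityLaw_real_exists_le [IsProbabilityMeasure U] {ι : Type*} (s : Finset ι)
    (Q : ι → (Fin n × Fin m → ℝ) → Prop) (c : ℝ)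
    (h : ∀ x ∈ s, (utilityLaw U n m).real {ω | Q x ω} ≤ c) :
    (utilityLaw U n m).real {ω | ∃ x ∈ s, Q x ω} ≤ s.card * c := by
  have h1 : {ω | ∃ x ∈ s, Q x ω} = ⋃ x ∈ s, {ω | Q x ω} := by
    ext ω
    simp
  rw [h1, ← nsmul_eq_mul]
  exact (measureReal_biUnion_finset_le s _).trans (Finset.sum_le_card_nsmul s _ c h)

theorem utilityLaw_real_mono [IsProbabilityMeasure U] {Q Q' : (Fin n × Fin m → ℝ) → Prop}
    (h : ∀ ω, Q ω → Q' ω) :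
    (utilityLaw U n m).real {ω | Q ω} ≤ (utilityLaw U n m).real {ω | Q' ω} :=
  measureReal_mono (fun ω hω => h ω hω)

theorem utilityLaw_real_or_le [IsProbabilityMeasure U] (Q Q' : (Fin n × Fin m → ℝ) → Prop) :
    (utilityLaw U n m).real {ω | Q ω ∨ Q' ω} ≤
      (utilityLaw U n m).real {ω | Q ω} + (utilityLaw U n m).real {ω | Q' ω} :=
  measureReal_union_le {ω | Q ω} {ω | Q' ω}

/-- Union bound over the placements of the pattern. Injectivity of the two vertex maps keeps its
edges distinct, so they are independent events. -/
theorem utilityLaw_real_containsCopy_le [IsProbabilityMeasure U] {a b : ℕ}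
    (E : Finset (Fin a × Fin b)) (B : Set ℝ) :
    (utilityLaw U n m).real {ω | ContainsCopy (fun i j => Function.curry ω i j ∈ B) E} ≤
      n ^ a * m ^ b * U.real B ^ E.card := by
  classical
  set s : Finset ((Fin a → Fin n) × (Fin b → Fin m)) :=
    Finset.univ.filter fun p => Function.Injective p.1 ∧ Function.Injective p.2
  have hs : (s.card : ℝ) ≤ n ^ a * m ^ b := by
    have := Finset.card_le_univ s
    simp only [Fintype.card_prod, Fintype.card_fun, Fintype.card_fin] at this
    exact_mod_cast this
  refine le_trans (utilityLaw_real_mono (Q' := fun ω => ∃ p ∈ s,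
    ∀ e ∈ E.image (Prod.map p.1 p.2), ω e ∈ B) ?_) ((utilityLaw_real_exists_le s _
      (U.real B ^ E.card) ?_).trans (mul_le_mul_of_nonneg_right hs (by positivity)))
  · rintro ω ⟨f, g, hf, hg, h⟩
    refine ⟨(f, g), Finset.mem_filter.2 ⟨Finset.mem_univ _, hf, hg⟩, ?_⟩
    intro e he
    obtain ⟨e', he', rfl⟩ := Finset.mem_image.1 he
    exact h e' he'
  · intro p hp
    have hp' := (Finset.mem_filter.1 hp).2
    rw [utilityLaw_real_forall_mem,
      Finset.card_image_of_injective _ (hp'.1.prodMap hp'.2)]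

/-- Union bound over pairs of agents and sets of k common items; each choice prescribes 2k
independent events. -/
theorem utilityLaw_real_common_le [IsProbabilityMeasure U] (k : ℕ) (B : Set ℝ)
    [DecidablePred (· ∈ B)] :
    (utilityLaw U n m).real {ω | ∃ i i', i ≠ i' ∧ k ≤ (Finset.univ.filter fun j =>
      Function.curry ω i j ∈ B ∧ Function.curry ω i' j ∈ B).card} ≤
      n ^ 2 * m.choose k * U.real B ^ (2 * k) := by
  classical
  set s : Finset ((Fin n × Fin n) × Finset (Fin m)) :=
    (Finset.univ.filter fun p => p.1 ≠ p.2) ×ˢ Finset.univ.powersetCard k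
  have hs : (s.card : ℝ) ≤ n ^ 2 * m.choose k := by
    have h1 := Finset.card_le_univ (Finset.univ.filter fun p : Fin n × Fin n => p.1 ≠ p.2)
    rw [Finset.card_product, Finset.card_powersetCard, Finset.card_univ, Fintype.card_fin]
    simp only [Fintype.card_prod, Fintype.card_fin] at h1
    rw [← sq] at h1
    exact_mod_cast Nat.mul_le_mul_right _ h1
  refine le_trans (utilityLaw_real_mono (Q' := fun ω => ∃ p ∈ s,
    ∀ e ∈ ({p.1.1, p.1.2} : Finset (Fin n)) ×ˢ p.2, ω e ∈ B) ?_) ((utilityLaw_real_exists_le s _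
      (U.real B ^ (2 * k)) ?_).trans (mul_le_mul_of_nonneg_right hs (by positivity)))
  · rintro ω ⟨i, i', hii, h⟩
    obtain ⟨K, hK, hKc⟩ := Finset.exists_subset_card_eq h
    refine ⟨((i, i'), K), ?_, ?_⟩
    · simp [s, hii, hKc]
    · rintro ⟨a, j⟩ he
      simp only [Finset.mem_product, Finset.mem_insert, Finset.mem_singleton] at he
      have h1 := (Finset.mem_filter.1 (hK he.2)).2
      rcases he.1 with rfl | rfl
      · exact h1.1
      · exact h1.2
  · intro p hp
    simp only [s, Finset.mem_product, Finset.mem_filter, Finset.mem_powersetCard] at hp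
    rw [utilityLaw_real_forall_mem, Finset.card_product, Finset.card_pair hp.1.2, hp.2.2]

theorem utilityLaw_real_not_le_one [IsProbabilityMeasure U] (hU : U (Set.Icc 0 1)ᶜ = 0) :
    (utilityLaw U n m).real {ω | ¬ ∀ e, ω e ∈ Set.Icc (0 : ℝ) 1} = 0 := by
  classical
  refine le_antisymm (le_trans (utilityLaw_real_mono (Q' := fun ω => ∃ e ∈ Finset.univ,
    ∀ e' ∈ ({e} : Finset (Fin n × Fin m)), ω e' ∈ (Set.Icc (0 : ℝ) 1)ᶜ) ?_)
      ((utilityLaw_real_exists_le _ _ 0 ?_).trans_eq (mul_zero _))) measureReal_nonneg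
  · intro ω h
    push Not at h
    obtain ⟨e, he⟩ := h
    exact ⟨e, Finset.mem_univ _, by simpa using he⟩
  · intro e _
    rw [utilityLaw_real_forall_mem]
    simp [measureReal_def, hU]

end FirstMoment

/-! ### The random graph satisfies Hall's condition robustly -/

section Hall

variable {U : Measure ℝ} {n r : ℕ}

/-- With y = r(n - x) + 1, w = min x y and L = log m, the term counts the choices of X, Y and at
most 2w exceptional edges, times the probability that all other pairs are non-edges. If a number z
bounds all exponents, the counting factors are at most m^(6z) together, and 32zL ≤ pxy. The total
exponent is then at most 6zL - 32zL + 2z ≤ -2L, using p ≤ 1 and L ≥ 1. -/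
theorem hall_term_le {x : ℕ} {p : ℝ} (hx : 1 ≤ x) (hxn : x ≤ n) (hr : 1 ≤ r)
    (hm : 3 ≤ r * n) (hp1 : p ≤ 1) (hp : 64 * Real.log (r * n : ℕ) / n ≤ p) :
    (n.choose x : ℝ) * (r * n).choose (r * (n - x) + 1) *
      ((n * (r * n) : ℕ) : ℝ) ^ (2 * min x (r * (n - x) + 1)) *
        Real.exp (-p * (x * (r * (n - x) + 1 : ℕ) - 2 * min x (r * (n - x) + 1) : ℝ)) ≤
      Real.exp (-2 * Real.log (r * n : ℕ)) := by
  obtain ⟨d, rfl⟩ := Nat.exists_eq_add_of_le hxn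
  rw [Nat.add_sub_cancel_left]
  set n := x + d with hn
  set m := r * n with hmdef
  set y := r * d + 1 with hy
  set L := Real.log (m : ℕ) with hL
  set w := min x y with hw
  have hm0 : (0 : ℝ) < m := by exact_mod_cast (by omega : 0 < m)
  have hn0 : (0 : ℝ) < n := by exact_mod_cast (by omega : 0 < n)
  have hexp : ∀ k : ℕ, (m : ℝ) ^ k = Real.exp (k * L) := by
    intro k
    rw [Real.exp_nat_mul, hL, Real.exp_log hm0]
  have hL1 : 1 ≤ L := by
    rw [hL, Real.le_log_iff_exp_le hm0]
    have : (3 : ℝ) ≤ m := by exact_mod_cast hm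
    linarith [Real.exp_one_lt_d9]
  have hnm : n ≤ m := by rw [hmdef]; exact Nat.le_mul_of_pos_left n hr
  have hmd : m = r * x + r * d := by rw [hmdef, hn]; ring
  have hp0 : 0 ≤ p := le_trans (by positivity) hp
  have hpn : 64 * L ≤ p * n := by rwa [div_le_iff₀ hn0] at hp
  -- Up to symmetry of the binomial coefficients the smaller half counts. If x ≤ n - x, take z = rx,
  -- since m - y = rx - 1 and y ≥ m/2. Otherwise take z = y, since n - x ≤ y and x ≥ n/2.
  obtain ⟨z, hz1, hxz, hyz, hwz, hpz⟩ : ∃ z : ℕ, 1 ≤ z ∧ n.choose x ≤ m ^ z ∧ m.choose y ≤ m ^ z ∧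
      w ≤ z ∧ 32 * z * L ≤ p * (x * y) := by
    by_cases hxd : x ≤ d
    · have hxr : x ≤ r * x := Nat.le_mul_of_pos_left x hr
      refine ⟨r * x, by omega, ?_, ?_, (min_le_left _ _).trans hxr, ?_⟩
      · exact (Nat.choose_le_pow _ _).trans ((Nat.pow_le_pow_left hnm x).trans
          (Nat.pow_le_pow_right (by omega) hxr))
      · rw [← Nat.choose_symm (by omega)]
        exact (Nat.choose_le_pow _ _).trans (Nat.pow_le_pow_right (by omega) (by omega))
      · have h1 : r * n ≤ 2 * y := by
          have : r * x ≤ r * d := Nat.mul_le_mul_left r hxd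
          rw [hn, hy, mul_add]; omega
        have h2 : (r : ℝ) * n ≤ 2 * y := by exact_mod_cast h1
        push_cast
        calc 32 * (r * x : ℝ) * L = (r * x) * (64 * L) / 2 := by ring
          _ ≤ (r * x) * (p * n) / 2 := by gcongr
          _ = p * x * (r * n) / 2 := by ring
          _ ≤ p * x * (2 * y) / 2 := by gcongr
          _ = p * (x * y) := by ring
    · have hdy : d ≤ y := by
        have : d ≤ r * d := Nat.le_mul_of_pos_left d hr
        omega
      refine ⟨y, by omega, ?_, Nat.choose_le_pow _ _, min_le_right _ _, ?_⟩
      · rw [← Nat.choose_symm hxn, hn, Nat.add_sub_cancel_left]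
        exact (Nat.choose_le_pow _ _).trans ((Nat.pow_le_pow_left hnm d).trans
          (Nat.pow_le_pow_right (by omega) hdy))
      · have h2 : (n : ℝ) ≤ 2 * x := by exact_mod_cast (by omega : n ≤ 2 * x)
        calc 32 * (y : ℝ) * L = y * (64 * L) / 2 := by ring
          _ ≤ y * (p * n) / 2 := by gcongr
          _ ≤ y * (p * (2 * x)) / 2 := by gcongr
          _ = p * (x * y) := by ring
  have hz1' : (1 : ℝ) ≤ z := by exact_mod_cast hz1
  have hwz' : (w : ℝ) ≤ z := by exact_mod_cast hwz
  have e1 : (n.choose x : ℝ) ≤ Real.exp (z * L) := by rw [← hexp]; exact_mod_cast hxz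
  have e2 : (m.choose y : ℝ) ≤ Real.exp (z * L) := by rw [← hexp]; exact_mod_cast hyz
  have e3 : ((n * m : ℕ) : ℝ) ^ (2 * w) ≤ Real.exp ((4 * z : ℕ) * L) := by
    rw [← hexp]
    have : (n * m) ^ (2 * w) ≤ m ^ (4 * z) := by
      calc (n * m) ^ (2 * w) ≤ (m * m) ^ (2 * w) :=
            Nat.pow_le_pow_left (Nat.mul_le_mul_right m hnm) _
        _ = m ^ (4 * w) := by rw [← sq, ← pow_mul]; congr 1; ring
        _ ≤ m ^ (4 * z) := Nat.pow_le_pow_right (by omega) (by omega)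
    exact_mod_cast this
  calc _ ≤ Real.exp (z * L) * Real.exp (z * L) * Real.exp ((4 * z : ℕ) * L) *
        Real.exp (-p * (x * y - 2 * w)) := by
        gcongr
    _ = Real.exp (6 * (z * L) - p * (x * y) + 2 * (p * w)) := by
        rw [← Real.exp_add, ← Real.exp_add, ← Real.exp_add]
        congr 1
        push_cast
        ring
    _ ≤ Real.exp (-2 * L) := by
        apply Real.exp_le_exp.2
        have h1 : p * w ≤ z := by
          calc p * w ≤ 1 * w := by gcongr
            _ ≤ z := by linarith
        have h2 : (z : ℝ) ≤ z * L := le_mul_of_one_le_right (by positivity) hL1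
        have h3 : L ≤ z * L := le_mul_of_one_le_left (by positivity) hz1'
        nlinarith

/-- Sets of at most k exceptional edges are dominated by ranges of functions on `Fin k`, which are
easily counted. -/
theorem exists_fun_range_superset {α : Type*} [DecidableEq α] [Nonempty α] (R : Finset α) {k : ℕ}
    (h : R.card ≤ k) : ∃ g : Fin k → α, R ⊆ Finset.univ.image g := by
  classical
  refine ⟨fun i => if hi : i.1 < R.card then (R.equivFin.symm ⟨i, hi⟩).1 else
    Classical.arbitrary α, fun a ha => ?_⟩
  refine Finset.mem_image.2 ⟨⟨(R.equivFin ⟨a, ha⟩).1, (R.equivFin ⟨a, ha⟩).2.trans_le h⟩,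
    Finset.mem_univ _, ?_⟩
  simp

/-- Fix X, Y and a list of w pairs that covers R. At least xy - w other pairs of the rectangle have
values below τ, independently and each with probability 1 - p ≤ e^(-p). -/
theorem utilityLaw_real_sparse_rectangle_le [IsProbabilityMeasure U] {m : ℕ} (τ : ℝ)
    (hn : 0 < n) (hm : 0 < m) (x y w : ℕ) :
    (utilityLaw U n m).real {ω | ∃ (X : Finset (Fin n)) (Y : Finset (Fin m))
      (R : Finset (Fin n × Fin m)), X.card = x ∧ Y.card = y ∧ R.card ≤ w ∧
        ∀ i ∈ X, ∀ j ∈ Y, (i, j) ∉ R → ¬ τ ≤ Function.curry ω i j} ≤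
      (n.choose x : ℝ) * m.choose y * ((n * m : ℕ) : ℝ) ^ w *
        Real.exp (-U.real (Set.Ici τ) * (x * y - w)) := by
  classical
  have : Nonempty (Fin n × Fin m) := ⟨⟨0, hn⟩, ⟨0, hm⟩⟩
  set p := U.real (Set.Ici τ) with hpdef
  have hp0 : 0 ≤ p := measureReal_nonneg
  have hp1 : p ≤ 1 := measureReal_le_one
  have hq : U.real (Set.Iio τ) = 1 - p := by
    rw [hpdef, ← Set.compl_Ici, measureReal_compl measurableSet_Ici]
    simp
  set s : Finset ((Finset (Fin n) × Finset (Fin m)) × (Fin w → Fin n × Fin m)) :=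
    (Finset.univ.powersetCard x ×ˢ Finset.univ.powersetCard y) ×ˢ Finset.univ with hs
  have hscard : (s.card : ℝ) = n.choose x * m.choose y * ((n * m : ℕ) : ℝ) ^ w := by
    rw [hs]
    simp only [Finset.card_product, Finset.card_powersetCard, Finset.card_univ, Fintype.card_fun,
      Fintype.card_prod, Fintype.card_fin]
    push_cast
    ring
  rw [← hscard]
  refine le_trans (utilityLaw_real_mono (Q' := fun ω => ∃ t ∈ s,
    ∀ e ∈ (t.1.1 ×ˢ t.1.2) \ Finset.univ.image t.2, ω e ∈ Set.Iio τ) ?_)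
      (utilityLaw_real_exists_le s _ _ ?_)
  · rintro ω ⟨X, Y, R, hX, hY, hR, h⟩
    obtain ⟨g, hg⟩ := exists_fun_range_superset R hR
    refine ⟨((X, Y), g), by simp [hs, hX, hY], ?_⟩
    rintro ⟨i, j⟩ he
    rw [Finset.mem_sdiff, Finset.mem_product] at he
    exact not_le.1 (h i he.1.1 j he.1.2 fun hR => he.2 (hg hR))
  · rintro t ht
    simp only [hs, Finset.mem_product, Finset.mem_powersetCard] at ht
    rw [utilityLaw_real_forall_mem, hq]
    set k := ((t.1.1 ×ˢ t.1.2) \ Finset.univ.image t.2).card with hk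
    have hcard : (x * y : ℝ) - w ≤ k := by
      have h1 := Finset.le_card_sdiff (Finset.univ.image t.2) (t.1.1 ×ˢ t.1.2)
      have h2 : (Finset.univ.image t.2).card ≤ w := by
        simpa using Finset.card_image_le (s := Finset.univ) (f := t.2)
      rw [Finset.card_product, ht.1.1.2, ht.1.2.2, ← hk] at h1
      have h3 : x * y ≤ k + w := by omega
      have h4 : (x * y : ℝ) ≤ k + w := by exact_mod_cast h3
      linarith
    calc (1 - p) ^ k ≤ Real.exp (-p) ^ k := by
          gcongr
          exact Real.one_sub_le_exp_neg p
      _ = Real.exp (-p * k) := by rw [← Real.exp_nat_mul, mul_comm]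
      _ ≤ _ := by
          apply Real.exp_le_exp.2
          nlinarith

/-- A random bipartite graph with edge probability at least `64 log m / n` satisfies Hall's
condition robustly. -/
theorem utilityLaw_real_not_robustHall_le [IsProbabilityMeasure U] {τ : ℝ} (hn : 0 < n)
    (hr : 1 ≤ r) (hm : 3 ≤ r * n)
    (hp : 64 * Real.log (r * n : ℕ) / n ≤ U.real (Set.Ici τ)) :
    (utilityLaw U n (r * n)).real
      {ω | ¬ RobustHall r fun i j => τ ≤ Function.curry ω i j} ≤ 1 / n := by
  refine le_trans (utilityLaw_real_mono (Q' := fun ω => ∃ x ∈ Finset.Icc 1 n,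
    ∃ (X : Finset (Fin n)) (Y : Finset (Fin (r * n))) (R : Finset (Fin n × Fin (r * n))),
      X.card = x ∧ Y.card = r * (n - x) + 1 ∧ R.card ≤ 2 * min x (r * (n - x) + 1) ∧
        ∀ i ∈ X, ∀ j ∈ Y, (i, j) ∉ R → ¬ τ ≤ Function.curry ω i j) ?_)
      ((utilityLaw_real_exists_le _ _ (Real.exp (-2 * Real.log (r * n : ℕ))) ?_).trans ?_)
  · intro ω h
    unfold RobustHall at h
    push Not at h
    obtain ⟨X, Y, R, hX, hY, hR, hR', h⟩ := h
    refine ⟨X.card, Finset.mem_Icc.2 ⟨hX.card_pos, by simpa using X.card_le_univ⟩, X, Y, R, rfl, hY,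
      by omega, fun i hi j hj hij => not_le.2 (h i hi j hj hij)⟩
  · intro x hx
    rw [Finset.mem_Icc] at hx
    refine (utilityLaw_real_sparse_rectangle_le τ hn (by omega) _ _ _).trans
      (le_trans (le_of_eq ?_) (hall_term_le hx.1 hx.2 hr hm measureReal_le_one hp))
    push_cast
    rfl
  -- There are n values of x with a bound m^(-2) each, and n ≤ m.
  · have hn' : (0 : ℝ) < n := by exact_mod_cast hn
    have hm' : (0 : ℝ) < (r * n : ℕ) := by exact_mod_cast (by omega : 0 < r * n)
    have hnm : (n : ℝ) ≤ (r * n : ℕ) := by exact_mod_cast Nat.le_mul_of_pos_left n hr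
    have : Real.exp (-2 * Real.log (r * n : ℕ)) = 1 / ((r * n : ℕ) : ℝ) ^ 2 := by
      rw [show -2 * Real.log (r * n : ℕ) = -((2 : ℕ) * Real.log (r * n : ℕ)) by push_cast; ring,
        Real.exp_neg, Real.exp_nat_mul, Real.exp_log hm', one_div]
    rw [this, Nat.card_Icc, Nat.add_sub_cancel, mul_one_div, div_le_div_iff₀ (by positivity) hn']
    nlinarith

end Hall

/-! ### Typical utilities are likely, in terms of N = n^(1/10) -/

section Typical

variable {U : Measure ℝ} {n : ℕ}

/-- The expected number of copies of a pattern with v = a + b vertices and v + 1 edges has order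
N^(10v - 9(v + 1)) = N^(v - 9), and v ≤ 7. The three patterns of touching cycles have 5, 6 and 7
vertices. -/
theorem utilityLaw_real_containsCopy_le' [IsProbabilityMeasure U] {a b : ℕ}
    {E : Finset (Fin a × Fin b)} {B : Set ℝ} {N l : ℝ} (hN : 1 ≤ N) (hn : (n : ℝ) = N ^ 10)
    (hB : U.real B ≤ l / N ^ 9) (hE : E.card = a + b + 1) (hab : a + b ≤ 7) :
    (utilityLaw U n (2 * n)).real
      {ω | ContainsCopy (fun i j => Function.curry ω i j ∈ B) E} ≤
        2 ^ b * l ^ (a + b + 1) / N ^ 2 := by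
  refine (utilityLaw_real_containsCopy_le E B).trans ?_
  have hl : 0 ≤ l := by
    have h := measureReal_nonneg.trans hB
    by_contra! h'
    exact absurd h (not_le.2 (div_neg_of_neg_of_pos h' (by positivity)))
  rw [hE]
  push_cast
  rw [hn]
  calc (N ^ 10) ^ a * (2 * N ^ 10) ^ b * U.real B ^ (a + b + 1)
      ≤ (N ^ 10) ^ a * (2 * N ^ 10) ^ b * (l / N ^ 9) ^ (a + b + 1) := by gcongr
    _ = 2 ^ b * l ^ (a + b + 1) * N ^ (10 * a + 10 * b) / N ^ (9 * (a + b + 1)) := by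
        rw [div_pow, ← pow_mul, mul_pow, ← pow_mul, ← pow_mul, pow_add N]
        ring
    _ ≤ 2 ^ b * l ^ (a + b + 1) / N ^ 2 := by
        rw [div_le_div_iff₀ (by positivity) (by positivity), mul_assoc, ← pow_add]
        have := pow_le_pow_right₀ hN (by omega : 10 * a + 10 * b + 2 ≤ 9 * (a + b + 1))
        gcongr

/-- This is k! ≥ (k/e)^k together with e < 3. With m = rn and k of order r, the base is of order n
for every r, which makes the next bound uniform in r. -/
theorem choose_le_mul_pow {m k : ℕ} {x : ℝ} (hk : 0 < k) (hm : (m : ℝ) ≤ x * k) :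
    (m.choose k : ℝ) ≤ (3 * x) ^ k := by
  have hk' : (0 : ℝ) < k := by exact_mod_cast hk
  have hx : 0 ≤ x := nonneg_of_mul_nonneg_left ((Nat.cast_nonneg m).trans hm) hk'
  have hf : (0 : ℝ) < k.factorial := by exact_mod_cast k.factorial_pos
  calc (m.choose k : ℝ) ≤ (m : ℝ) ^ k / k.factorial := Nat.choose_le_pow_div k m
    _ ≤ (x * k) ^ k / k.factorial := by gcongr
    _ = x ^ k * ((k : ℝ) ^ k / k.factorial) := by rw [mul_pow]; ring
    _ ≤ x ^ k * Real.exp k := by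
        gcongr
        exact Real.pow_div_factorial_le_exp _ hk'.le k
    _ = x ^ k * Real.exp 1 ^ k := by rw [← Real.exp_nat_mul, mul_one]
    _ ≤ x ^ k * 3 ^ k := by
        gcongr
        linarith [Real.exp_one_lt_d9]
    _ = (3 * x) ^ k := by rw [mul_pow, mul_comm]

/-- The union bound is N^20 (5l² / N^8)^k with k > 2r/3. As r ≥ 3 forces k ≥ 3 and the base is at
most 1, this is at most 125 l^6 / N^4. For r = 2 only k = 2 would be available, which is not enough.
-/
theorem utilityLaw_real_common_le' [IsProbabilityMeasure U] {r : ℕ} {B : Set ℝ}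
    [DecidablePred (· ∈ B)] {N l : ℝ} (hN : 1 ≤ N)
    (hn : (n : ℝ) = N ^ 10) (hB : U.real B ≤ l / N ^ 9) (hr : 3 ≤ r) (hl : 5 * l ^ 2 ≤ N ^ 8) :
    (utilityLaw U n (r * n)).real {ω | ∃ i i', i ≠ i' ∧ 2 * r < 3 * (Finset.univ.filter fun j =>
      Function.curry ω i j ∈ B ∧ Function.curry ω i' j ∈ B).card} ≤ 125 * l ^ 6 / N ^ 2 := by
  have hl0 : 0 ≤ l := by
    have h := measureReal_nonneg.trans hB
    by_contra! h'
    exact absurd h (not_le.2 (div_neg_of_neg_of_pos h' (by positivity)))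
  set k := 2 * r / 3 + 1 with hk
  have hrk : 2 * r ≤ 3 * k := by omega
  have hrk' : (2 * r : ℝ) ≤ 3 * k := by exact_mod_cast hrk
  have hm : ((r * n : ℕ) : ℝ) ≤ (3 / 2 * N ^ 10) * k := by
    push_cast
    rw [hn]
    have : (0 : ℝ) ≤ N ^ 10 := by positivity
    nlinarith
  refine le_trans (utilityLaw_real_mono ?_) ((utilityLaw_real_common_le k B).trans ?_)
  · rintro ω ⟨i, i', h, hc⟩
    exact ⟨i, i', h, by omega⟩
  · rw [hn]
    have h1 : 5 * l ^ 2 / N ^ 8 ≤ 1 := div_le_one_of_le₀ hl (by positivity)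
    calc (N ^ 10) ^ 2 * ((r * n).choose k : ℝ) * U.real B ^ (2 * k)
        ≤ (N ^ 10) ^ 2 * (3 * (3 / 2 * N ^ 10)) ^ k * (l / N ^ 9) ^ (2 * k) := by
          gcongr
          exact choose_le_mul_pow (by omega) hm
      -- The factor 3 * (3/2) is rounded up to 5.
      _ ≤ (N ^ 10) ^ 2 * (5 * N ^ 10) ^ k * (l / N ^ 9) ^ (2 * k) := by
          gcongr (N ^ 10) ^ 2 * ?_ ^ k * (l / N ^ 9) ^ (2 * k)
          nlinarith [pow_pos (zero_lt_one.trans_le hN) 10]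
      _ = N ^ 20 * (5 * l ^ 2 / N ^ 8) ^ k := by
          rw [pow_mul (l / N ^ 9), mul_assoc, ← mul_pow, ← pow_mul]
          congr 2
          have : N ≠ 0 := by positivity
          field_simp
      _ ≤ N ^ 20 * (5 * l ^ 2 / N ^ 8) ^ 3 := by
          gcongr N ^ 20 * ?_
          exact pow_le_pow_of_le_one (by positivity) h1 (by omega)
      _ = 125 * l ^ 6 / N ^ 4 := by
          have : N ≠ 0 := by positivity
          field_simp
          ring
      _ ≤ 125 * l ^ 6 / N ^ 2 := by
          gcongr 125 * l ^ 6 / ?_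
          exact pow_le_pow_right₀ hN (by omega)

theorem utilityLaw_real_hasTouchingCycles_le [IsProbabilityMeasure U] {B : Set ℝ} {N l : ℝ}
    (hN : 1 ≤ N) (hn : (n : ℝ) = N ^ 10) (hB : U.real B ≤ l / N ^ 9) :
    (utilityLaw U n (2 * n)).real
      {ω | HasTouchingCycles (fun i j => Function.curry ω i j ∈ B) ∨
        HasTouchingCycles (flip fun i j => Function.curry ω i j ∈ B)} ≤
      (12 * l ^ 6 + 16 * l ^ 7 + 24 * l ^ 8) / N ^ 2 := by
  have h1 : (utilityLaw U n (2 * n)).real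
      {ω | HasTouchingCycles (fun i j => Function.curry ω i j ∈ B)} ≤
        2 ^ 2 * l ^ 6 / N ^ 2 + (2 ^ 3 * l ^ 7 / N ^ 2 + 2 ^ 3 * l ^ 8 / N ^ 2) :=
    (utilityLaw_real_or_le _ _).trans <| add_le_add
      (utilityLaw_real_containsCopy_le' hN hn hB rfl (by norm_num)) <|
      (utilityLaw_real_or_le _ _).trans <| add_le_add
        (utilityLaw_real_containsCopy_le' hN hn hB rfl (by norm_num))
        (utilityLaw_real_containsCopy_le' hN hn hB rfl (by norm_num))
  have h2 : (utilityLaw U n (2 * n)).real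
      {ω | HasTouchingCycles (flip fun i j => Function.curry ω i j ∈ B)} ≤
        2 ^ 3 * l ^ 6 / N ^ 2 + (2 ^ 3 * l ^ 7 / N ^ 2 + 2 ^ 4 * l ^ 8 / N ^ 2) := by
    refine le_trans (utilityLaw_real_mono (Q' := fun ω => _ ∨ _ ∨ _)
      fun ω h => h.imp ContainsCopy.of_flip (Or.imp ContainsCopy.of_flip ContainsCopy.of_flip)) ?_
    exact (utilityLaw_real_or_le _ _).trans <| add_le_add
      (utilityLaw_real_containsCopy_le' hN hn hB rfl (by norm_num)) <|
      (utilityLaw_real_or_le _ _).trans <| add_le_add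
        (utilityLaw_real_containsCopy_le' hN hn hB rfl (by norm_num))
        (utilityLaw_real_containsCopy_le' hN hn hB rfl (by norm_num))
  refine (utilityLaw_real_or_le _ _).trans ((add_le_add h1 h2).trans_eq ?_)
  ring

theorem utilityLaw_real_not_isTypical_le [IsProbabilityMeasure U] {r : ℕ} {α N l : ℝ}
    (hU : U (Set.Icc 0 1)ᶜ = 0) (hN : 1 ≤ N) (hn : (n : ℝ) = N ^ 10)
    (hB : U.real (Set.Ioi (1 - 3 * α)) ≤ l / N ^ 9) (hl : 5 * l ^ 2 ≤ N ^ 8) (hr : 2 ≤ r)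
    (hm : 3 ≤ r * n) (hp : 64 * Real.log (r * n : ℕ) / n ≤ U.real (Set.Ici (1 - α))) :
    (utilityLaw U n (r * n)).real {ω | ¬ IsTypical r α (1 - α) (Function.curry ω)} ≤
      (1 + 12 * l ^ 6 + 16 * l ^ 7 + 24 * l ^ 8 + 125 * l ^ 6) / N ^ 2 := by
  classical
  have hl0 : 0 ≤ l := by
    have h := measureReal_nonneg.trans hB
    by_contra! h'
    exact absurd h (not_le.2 (div_neg_of_neg_of_pos h' (by positivity)))
  have hn0 : 0 < n := Nat.pos_of_ne_zero fun h => by simp [h] at hm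
  have hN2 : (1 : ℝ) / n ≤ 1 / N ^ 2 := by
    rw [hn]
    gcongr 1 / ?_
    exact pow_le_pow_right₀ hN (by norm_num)
  have h1 : (utilityLaw U n (r * n)).real {ω | r = 2 ∧
      (HasTouchingCycles (fun i j => Function.curry ω i j ∈ Set.Ioi (1 - 3 * α)) ∨
        HasTouchingCycles (flip fun i j => Function.curry ω i j ∈ Set.Ioi (1 - 3 * α)))} ≤
      (12 * l ^ 6 + 16 * l ^ 7 + 24 * l ^ 8) / N ^ 2 := by
    by_cases h : r = 2
    · subst h
      simpa only [true_and] using utilityLaw_real_hasTouchingCycles_le hN hn hB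
    · simp only [h, false_and, Set.ofPred_false, measureReal_empty]
      positivity
  have h2 : (utilityLaw U n (r * n)).real {ω | 3 ≤ r ∧
      ∃ i i', i ≠ i' ∧ 2 * r < 3 * (Finset.univ.filter fun j =>
        Function.curry ω i j ∈ Set.Ioi (1 - 3 * α) ∧
          Function.curry ω i' j ∈ Set.Ioi (1 - 3 * α)).card} ≤ 125 * l ^ 6 / N ^ 2 := by
    by_cases h : 3 ≤ r
    · simpa only [h, true_and] using utilityLaw_real_common_le' hN hn hB h hl
    · simp only [h, false_and, Set.ofPred_false, measureReal_empty]
      positivity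
  have h3 := utilityLaw_real_not_robustHall_le hn0 (by omega) hm hp
  have h4 := utilityLaw_real_not_le_one (n := n) (m := r * n) hU
  refine le_trans (utilityLaw_real_mono (Q' := fun ω => _ ∨ _ ∨ _ ∨ _) ?_)
    ((utilityLaw_real_or_le _ _).trans <| (add_le_add h4.le <| (utilityLaw_real_or_le _ _).trans <|
      add_le_add h3 <| (utilityLaw_real_or_le _ _).trans <| add_le_add h1 h2).trans ?_)
  · intro ω h
    by_contra! hc
    obtain ⟨c1, c2, c3, c4⟩ := hc
    refine h ⟨fun i j => (c1 (i, j)).2, c2, fun hr => ?_, fun hr => ?_,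
      fun hr i i' hii => ?_⟩
    · exact fun h' => (c3 hr).1 h'
    · exact fun h' => (c3 hr).2 h'
    · exact c4 hr i i' hii
  · rw [zero_add]
    refine (add_le_add_left hN2 _).trans_eq ?_
    ring

end Typical

/-! ### The threshold of the theorem -/

section Asymptotics

/-- The distance of the threshold to 1. -/
noncomputable def thresholdGap (θ q : ℝ) (n r : ℕ) : ℝ :=
  (64 * Real.log (r * n : ℕ) / (θ * n)) ^ (1 / q)

theorem tendsto_rpow_tenth : Tendsto (fun n : ℕ => (n : ℝ) ^ (0.1 : ℝ)) atTop atTop :=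
  (tendsto_rpow_atTop (by norm_num)).comp tendsto_natCast_atTop_atTop

/-- For r ≤ e^N we have log m ≤ 2N for large n, so α^q is at most a constant times N^(-9), and so is
the probability of a value above 1 - 3α. The error bound f depends on n only: r(n) may lie on either
side of e^N for different n. -/
theorem eventually_isTypical {U : Measure ℝ} {θl θu q : ℝ} (hU : IsUtilityDistribution U)
    (hθl : 0 < θl) (hq : 0 < q) (hl : PolyBoundedBelowAtOne U θl q)
    (hu : PolyBoundedAboveAtOne U θu q) :
    ∃ f : ℕ → ℝ, Tendsto f atTop (𝓝 0) ∧ ∀ᶠ n : ℕ in atTop, ∀ r : ℕ, 2 ≤ r →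
      (r : ℝ) ≤ Real.exp ((n : ℝ) ^ (0.1 : ℝ)) →
        0 < thresholdGap θl q n r ∧ 3 * thresholdGap θl q n r ≤ 1 ∧
          (utilityLaw U n (r * n)).real {ω | ¬ IsTypical r (thresholdGap θl q n r)
            (threshold θl q n r) (Function.curry ω)} ≤ f n := by
  have := hU.1
  -- P[u > 1 - 3α] ≤ θu 3^q α^q, and α^q = 64 log m / (θl n) ≤ 128 N / (θl N^10).
  set l := θu * 3 ^ q * 128 / θl with hldef
  refine ⟨fun n => (1 + 12 * l ^ 6 + 16 * l ^ 7 + 24 * l ^ 8 + 125 * l ^ 6) /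
    ((n : ℝ) ^ (0.1 : ℝ)) ^ 2, ?_, ?_⟩
  · exact tendsto_const_nhds.div_atTop
      ((tendsto_pow_atTop (by norm_num)).comp tendsto_rpow_tenth)
  have hlog : ∀ᶠ n : ℕ in atTop, Real.log n ≤ (n : ℝ) ^ (0.1 : ℝ) := by
    have h := (isLittleO_log_rpow_atTop (by norm_num : (0 : ℝ) < 0.1)).bound zero_lt_one
    filter_upwards [tendsto_natCast_atTop_atTop.eventually h] with n hn
    rw [one_mul, Real.norm_eq_abs, Real.norm_eq_abs,
      abs_of_nonneg (by positivity : (0 : ℝ) ≤ (n : ℝ) ^ (0.1 : ℝ))] at hn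
    exact (le_abs_self _).trans hn
  filter_upwards [hlog, eventually_ge_atTop 2, tendsto_rpow_tenth.eventually_ge_atTop 1,
    tendsto_rpow_tenth.eventually_ge_atTop (5 * l ^ 2),
    tendsto_rpow_tenth.eventually_ge_atTop (128 * 3 ^ q / θl)] with n hn1 hn2 hn3 hn4 hn5
  intro r hr hr'
  set N := (n : ℝ) ^ (0.1 : ℝ) with hN
  have hnN : (n : ℝ) = N ^ 10 := by
    rw [hN, ← Real.rpow_natCast, ← Real.rpow_mul (by positivity)]
    norm_num
  have hn0 : (0 : ℝ) < n := by exact_mod_cast (by omega : 0 < n)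
  have hr0 : (0 : ℝ) < r := by exact_mod_cast (by omega : 0 < r)
  set L := Real.log (r * n : ℕ) with hL
  have hm : 3 ≤ r * n := by nlinarith
  have hLpos : 0 < L := Real.log_pos (by exact_mod_cast (by omega : 1 < r * n))
  have hLN : L ≤ 2 * N := by
    rw [hL, Nat.cast_mul, Real.log_mul hr0.ne' hn0.ne']
    have := (Real.log_le_iff_le_exp hr0).2 hr'
    linarith
  set α := thresholdGap θl q n r with hα
  have hbase : 0 < 64 * L / (θl * n) := by positivity
  have hα0 : 0 < α := Real.rpow_pos_of_pos hbase _
  have hαq : α ^ q = 64 * L / (θl * n) := by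
    rw [hα, thresholdGap, ← Real.rpow_mul hbase.le, one_div_mul_cancel hq.ne', Real.rpow_one]
  have hαq' : α ^ q ≤ 128 / θl / N ^ 9 := by
    rw [hαq, hnN]
    calc 64 * L / (θl * N ^ 10) ≤ 64 * (2 * N) / (θl * N ^ 10) := by gcongr
      _ = 128 / θl / N ^ 9 := by field_simp; norm_num
  have hNpow : ∀ k : ℕ, k ≠ 0 → N ≤ N ^ k := fun k hk => le_self_pow₀ hn3 hk
  have h3α : 3 * α ≤ 1 := by
    rw [← Real.rpow_le_rpow_iff (by positivity) zero_le_one hq, Real.one_rpow,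
      Real.mul_rpow (by norm_num) hα0.le]
    calc (3 : ℝ) ^ q * α ^ q ≤ 3 ^ q * (128 / θl / N ^ 9) := by gcongr
      _ = (128 * 3 ^ q / θl) / N ^ 9 := by ring
      _ ≤ 1 := div_le_one_of_le₀ (hn5.trans (hNpow 9 (by norm_num))) (by positivity)
  have hα1 : α ≤ 1 := by linarith
  refine ⟨hα0, h3α, ?_⟩
  refine utilityLaw_real_not_isTypical_le hU.2 hn3 hnN ?_ (hn4.trans (hNpow 8 (by norm_num))) hr hm
    ?_
  · refine (hu (3 * α) ⟨by linarith, h3α⟩).trans ?_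
    have hθu : 0 ≤ θu := by
      have h := measureReal_nonneg.trans (hu 1 ⟨one_pos, le_rfl⟩)
      simpa using h
    rw [Real.mul_rpow (by norm_num) hα0.le]
    calc θu * (3 ^ q * α ^ q) ≤ θu * (3 ^ q * (128 / θl / N ^ 9)) := by gcongr
      _ = l / N ^ 9 := by rw [hldef]; ring
  -- The threshold is chosen so that the lower bound on the tail is exactly the edge probability
  -- that Hall's condition needs.
  · calc 64 * L / n = θl * α ^ q := by rw [hαq]; field_simp
      _ ≤ U.real (Set.Ioi (1 - α)) := hl α ⟨hα0, hα1⟩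
      _ ≤ U.real (Set.Ici (1 - α)) := measureReal_mono Set.Ioi_subset_Ici_self

end Asymptotics

/-! ### The allocation by trades in blocks -/

section BlockAllocation

variable {n r : ℕ}

/-- Item `k` of block `b`; each block consists of `n` items. -/
def blockItem (b : Fin r) (k : Fin n) : Fin (r * n) := finProdFinEquiv (b, k)

theorem blockItem_val (b : Fin r) (k : Fin n) : (blockItem b k : ℕ) = k + n * b := rfl

theorem blockItem_injective {b b' : Fin r} {k k' : Fin n} (h : blockItem b k = blockItem b' k') :
    b = b' ∧ k = k' := by
  simpa [blockItem] using h

/-- The agents who trade in block `b`; all pairs have their turns periodically. -/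
def tradingPair (hn : 0 < n) (b : ℕ) : Fin n × Fin n :=
  (⟨b / n % n, Nat.mod_lt _ hn⟩, ⟨b % n, Nat.mod_lt _ hn⟩)

open Classical in
/-- In block `b` every agent is assigned one item; the first agent of the trading pair exchanges
her item for that of the second if she prefers that. -/
noncomputable def blockPerm (hn : 0 < n) (u : Fin n → Fin (r * n) → ℝ) (b : Fin r) :
    Equiv.Perm (Fin n) :=
  let p := tradingPair hn b
  if u p.1 (blockItem b p.1) < u p.1 (blockItem b p.2) then Equiv.swap p.1 p.2 else 1

/-- The permutation is an involution, so it tells both who owns item k of the block and which item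
agent k owns. -/
theorem blockPerm_symm (hn : 0 < n) (u : Fin n → Fin (r * n) → ℝ) (b : Fin r) :
    (blockPerm hn u b).symm = blockPerm hn u b := by
  unfold blockPerm
  dsimp only
  split_ifs
  · exact Equiv.symm_swap _ _
  · rfl

/-- The allocation that is obtained from the trades in all blocks. -/
noncomputable def blockAllocation (hn : 0 < n) (u : Fin n → Fin (r * n) → ℝ) :
    Allocation n (r * n) :=
  fun j => blockPerm hn u (finProdFinEquiv.symm j).1 (finProdFinEquiv.symm j).2

theorem sum_bundle_blockAllocation {M : Type*} [AddCommMonoid M] (hn : 0 < n)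
    (u : Fin n → Fin (r * n) → ℝ) (i : Fin n) (f : Fin (r * n) → M) :
    ∑ j ∈ bundle (blockAllocation hn u) i, f j =
      ∑ b, f (blockItem b (blockPerm hn u b i)) := by
  rw [bundle, Finset.sum_filter, ← finProdFinEquiv.sum_comp, Fintype.sum_prod_type]
  refine Finset.sum_congr rfl fun b _ => ?_
  rw [Finset.sum_eq_single (blockPerm hn u b i)]
  · rw [if_pos]
    · rfl
    · simp only [blockAllocation, Equiv.symm_apply_apply]
      nth_rw 1 [← blockPerm_symm]
      exact Equiv.symm_apply_apply _ _
  · intro k _ hk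
    rw [if_neg]
    simp only [blockAllocation, Equiv.symm_apply_apply]
    intro h
    apply hk
    rw [← h]
    nth_rw 1 [← blockPerm_symm]
    exact (Equiv.symm_apply_apply _ _).symm
  · simp

theorem card_bundle_blockAllocation (hn : 0 < n) (u : Fin n → Fin (r * n) → ℝ) (i : Fin n) :
    (bundle (blockAllocation hn u) i).card = r := by
  have := sum_bundle_blockAllocation hn u i fun _ => 1
  simpa using this

/-- The amount by which agent `i` prefers her item in block `b` to that of agent `i'`. -/
noncomputable def blockGain (hn : 0 < n) (u : Fin n → Fin (r * n) → ℝ) (i i' : Fin n)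
    (b : Fin r) : ℝ :=
  u i (blockItem b (blockPerm hn u b i)) - u i (blockItem b (blockPerm hn u b i'))

theorem envyFree_blockAllocation_iff (hn : 0 < n) (u : Fin n → Fin (r * n) → ℝ) :
    EnvyFree u (blockAllocation hn u) ↔ ∀ i i', i ≠ i' → 0 ≤ ∑ b, blockGain hn u i i' b := by
  have h : ∀ i i', ∑ b, blockGain hn u i i' b = ∑ j ∈ bundle (blockAllocation hn u) i, u i j -
      ∑ j ∈ bundle (blockAllocation hn u) i', u i j := by
    intro i i'
    rw [sum_bundle_blockAllocation, sum_bundle_blockAllocation, ← Finset.sum_sub_distrib]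
    rfl
  unfold EnvyFree
  simp only [h, sub_nonneg]
  refine forall_congr' fun i => forall_congr' fun i' => ⟨fun h _ => h, fun h => ?_⟩
  by_cases hi : i = i'
  · rw [hi]
  · exact h hi

/-- The trading pair of block b is given by the last two digits of b in base n, so b = sn² + in + i'
works for all s < t. -/
theorem card_tradingPair_eq_ge (hn : 0 < n) (i i' : Fin n) {t : ℕ} (ht : t * n ^ 2 ≤ r) :
    t ≤ (Finset.univ.filter fun b : Fin r => tradingPair hn b = (i, i')).card := by
  have hlt : ∀ s : Fin t, (s : ℕ) * n ^ 2 + i * n + i' < r := by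
    intro s
    have h1 : ((s : ℕ) + 1) * n ^ 2 ≤ t * n ^ 2 := Nat.mul_le_mul_right _ s.2
    have h2 : ((i : ℕ) + 1) * n ≤ n * n := Nat.mul_le_mul_right _ i.2
    have h3 := i'.2
    nlinarith
  have h := Finset.card_le_card_of_injOn (s := (Finset.univ : Finset (Fin t)))
    (t := Finset.univ.filter fun b : Fin r => tradingPair hn b = (i, i'))
    (fun s => ⟨(s : ℕ) * n ^ 2 + i * n + i', hlt s⟩) ?_ ?_
  · simpa using h
  · intro s _
    simp only [Finset.coe_filter, Finset.mem_univ, true_and, Set.mem_ofPred_eq, tradingPair,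
      Prod.mk.injEq]
    have h1 : (s : ℕ) * n ^ 2 + i * n + i' = i' + n * (i + n * s) := by ring
    constructor <;> ext <;> simp only
    · rw [h1, Nat.add_mul_div_left _ _ hn, Nat.div_eq_of_lt i'.2, zero_add, Nat.add_mul_mod_self_left,
        Nat.mod_eq_of_lt i.2]
    · rw [h1, Nat.add_mul_mod_self_left, Nat.mod_eq_of_lt i'.2]
  · intro s _ s' _ h
    simp only [Fin.mk.injEq, add_left_inj] at h
    exact Fin.ext (Nat.eq_of_mul_eq_mul_right (by positivity) h)

end BlockAllocation

/-! ### Independence and means of the utilities -/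

section Independence

open ProbabilityTheory

variable {U : Measure ℝ} {n m : ℕ}

/-- Restrictions to disjoint sets of coordinates are independent. Extending a restriction by 0
presents X and Y as measurable functions of these restrictions. -/
theorem indepFun_of_dependsOn [IsProbabilityMeasure U] {S T : Finset (Fin n × Fin m)}
    (hST : Disjoint S T) {X Y : (Fin n × Fin m → ℝ) → ℝ} (hX : Measurable X) (hY : Measurable Y)
    (hXS : DependsOn X S) (hYT : DependsOn Y T) : IndepFun X Y (utilityLaw U n m) := by
  classical
  have hind : iIndepFun (fun (e : Fin n × Fin m) (ω : Fin n × Fin m → ℝ) => ω e)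
      (utilityLaw U n m) :=
    iIndepFun_pi (X := fun _ => id) fun _ => aemeasurable_id
  have h := hind.indepFun_finset S T hST fun e => measurable_pi_apply e
  let ext : (R : Finset (Fin n × Fin m)) → (R → ℝ) → (Fin n × Fin m → ℝ) :=
    fun R v e => if he : e ∈ R then v ⟨e, he⟩ else 0
  have hext : ∀ R, Measurable (ext R) := by
    intro R
    refine measurable_pi_lambda _ fun e => ?_
    by_cases he : e ∈ R
    · simpa only [ext, he, dif_pos] using measurable_pi_apply _
    · simpa only [ext, he, dif_neg, not_false_eq_true] using measurable_const
  have h2 := h.comp (hX.comp (hext S)) (hY.comp (hext T))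
  have hXe : (X ∘ ext S) ∘ (fun ω (e : S) => ω e) = X := by
    funext ω
    refine hXS fun e he => ?_
    simp [ext, Finset.mem_coe.1 he]
  have hYe : (Y ∘ ext T) ∘ (fun ω (e : T) => ω e) = Y := by
    funext ω
    refine hYT fun e he => ?_
    simp [ext, Finset.mem_coe.1 he]
  rwa [hXe, hYe] at h2

theorem ae_mem_Icc [IsProbabilityMeasure U] (hU : U (Set.Icc 0 1)ᶜ = 0) :
    ∀ᵐ ω ∂utilityLaw U n m, ∀ e, ω e ∈ Set.Icc (0 : ℝ) 1 := by
  have h := utilityLaw_real_not_le_one (n := n) (m := m) hU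
  rw [measureReal_eq_zero_iff] at h
  exact h

theorem integrable_of_ae_mem_Icc [IsProbabilityMeasure U] {X : (Fin n × Fin m → ℝ) → ℝ}
    (hX : Measurable X) {a b : ℝ} (h : ∀ᵐ ω ∂utilityLaw U n m, X ω ∈ Set.Icc a b) :
    Integrable X (utilityLaw U n m) := by
  refine Integrable.of_bound hX.aestronglyMeasurable (max |a| |b|) ?_
  filter_upwards [h] with ω hω
  exact abs_le_max_abs_abs hω.1 hω.2

theorem integrable_coord [IsProbabilityMeasure U] (hU : U (Set.Icc 0 1)ᶜ = 0)
    (e : Fin n × Fin m) : Integrable (fun ω => ω e) (utilityLaw U n m) :=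
  integrable_of_ae_mem_Icc (measurable_pi_apply e) ((ae_mem_Icc hU).mono fun _ h => h e)

theorem integral_coord [IsProbabilityMeasure U] (e : Fin n × Fin m) :
    ∫ ω, ω e ∂utilityLaw U n m = ∫ x, x ∂U := by
  have h := measurePreserving_eval (fun _ : Fin n × Fin m => U) e
  have h1 := integral_map (μ := utilityLaw U n m) (φ := Function.eval e)
    (measurable_pi_apply e).aemeasurable (f := fun x => x) aestronglyMeasurable_id
  unfold utilityLaw at h1 ⊢
  rw [h.map_eq] at h1
  exact h1.symm

theorem integral_coord_sub [IsProbabilityMeasure U] (hU : U (Set.Icc 0 1)ᶜ = 0)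
    (e e' : Fin n × Fin m) : ∫ ω, (ω e - ω e') ∂utilityLaw U n m = 0 := by
  rw [integral_sub (integrable_coord hU e) (integrable_coord hU e'), integral_coord,
    integral_coord, sub_self]

/-- The mean distance of two independent samples. -/
noncomputable def meanGap (U : Measure ℝ) : ℝ := ∫ x, |x.1 - x.2| ∂U.prod U

theorem integral_abs_coord_sub [IsProbabilityMeasure U] {e e' : Fin n × Fin m} (h : e ≠ e') :
    ∫ ω, |ω e - ω e'| ∂utilityLaw U n m = meanGap U := by
  have hi : IndepFun (fun ω => ω e) (fun ω => ω e') (utilityLaw U n m) :=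
    indepFun_of_dependsOn (S := {e}) (T := {e'}) (by simpa using h) (measurable_pi_apply e)
      (measurable_pi_apply e') (fun ω ω' hω => hω e (by simp)) (fun ω ω' hω => hω e' (by simp))
  rw [indepFun_iff_map_prod_eq_prod_map_map (measurable_pi_apply e).aemeasurable
    (measurable_pi_apply e').aemeasurable] at hi
  have h1 : ∀ e : Fin n × Fin m, (utilityLaw U n m).map (fun ω => ω e) = U := fun e =>
    (measurePreserving_eval (fun _ : Fin n × Fin m => U) e).map_eq
  rw [h1, h1] at hi
  rw [meanGap, ← hi, integral_map]
  · exact ((measurable_pi_apply e).prodMk (measurable_pi_apply e')).aemeasurable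
  · exact (by fun_prop : Measurable fun x : ℝ × ℝ => |x.1 - x.2|).aestronglyMeasurable

/-- A small α has 0 < P[u > 1 - α] < 1 by the two tail bounds, so two samples lie on different sides
of 1 - α with positive probability. All that matters for large r is that U is not a point mass. -/
theorem meanGap_pos (hU : IsUtilityDistribution U) (hU' : PolyBoundedAtOne U) :
    0 < meanGap U := by
  have := hU.1
  obtain ⟨θl, hθl, θu, hθu, q, hq, hl, hu⟩ := hU'
  obtain ⟨α, hα, hα1, hlt⟩ : ∃ α : ℝ, 0 < α ∧ α ≤ 1 ∧ θu * α ^ q < 1 := by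
    have hc : Tendsto (fun α : ℝ => θu * α ^ q) (𝓝[>] 0) (𝓝 (θu * 0 ^ q)) :=
      ((Real.continuousAt_rpow_const 0 q (Or.inr hq.le)).tendsto.mono_left
        nhdsWithin_le_nhds).const_mul θu
    rw [Real.zero_rpow hq.ne', mul_zero] at hc
    have h1 := hc.eventually_lt_const one_pos
    have h2 : ∀ᶠ α : ℝ in 𝓝[>] 0, α ∈ Set.Ioc (0 : ℝ) 1 := Ioc_mem_nhdsGT one_pos
    obtain ⟨α, hα1, hα2⟩ := (h1.and h2).exists
    exact ⟨α, hα2.1, hα2.2, hα1⟩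
  have hp0 : 0 < U.real (Set.Ioi (1 - α)) :=
    lt_of_lt_of_le (by positivity) (hl α ⟨hα, hα1⟩)
  have hp1 : U.real (Set.Ioi (1 - α)) < 1 := (hu α ⟨hα, hα1⟩).trans_lt hlt
  have hcompl : U.real (Set.Iic (1 - α)) = 1 - U.real (Set.Ioi (1 - α)) := by
    rw [← Set.compl_Ioi, measureReal_compl measurableSet_Ioi]
    simp
  have hprod : 0 < (U.prod U) (Set.Ioi (1 - α) ×ˢ Set.Iic (1 - α)) := by
    rw [Measure.prod_prod]
    refine ENNReal.mul_pos ?_ ?_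
    · intro h
      simp [measureReal_def, h] at hp0
    · intro h
      have : U.real (Set.Iic (1 - α)) = 0 := by simp [measureReal_def, h]
      linarith
  have hint : Integrable (fun x : ℝ × ℝ => |x.1 - x.2|) (U.prod U) := by
    have h1 : ∀ᵐ x ∂U, x ∈ Set.Icc (0 : ℝ) 1 := hU.2
    have h2 : Integrable (fun x : ℝ => x) U := by
      refine Integrable.of_bound aestronglyMeasurable_id 1 ?_
      filter_upwards [h1] with x hx
      rw [Real.norm_eq_abs, abs_of_nonneg hx.1]
      exact hx.2
    exact ((h2.comp_fst U).sub (h2.comp_snd U)).abs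
  unfold meanGap
  rw [integral_pos_iff_support_of_nonneg (fun x => abs_nonneg _) hint]
  refine hprod.trans_le (measure_mono ?_)
  rintro ⟨x, y⟩ ⟨hx, hy⟩
  simp only [Set.mem_Ioi, Set.mem_Iic] at hx hy
  simp only [Function.mem_support, ne_eq, abs_eq_zero, sub_eq_zero]
  exact (hy.trans_lt hx).ne'

end Independence

/-! ### Trades in blocks remove envy when r is large -/

section BlockGain

open ProbabilityTheory

variable {U : Measure ℝ} {n r : ℕ}

theorem blockGain_eq (hn : 0 < n) (u : Fin n → Fin (r * n) → ℝ) (i i' : Fin n) (b : Fin r)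
    {a a' : Fin n} (hp : tradingPair hn b = (a, a')) :
    blockGain hn u i i' b = if u a (blockItem b a) < u a (blockItem b a') then
      u i (blockItem b (Equiv.swap a a' i)) - u i (blockItem b (Equiv.swap a a' i'))
      else u i (blockItem b i) - u i (blockItem b i') := by
  unfold blockGain blockPerm
  rw [hp]
  dsimp only
  split_ifs <;> rfl

theorem measurable_blockGain (hn : 0 < n) (i i' : Fin n) (b : Fin r) :
    Measurable fun ω : Fin n × Fin (r * n) → ℝ => blockGain hn (Function.curry ω) i i' b := by
  simp only [fun ω : Fin n × Fin (r * n) → ℝ =>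
    blockGain_eq hn (Function.curry ω) i i' b (a := (tradingPair hn b).1) rfl, Function.curry]
  refine Measurable.ite (measurableSet_lt (measurable_pi_apply _) (measurable_pi_apply _)) ?_ ?_
  · exact (measurable_pi_apply _).sub (measurable_pi_apply _)
  · exact (measurable_pi_apply _).sub (measurable_pi_apply _)

theorem ae_blockGain_mem_Icc [IsProbabilityMeasure U] (hU : U (Set.Icc 0 1)ᶜ = 0) (hn : 0 < n)
    (i i' : Fin n) (b : Fin r) : ∀ᵐ ω ∂utilityLaw U n (r * n),
      blockGain hn (Function.curry ω) i i' b ∈ Set.Icc (-1 : ℝ) 1 := by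
  filter_upwards [ae_mem_Icc hU] with ω h
  unfold blockGain
  have h1 := h (i, blockItem b (blockPerm hn (Function.curry ω) b i))
  have h2 := h (i, blockItem b (blockPerm hn (Function.curry ω) b i'))
  simp only [Function.curry] at h1 h2 ⊢
  constructor <;> linarith [h1.1, h1.2, h2.1, h2.2]

theorem dependsOn_blockGain (hn : 0 < n) (i i' : Fin n) (b : Fin r) :
    DependsOn (fun ω : Fin n × Fin (r * n) → ℝ => blockGain hn (Function.curry ω) i i' b)
      ((Finset.univ.filter fun e => (finProdFinEquiv.symm e.2).1 = b :
        Finset (Fin n × Fin (r * n))) : Set (Fin n × Fin (r * n))) := by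
  intro ω ω' h
  have h' : ∀ i k, Function.curry ω i (blockItem b k) = Function.curry ω' i (blockItem b k) :=
    fun i k => h (i, blockItem b k) <| by
      rw [Finset.mem_coe, Finset.mem_filter]
      exact ⟨Finset.mem_univ _, by rw [blockItem, Equiv.symm_apply_apply]⟩
  simp only [blockGain_eq hn _ i i' b (a := (tradingPair hn b).1) rfl, h']

theorem indepFun_blockGain [IsProbabilityMeasure U] (hn : 0 < n) (i i' : Fin n) {b b' : Fin r}
    (h : b ≠ b') : IndepFun (fun ω => blockGain hn (Function.curry ω) i i' b)
      (fun ω => blockGain hn (Function.curry ω) i i' b') (utilityLaw U n (r * n)) := by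
  refine indepFun_of_dependsOn ?_ (measurable_blockGain hn i i' b) (measurable_blockGain hn i i' b')
    (dependsOn_blockGain hn i i' b) (dependsOn_blockGain hn i i' b')
  rw [Finset.disjoint_filter]
  rintro e - rfl
  exact h

/-- A comparison of two utilities of one agent is independent of the utilities of another. -/
theorem integral_ite_coord [IsProbabilityMeasure U] {m : ℕ} (hU : U (Set.Icc 0 1)ᶜ = 0)
    {a i : Fin n} (h : a ≠ i) (j j' k k' l l' : Fin m) :
    ∫ ω, (if ω (a, j) < ω (a, j') then ω (i, k) - ω (i, k') else ω (i, l) - ω (i, l'))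
      ∂utilityLaw U n m = 0 := by
  have key : ∀ (s : Set (Fin n × Fin m → ℝ)) (k k' : Fin m), MeasurableSet s →
      DependsOn (s.indicator fun _ => (1 : ℝ))
        (({(a, j), (a, j')} : Finset (Fin n × Fin m)) : Set (Fin n × Fin m)) →
      ∫ ω, s.indicator (fun _ => (1 : ℝ)) ω * (ω (i, k) - ω (i, k')) ∂utilityLaw U n m = 0 := by
    intro s k k' hs hd
    have hm1 : Measurable (s.indicator fun _ => (1 : ℝ)) := measurable_const.indicator hs
    have hm2 : Measurable fun ω : Fin n × Fin m → ℝ => ω (i, k) - ω (i, k') :=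
      (measurable_pi_apply _).sub (measurable_pi_apply _)
    rw [IndepFun.integral_fun_mul_eq_mul_integral (indepFun_of_dependsOn
      (T := {(i, k), (i, k')}) ?_ hm1 hm2 hd ?_) hm1.aestronglyMeasurable
      hm2.aestronglyMeasurable, integral_coord_sub hU, mul_zero]
    · simp only [Finset.disjoint_left, Finset.mem_insert, Finset.mem_singleton]
      rintro e (rfl | rfl) <;> simp [h]
    · intro ω ω' hω
      dsimp only
      rw [hω (i, k) (by simp), hω (i, k') (by simp)]
  set s : Set (Fin n × Fin m → ℝ) := {ω | ω (a, j) < ω (a, j')} with hs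
  have hsm : MeasurableSet s := measurableSet_lt (measurable_pi_apply _) (measurable_pi_apply _)
  have hd : ∀ t : Set (Fin n × Fin m → ℝ), (t = s ∨ t = sᶜ) →
      DependsOn (t.indicator fun _ => (1 : ℝ))
        (({(a, j), (a, j')} : Finset (Fin n × Fin m)) : Set (Fin n × Fin m)) := by
    intro t ht ω ω' hω
    have h1 := hω (a, j) (by simp)
    have h2 := hω (a, j') (by simp)
    have h3 : ω ∈ s ↔ ω' ∈ s := by simp only [hs, Set.mem_ofPred_eq, h1, h2]
    classical
    rcases ht with rfl | rfl <;> simp only [Set.indicator_apply, Set.mem_compl_iff, h3]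
  have h1 := key s k k' hsm (hd s (Or.inl rfl))
  have h2 := key sᶜ l l' hsm.compl (hd _ (Or.inr rfl))
  have hint : ∀ (t : Set (Fin n × Fin m → ℝ)) (k k' : Fin m), MeasurableSet t →
      Integrable (fun ω => t.indicator (fun _ => (1 : ℝ)) ω * (ω (i, k) - ω (i, k')))
        (utilityLaw U n m) := by
    intro t k k' ht
    have : (fun ω : Fin n × Fin m → ℝ => t.indicator (fun _ => (1 : ℝ)) ω *
        (ω (i, k) - ω (i, k'))) = t.indicator fun ω => ω (i, k) - ω (i, k') := by
      funext ω
      by_cases hω : ω ∈ t <;> simp [hω]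
    rw [this]
    exact ((integrable_coord hU _).sub (integrable_coord hU _)).indicator ht
  have h3 := integral_add (hint s k k' hsm) (hint sᶜ l l' hsm.compl)
  rw [h1, h2, add_zero] at h3
  rw [← h3]
  refine integral_congr_ae (ae_of_all _ fun ω => ?_)
  by_cases hω : ω (a, j) < ω (a, j')
  · have : ω ∈ s := hω
    simp [hω, this]
  · have : ω ∉ s := hω
    simp [hω, this]

/-- If i decides on the trade, her gain is at least the untraded difference, which has mean 0, and
it is an absolute value if her partner is i'. If another agent decides, the decision is independent
of the utilities of i, for whom all items are alike in the mean. -/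
theorem integral_blockGain_nonneg [IsProbabilityMeasure U] (hU : U (Set.Icc 0 1)ᶜ = 0)
    (hn : 0 < n) {i i' : Fin n} (hi : i ≠ i') (b : Fin r) :
    0 ≤ ∫ ω, blockGain hn (Function.curry ω) i i' b ∂utilityLaw U n (r * n) := by
  obtain ⟨a, a', hp⟩ : ∃ a a', tradingPair hn b = (a, a') := ⟨_, _, rfl⟩
  have heq := fun ω : Fin n × Fin (r * n) → ℝ => blockGain_eq hn (Function.curry ω) i i' b hp
  by_cases hia : a = i
  · rw [← integral_coord_sub (n := n) (m := r * n) (U := U) hU (i, blockItem b i)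
      (i, blockItem b i')]
    by_cases hia' : a' = i'
    · rw [integral_coord_sub hU]
      refine integral_nonneg fun ω => ?_
      rw [heq, hia, hia', Equiv.swap_apply_left, Equiv.swap_apply_right]
      dsimp only [Pi.zero_apply]
      split_ifs with h <;> linarith
    · refine integral_mono ((integrable_coord hU _).sub (integrable_coord hU _))
        (integrable_of_ae_mem_Icc (measurable_blockGain hn i i' b)
          (ae_blockGain_mem_Icc hU hn i i' b)) fun ω => ?_
      dsimp only
      rw [heq, hia, Equiv.swap_apply_left, Equiv.swap_apply_of_ne_of_ne hi.symm (Ne.symm hia')]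
      split_ifs with h <;> simp only [Function.curry] at h ⊢ <;> linarith
  · simp only [heq, Function.curry]
    exact (integral_ite_coord hU hia _ _ _ _ _ _).ge

theorem integral_blockGain_of_tradingPair [IsProbabilityMeasure U] (hn : 0 < n) {i i' : Fin n}
    (hi : i ≠ i') {b : Fin r} (hp : tradingPair hn b = (i, i')) :
    ∫ ω, blockGain hn (Function.curry ω) i i' b ∂utilityLaw U n (r * n) = meanGap U := by
  rw [← integral_abs_coord_sub (n := n) (m := r * n) (U := U) (e := (i, blockItem b i))
    (e' := (i, blockItem b i')) fun h => hi (blockItem_injective (Prod.mk.inj h).2).2]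
  refine integral_congr_ae (ae_of_all _ fun ω => ?_)
  simp only [blockGain_eq hn _ i i' b hp, Function.curry, Equiv.swap_apply_left,
    Equiv.swap_apply_right]
  split_ifs with h
  · rw [abs_of_neg (by linarith)]
    ring
  · rw [abs_of_nonneg (by linarith)]

/-- Chebyshev's inequality: the gains of the blocks are pairwise independent with variance at most
1, and their sum has mean at least t times the mean gap, since (i, i') trades at least t times. -/
theorem utilityLaw_real_sum_blockGain_neg_le [IsProbabilityMeasure U]
    (hU : U (Set.Icc 0 1)ᶜ = 0) (hc : 0 < meanGap U) (hn : 0 < n) {i i' : Fin n} (hi : i ≠ i')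
    {t : ℕ} (ht : t * n ^ 2 ≤ r) (ht0 : 0 < t) :
    (utilityLaw U n (r * n)).real {ω | ¬ 0 ≤ ∑ b, blockGain hn (Function.curry ω) i i' b} ≤
      r / (t * meanGap U) ^ 2 := by
  set μ := utilityLaw U n (r * n) with hμ
  set X : Fin r → (Fin n × Fin (r * n) → ℝ) → ℝ :=
    fun b ω => blockGain hn (Function.curry ω) i i' b with hX
  have hae := fun b : Fin r => ae_blockGain_mem_Icc (U := U) hU hn i i' b
  have hmeas := fun b : Fin r => measurable_blockGain (r := r) hn i i' b
  have hmem : ∀ b, MemLp (X b) 2 μ := by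
    intro b
    refine MemLp.of_bound (hmeas b).aestronglyMeasurable 1 ?_
    filter_upwards [hae b] with ω hω
    exact abs_le.2 hω
  have hint : ∀ b, Integrable (X b) μ := fun b => integrable_of_ae_mem_Icc (hmeas b) (hae b)
  have hvar : variance (∑ b, X b) μ ≤ r := by
    rw [IndepFun.variance_sum (fun b _ => hmem b) fun b _ b' _ hb => indepFun_blockGain hn i i' hb]
    -- A variable with values in [-1, 1] has variance at most the square of half the length of this
    -- interval.
    calc ∑ b, variance (X b) μ ≤ ∑ _b : Fin r, ((1 - (-1)) / 2 : ℝ) ^ 2 :=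
          Finset.sum_le_sum fun b _ => variance_le_sq_of_bounded (hae b) (hmeas b).aemeasurable
      _ = r := by norm_num
  have hmean : t * meanGap U ≤ μ[∑ b, X b] := by
    have h1 : μ[∑ b, X b] = ∑ b, ∫ ω, X b ω ∂μ := by
      simp only [Finset.sum_apply]
      exact integral_finsetSum _ fun b _ => hint b
    rw [h1]
    have h2 := card_tradingPair_eq_ge (r := r) hn i i' ht
    calc t * meanGap U
        ≤ ((Finset.univ.filter fun b : Fin r => tradingPair hn b = (i, i')).card : ℝ) *
          meanGap U := by gcongr
      _ = ∑ b ∈ Finset.univ.filter fun b : Fin r => tradingPair hn b = (i, i'),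
          ∫ ω, X b ω ∂μ := by
          rw [← nsmul_eq_mul]
          refine (Finset.sum_eq_card_nsmul fun b hb => ?_).symm
          exact integral_blockGain_of_tradingPair hn hi (Finset.mem_filter.1 hb).2
      _ ≤ ∑ b, ∫ ω, X b ω ∂μ :=
          Finset.sum_le_sum_of_subset_of_nonneg (Finset.subset_univ _)
            fun b _ _ => integral_blockGain_nonneg hU hn hi b
  have hpos : 0 < t * meanGap U := mul_pos (by exact_mod_cast ht0) hc
  have hcheb := meas_ge_le_variance_div_sq (memLp_finsetSum' Finset.univ fun b _ => hmem b) hpos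
  have hsub : {ω | ¬ 0 ≤ ∑ b, blockGain hn (Function.curry ω) i i' b} ⊆
      {ω | t * meanGap U ≤ |(∑ b, X b) ω - μ[∑ b, X b]|} := by
    intro ω hω
    have h1 : ∑ b, X b ω < 0 := not_le.1 hω
    rw [Set.mem_ofPred_eq, Finset.sum_apply, abs_of_neg (by linarith)]
    linarith
  calc μ.real {ω | ¬ 0 ≤ ∑ b, blockGain hn (Function.curry ω) i i' b}
      ≤ (ENNReal.ofReal (variance (∑ b, X b) μ / (t * meanGap U) ^ 2)).toReal :=
        ENNReal.toReal_mono ENNReal.ofReal_ne_top ((measure_mono hsub).trans hcheb)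
    _ = variance (∑ b, X b) μ / (t * meanGap U) ^ 2 :=
        ENNReal.toReal_ofReal (div_nonneg (variance_nonneg _ _) (sq_nonneg _))
    _ ≤ r / (t * meanGap U) ^ 2 := by gcongr

theorem utilityLaw_real_not_envyFree_le [IsProbabilityMeasure U]
    (hU : U (Set.Icc 0 1)ᶜ = 0) (hc : 0 < meanGap U) (hn : 0 < n)
    {t : ℕ} (ht : t * n ^ 2 ≤ r) (ht0 : 0 < t) :
    (utilityLaw U n (r * n)).real
      {ω | ¬ EnvyFree (Function.curry ω) (blockAllocation hn (Function.curry ω))} ≤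
      n ^ 2 * (r / (t * meanGap U) ^ 2) := by
  have hcard : ((Finset.univ.filter fun p : Fin n × Fin n => p.1 ≠ p.2).card : ℝ) ≤ n ^ 2 := by
    have := Finset.card_le_univ (Finset.univ.filter fun p : Fin n × Fin n => p.1 ≠ p.2)
    rw [Fintype.card_prod, Fintype.card_fin, ← sq] at this
    exact_mod_cast this
  refine le_trans (utilityLaw_real_mono (Q' := fun ω => ∃ p ∈ Finset.univ.filter
    fun p : Fin n × Fin n => p.1 ≠ p.2, ¬ 0 ≤ ∑ b, blockGain hn (Function.curry ω) p.1 p.2 b) ?_)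
    ((utilityLaw_real_exists_le _ _ (r / (t * meanGap U) ^ 2) fun p hp => ?_).trans
      (mul_le_mul_of_nonneg_right hcard (by positivity)))
  · intro ω h
    rw [envyFree_blockAllocation_iff] at h
    push Not at h
    obtain ⟨i, i', hi, h⟩ := h
    exact ⟨(i, i'), by simpa using hi, not_le.2 h⟩
  · exact utilityLaw_real_sum_blockGain_neg_le hU hc hn (Finset.mem_filter.1 hp).2 ht ht0

theorem eventually_envyFree_blockAllocation (hU : IsUtilityDistribution U)
    (hU' : PolyBoundedAtOne U) :
    ∃ f : ℕ → ℝ, Tendsto f atTop (𝓝 0) ∧ ∀ᶠ n : ℕ in atTop, ∀ (hn : 0 < n) (r : ℕ),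
      Real.exp ((n : ℝ) ^ (0.1 : ℝ)) < r →
        (utilityLaw U n (r * n)).real
          {ω | ¬ EnvyFree (Function.curry ω) (blockAllocation hn (Function.curry ω))} ≤ f n := by
  have := hU.1
  have hc := meanGap_pos hU hU'
  set c := meanGap U
  have hlim : Tendsto (fun n : ℕ => ((n : ℝ) ^ (0.1 : ℝ)) ^ 60 * Real.exp (-(n : ℝ) ^ (0.1 : ℝ)))
      atTop (𝓝 0) :=
    (Real.tendsto_pow_mul_exp_neg_atTop_nhds_zero 60).comp tendsto_rpow_tenth
  refine ⟨fun n => 4 / c ^ 2 *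
    (((n : ℝ) ^ (0.1 : ℝ)) ^ 60 * Real.exp (-(n : ℝ) ^ (0.1 : ℝ))), ?_, ?_⟩
  · simpa using hlim.const_mul (4 / c ^ 2)
  filter_upwards [hlim.eventually_le_const one_pos, tendsto_rpow_tenth.eventually_ge_atTop 1]
    with n hn1 hn2
  intro hn r hr
  set N := (n : ℝ) ^ (0.1 : ℝ) with hN
  have hnN : (n : ℝ) = N ^ 10 := by
    rw [hN, ← Real.rpow_natCast, ← Real.rpow_mul (by positivity)]
    norm_num
  have hN60 : N ^ 60 ≤ r := by
    rw [Real.exp_neg, ← div_eq_mul_inv, div_le_one (Real.exp_pos _)] at hn1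
    exact hn1.trans hr.le
  have hnr : n ^ 2 ≤ r := by
    have h1 : (n : ℝ) ^ 2 ≤ r := by
      rw [hnN, ← pow_mul]
      exact (pow_le_pow_right₀ hn2 (by norm_num)).trans hN60
    exact_mod_cast h1
  have hn2pos : 0 < n ^ 2 := by positivity
  set t := r / n ^ 2 with ht
  have ht0 : 0 < t := Nat.div_pos hnr hn2pos
  have htr : t * n ^ 2 ≤ r := Nat.div_mul_le_self r (n ^ 2)
  -- The quotient t is at least 1, so r < (t + 1)n² ≤ 2tn². Used twice below, this cancels t² and
  -- leaves 4n^6 / (c² r), which is small as r > e^N.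
  have htr' : r ≤ 2 * t * n ^ 2 := by
    have h1 := Nat.lt_div_mul_add (a := r) hn2pos
    rw [← ht] at h1
    nlinarith
  have htr'' : (r : ℝ) ≤ 2 * t * n ^ 2 := by exact_mod_cast htr'
  have hr0 : (0 : ℝ) < r := (Real.exp_pos _).trans hr
  have ht0' : (0 : ℝ) < t := by exact_mod_cast ht0
  have hn0 : (0 : ℝ) < n := by exact_mod_cast hn
  refine (utilityLaw_real_not_envyFree_le hU.2 hc hn htr ht0).trans ?_
  calc (n : ℝ) ^ 2 * (r / (t * c) ^ 2) = n ^ 2 * r * r / (t * c) ^ 2 * (1 / r) := by field_simp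
    _ ≤ n ^ 2 * (2 * t * n ^ 2) * (2 * t * n ^ 2) / (t * c) ^ 2 * (1 / r) := by gcongr
    _ = 4 / c ^ 2 * (n : ℝ) ^ 6 * (1 / r) := by field_simp; norm_num
    _ ≤ 4 / c ^ 2 * (n : ℝ) ^ 6 * Real.exp (-N) := by
        gcongr
        rw [Real.exp_neg, one_div]
        exact inv_anti₀ (Real.exp_pos _) hr.le
    _ = 4 / c ^ 2 * (N ^ 60 * Real.exp (-N)) := by rw [hnN, ← pow_mul]; ring

end BlockGain

/-! ### Programs with bounded loops -/

/-- Programs whose only loops are bounded ones: `loop x y c` runs `c` with variable `x` equal to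
`0, 1, …` as long as this is less than the value of variable `y`. -/
inductive Code
  | skip
  | setVar (x : ℕ) (e : NatExpr)
  | setNat (a : ℕ) (e f : NatExpr) (value : NatExpr)
  | setReal (a : ℕ) (e f : NatExpr) (value : RealExpr)
  | seq (c d : Code)
  | ite (b : Test) (c d : Code)
  | loop (x y : ℕ) (c : Code)

infixr:60 " ;; " => Code.seq

namespace Memory

/-- Assign the value `v` to variable `x`. -/
def setVar (s : Memory) (x v : ℕ) : Memory :=
  { s with var := Function.update s.var x v }

/-- Assign the value `v` to an entry of an array of natural numbers. -/
def setNat (s : Memory) (a i j v : ℕ) : Memory :=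
  { s with natArray := updateArray s.natArray a i j v }

/-- Assign the value `v` to an entry of an array of real numbers. -/
def setReal (s : Memory) (a i j : ℕ) (v : ℝ) : Memory :=
  { s with realArray := updateArray s.realArray a i j v }

variable (s : Memory)

@[simp] theorem setVar_var (x v y : ℕ) :
    (s.setVar x v).var y = if y = x then v else s.var y := by
  simp [setVar, Function.update_apply]

@[simp] theorem setVar_natArray (x v : ℕ) : (s.setVar x v).natArray = s.natArray := rfl

@[simp] theorem setVar_realArray (x v : ℕ) : (s.setVar x v).realArray = s.realArray := rfl

@[simp] theorem setNat_var (a i j v : ℕ) : (s.setNat a i j v).var = s.var := rfl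

@[simp] theorem setNat_natArray (a i j v a' i' j' : ℕ) : (s.setNat a i j v).natArray a' i' j' =
    if a' = a ∧ i' = i ∧ j' = j then v else s.natArray a' i' j' := rfl

@[simp] theorem setNat_realArray (a i j v : ℕ) : (s.setNat a i j v).realArray = s.realArray := rfl

@[simp] theorem setReal_var (a i j : ℕ) (v : ℝ) : (s.setReal a i j v).var = s.var := rfl

@[simp] theorem setReal_realArray (a i j : ℕ) (v : ℝ) (a' i' j' : ℕ) :
    (s.setReal a i j v).realArray a' i' j' =
      if a' = a ∧ i' = i ∧ j' = j then v else s.realArray a' i' j' := rfl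

end Memory

namespace Code

/-- Translation to `while` programs. -/
def compile : Code → Program
  | skip => .skip
  | setVar x e => .setVar x e
  | setNat a e f v => .setNat a e f v
  | setReal a e f v => .setReal a e f v
  | seq c d => .seq c.compile d.compile
  | ite b c d => .ite b c.compile d.compile
  | loop x y c => .seq (.setVar x (.const 0)) (.while (.natLe (.add (.var x) (.const 1)) (.var y))
      (.seq c.compile (.setVar x (.add (.var x) (.const 1)))))

open Classical in
/-- The final memory. -/
noncomputable def run : Code → Memory → Memory
  | skip => fun s => s
  | setVar x e => fun s => s.setVar x (e.eval s)
  | setNat a e f v => fun s => s.setNat a (e.eval s) (f.eval s) (v.eval s)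
  | setReal a e f v => fun s => s.setReal a (e.eval s) (f.eval s) (v.eval s)
  | seq c d => fun s => d.run (c.run s)
  | ite b c d => fun s => if b.Holds s then c.run s else d.run s
  | loop x y c => fun s =>
      Nat.rec (s.setVar x 0) (fun k s' => (c.run s').setVar x (k + 1)) (s.var y)

/-- The variables that are assigned to. -/
def modVars : Code → List ℕ
  | setVar x _ => [x]
  | seq c d => c.modVars ++ d.modVars
  | ite _ c d => c.modVars ++ d.modVars
  | loop x _ c => x :: c.modVars
  | _ => []

/-- The arrays of natural numbers that are written to. -/
def modNats : Code → List ℕ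
  | setNat a _ _ _ => [a]
  | seq c d => c.modNats ++ d.modNats
  | ite _ c d => c.modNats ++ d.modNats
  | loop _ _ c => c.modNats
  | _ => []

/-- The arrays of real numbers that are written to. -/
def modReals : Code → List ℕ
  | setReal a _ _ _ => [a]
  | seq c d => c.modReals ++ d.modReals
  | ite _ c d => c.modReals ++ d.modReals
  | loop _ _ c => c.modReals
  | _ => []

/-- Loops are bounded by the variables 0 and 1, these are not assigned to, and loop variables are
not assigned to inside the loop. -/
def wellFormed : Code → Bool
  | setVar x _ => 2 ≤ x
  | seq c d => c.wellFormed && d.wellFormed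
  | ite _ c d => c.wellFormed && d.wellFormed
  | loop x y c => 2 ≤ x && y ≤ 1 && (x ∉ c.modVars) && c.wellFormed
  | _ => true

/-- A bound for the number of steps, if the variables 0 and 1 are at most `X`. -/
noncomputable def cost : Code → Polynomial ℕ
  | seq c d => c.cost + d.cost
  | ite _ c d => c.cost + d.cost + 1
  | loop _ _ c => Polynomial.X * (c.cost + 2) + 2
  | _ => 1

/-- The memories `s` and `s'` agree except where `c` writes. -/
structure SameOff (c : Code) (s s' : Memory) : Prop where
  var : ∀ x, x ∉ c.modVars → s'.var x = s.var x
  nat : ∀ a, a ∉ c.modNats → s'.natArray a = s.natArray a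
  real : ∀ a, a ∉ c.modReals → s'.realArray a = s.realArray a

theorem SameOff.rfl {c : Code} {s : Memory} : SameOff c s s := ⟨by simp, by simp, by simp⟩

theorem SameOff.trans {c : Code} {s s' s'' : Memory} (h : SameOff c s s') (h' : SameOff c s' s'') :
    SameOff c s s'' :=
  ⟨fun x hx => (h'.var x hx).trans (h.var x hx), fun a ha => (h'.nat a ha).trans (h.nat a ha),
    fun a ha => (h'.real a ha).trans (h.real a ha)⟩

theorem SameOff.mono {c d : Code} {s s' : Memory} (h : SameOff c s s')
    (h₁ : c.modVars ⊆ d.modVars) (h₂ : c.modNats ⊆ d.modNats) (h₃ : c.modReals ⊆ d.modReals) :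
    SameOff d s s' :=
  ⟨fun x hx => h.var x fun h' => hx (h₁ h'), fun a ha => h.nat a fun h' => ha (h₂ h'),
    fun a ha => h.real a fun h' => ha (h₃ h')⟩

theorem sameOff_setVar_loop (x y : ℕ) (c : Code) (s : Memory) (v : ℕ) :
    SameOff (loop x y c) s (s.setVar x v) := by
  refine ⟨fun z hz => ?_, fun _ _ => _root_.rfl, fun _ _ => _root_.rfl⟩
  have : z ≠ x := fun h => hz (by simp [modVars, h])
  simp [this]

/-- A frame rule with a syntactic hypothesis: for concrete code, `decide` verifies that a location
is not written to, so facts about it carry over. -/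
theorem sameOff_run (c : Code) (s : Memory) : SameOff c s (c.run s) := by
  induction c generalizing s with
  | skip => exact .rfl
  | setVar x e =>
    refine ⟨fun z hz => ?_, fun _ _ => rfl, fun _ _ => rfl⟩
    have : z ≠ x := fun h => hz (by simp [modVars, h])
    simp [run, this]
  | setNat a e f v =>
    refine ⟨fun _ _ => rfl, fun z hz => ?_, fun _ _ => rfl⟩
    have : z ≠ a := fun h => hz (by simp [modNats, h])
    funext i j
    simp [run, this]
  | setReal a e f v =>
    refine ⟨fun _ _ => rfl, fun _ _ => rfl, fun z hz => ?_⟩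
    have : z ≠ a := fun h => hz (by simp [modReals, h])
    funext i j
    simp [run, this]
  | seq c d hc hd =>
    exact ((hc s).mono (by simp [modVars]) (by simp [modNats]) (by simp [modReals])).trans
      ((hd _).mono (by simp [modVars]) (by simp [modNats]) (by simp [modReals]))
  | ite b c d hc hd =>
    unfold run
    split_ifs
    · exact (hc s).mono (by simp [modVars]) (by simp [modNats]) (by simp [modReals])
    · exact (hd s).mono (by simp [modVars]) (by simp [modNats]) (by simp [modReals])
  | loop x y c hc =>
    unfold run
    induction s.var y with
    | zero => exact sameOff_setVar_loop x y c s 0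
    | succ k ih =>
      refine ih.trans (SameOff.trans ?_ (sameOff_setVar_loop x y c _ (k + 1)))
      exact (hc _).mono (by simp [modVars]) (by simp [modNats]) (by simp [modReals])

/-- Loop invariants. -/
theorem run_loop {x y : ℕ} {c : Code} (s : Memory) (I : ℕ → Memory → Prop)
    (hI : ∀ k v s', I k s' → I k (s'.setVar x v)) (h0 : I 0 s)
    (hstep : ∀ k < s.var y, ∀ s', SameOff (loop x y c) s s' → s'.var x = k → I k s' →
      I (k + 1) (c.run s')) : I (s.var y) ((loop x y c).run s) := by
  unfold run
  -- The counter is set anew after each run of the body, so the invariant must not depend on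
  -- variable x; this is the role of `hI`.
  have key : ∀ k ≤ s.var y, ∀ s' : Memory,
      s' = Nat.rec (s.setVar x 0) (fun k s' => (c.run s').setVar x (k + 1)) k →
      SameOff (loop x y c) s s' ∧ s'.var x = k ∧ I k s' := by
    intro k
    induction k with
    | zero =>
      rintro - s' rfl
      exact ⟨sameOff_setVar_loop x y c s 0, by simp, hI _ _ _ h0⟩
    | succ k ih =>
      rintro hk s' rfl
      obtain ⟨h1, h2, h3⟩ := ih (by omega) _ rfl
      refine ⟨(h1.trans ?_).trans (sameOff_setVar_loop x y c _ (k + 1)), by simp,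
        hI _ _ _ (hstep k (by omega) _ h1 h2 h3)⟩
      exact (sameOff_run c _).mono (by simp [modVars]) (by simp [modNats]) (by simp [modReals])
  exact (key _ le_rfl _ rfl).2.2

/-- The `while` test rereads counter and bound each time. Well-formed code changes neither inside
the body, and every bound is variable 0 or 1, so each loop makes at most B passes; nesting
multiplies these and the cost stays polynomial. -/
theorem exec_compile (c : Code) (hc : c.wellFormed = true) {B : ℕ} (s : Memory) (h0 : s.var 0 ≤ B)
    (h1 : s.var 1 ≤ B) : ∃ t ≤ c.cost.eval B, Exec c.compile s t (c.run s) := by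
  have hmod : ∀ c : Code, c.wellFormed = true → 0 ∉ c.modVars ∧ 1 ∉ c.modVars := by
    intro c hc
    induction c with
    | setVar x e =>
      simp only [wellFormed, decide_eq_true_eq] at hc
      simp only [modVars, List.mem_singleton]
      omega
    | seq c d ihc ihd =>
      simp only [wellFormed, Bool.and_eq_true] at hc
      simp [modVars, ihc hc.1, ihd hc.2]
    | ite b c d ihc ihd =>
      simp only [wellFormed, Bool.and_eq_true] at hc
      simp [modVars, ihc hc.1, ihd hc.2]
    | loop x y c ih =>
      simp only [wellFormed, Bool.and_eq_true, decide_eq_true_eq] at hc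
      have := ih hc.2
      simp only [modVars, List.mem_cons, this, or_false]
      omega
    | _ => simp [modVars]
  induction c generalizing s with
  | skip => exact ⟨1, by simp [cost], .skip s⟩
  | setVar x e => exact ⟨1, by simp [cost], .setVar s x e⟩
  | setNat a e f v => exact ⟨1, by simp [cost], .setNat s a e f v⟩
  | setReal a e f v => exact ⟨1, by simp [cost], .setReal s a e f v⟩
  | seq c d ihc ihd =>
    simp only [wellFormed, Bool.and_eq_true] at hc
    obtain ⟨t, ht, hct⟩ := ihc hc.1 s h0 h1
    have hf := sameOff_run c s
    obtain ⟨t', ht', hdt⟩ := ihd hc.2 (c.run s) (by rwa [hf.var 0 (hmod c hc.1).1])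
      (by rwa [hf.var 1 (hmod c hc.1).2])
    exact ⟨t + t', by simp only [cost, Polynomial.eval_add]; omega, .seq _ _ _ _ _ _ _ hct hdt⟩
  | ite b c d ihc ihd =>
    simp only [wellFormed, Bool.and_eq_true] at hc
    unfold run
    split_ifs with hb
    · obtain ⟨t, ht, hct⟩ := ihc hc.1 s h0 h1
      exact ⟨t + 1, by simp only [cost, Polynomial.eval_add, Polynomial.eval_one]; omega,
        .iteTrue _ _ _ _ _ _ hb hct⟩
    · obtain ⟨t, ht, hct⟩ := ihd hc.2 s h0 h1
      exact ⟨t + 1, by simp only [cost, Polynomial.eval_add, Polynomial.eval_one]; omega,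
        .iteFalse _ _ _ _ _ _ hb hct⟩
  | loop x y c ih =>
    have hmod' := hmod _ hc
    simp only [wellFormed, Bool.and_eq_true, decide_eq_true_eq] at hc
    obtain ⟨⟨⟨hx2, hy⟩, hx⟩, hc⟩ := hc
    set st : ℕ → Memory :=
      Nat.rec (s.setVar x 0) (fun k s' => (c.run s').setVar x (k + 1)) with hst
    have hsucc : ∀ k, st (k + 1) = (c.run (st k)).setVar x (k + 1) := fun k => rfl
    have hsame : ∀ k, SameOff (loop x y c) s (st k) ∧ (st k).var x = k := by
      intro k
      induction k with
      | zero => exact ⟨sameOff_setVar_loop x y c s 0, by simp [hst]⟩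
      | succ k ih =>
        refine ⟨(ih.1.trans ?_).trans (sameOff_setVar_loop x y c _ (k + 1)), by simp [hsucc]⟩
        exact (sameOff_run c _).mono (by simp [modVars]) (by simp [modNats]) (by simp [modReals])
    have hyB : s.var y ≤ B := by
      rcases (by omega : y = 0 ∨ y = 1) with rfl | rfl <;> assumption
    have hyv : ∀ k, (st k).var y = s.var y := by
      intro k
      rcases (by omega : y = 0 ∨ y = 1) with rfl | rfl
      · exact (hsame k).1.var 0 hmod'.1
      · exact (hsame k).1.var 1 hmod'.2
    -- Induction on the number d of remaining passes. A pass costs the body, one test and one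
    -- increment; the last failing test costs one more step.
    have hwhile : ∀ d k, k + d = s.var y → ∃ t ≤ d * (c.cost.eval B + 2) + 1,
        Exec (.while (.natLe (.add (.var x) (.const 1)) (.var y))
          (.seq c.compile (.setVar x (.add (.var x) (.const 1))))) (st k) t (st (s.var y)) := by
      intro d
      induction d with
      | zero =>
        intro k hk
        refine ⟨1, by omega, ?_⟩
        rw [← hk, add_zero]
        refine .whileFalse _ _ _ ?_
        simp only [Test.Holds, NatExpr.eval, (hsame k).2, hyv]
        omega
      | succ d ihd =>
        intro k hk
        obtain ⟨t, ht, hct⟩ := ih hc (st k) (by rwa [(hsame k).1.var 0 hmod'.1])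
          (by rwa [(hsame k).1.var 1 hmod'.2])
        obtain ⟨t', ht', hwt⟩ := ihd (k + 1) (by omega)
        have hset : Exec (.setVar x (.add (.var x) (.const 1))) (c.run (st k)) 1 (st (k + 1)) := by
          have h := Exec.setVar (c.run (st k)) x (.add (.var x) (.const 1))
          have hv : (c.run (st k)).var x = k := by
            rw [(sameOff_run c (st k)).var x hx, (hsame k).2]
          simp only [NatExpr.eval, hv] at h
          exact h
        refine ⟨t + 1 + t' + 1, ?_, .whileTrue _ _ _ _ _ _ _ ?_
          (.seq _ _ _ _ _ _ _ hct hset) hwt⟩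
        · rw [Nat.succ_mul]
          omega
        · simp only [Test.Holds, NatExpr.eval, (hsame k).2, hyv]
          omega
    obtain ⟨t, ht, hw⟩ := hwhile (s.var y) 0 (by omega)
    refine ⟨1 + t, ?_, .seq _ _ _ _ _ _ _ (.setVar s x (.const 0)) hw⟩
    have h2 := Nat.mul_le_mul_right (c.cost.eval B + 2) hyB
    simp only [cost, Polynomial.eval_add, Polynomial.eval_mul, Polynomial.eval_X,
      Polynomial.eval_ofNat]
    omega

variable (s : Memory)

@[simp] theorem run_skip : skip.run s = s := rfl

@[simp] theorem run_setVar (x : ℕ) (e : NatExpr) :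
    (setVar x e).run s = s.setVar x (e.eval s) := rfl

@[simp] theorem run_setNat (a : ℕ) (e f v : NatExpr) :
    (setNat a e f v).run s = s.setNat a (e.eval s) (f.eval s) (v.eval s) := rfl

@[simp] theorem run_setReal (a : ℕ) (e f : NatExpr) (v : RealExpr) :
    (setReal a e f v).run s = s.setReal a (e.eval s) (f.eval s) (v.eval s) := rfl

@[simp] theorem run_seq (c d : Code) : (c ;; d).run s = d.run (c.run s) := rfl

open Classical in
@[simp] theorem run_ite (b : Test) (c d : Code) :
    (ite b c d).run s = if b.Holds s then c.run s else d.run s := rfl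

end Code

/-! ### Evaluation rules for expressions and tests -/

section Expressions

/-- Equality of natural numbers. -/
def Test.natEq (e f : NatExpr) : Test := .and (.natLe e f) (.natLe f e)

variable (s : Memory)

@[simp] theorem eval_const (k : ℕ) : (NatExpr.const k).eval s = k := rfl

@[simp] theorem eval_var (x : ℕ) : (NatExpr.var x).eval s = s.var x := rfl

@[simp] theorem eval_get (a : ℕ) (e f : NatExpr) :
    (NatExpr.get a e f).eval s = s.natArray a (e.eval s) (f.eval s) := rfl

@[simp] theorem eval_add (e f : NatExpr) : (NatExpr.add e f).eval s = e.eval s + f.eval s := rfl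

@[simp] theorem eval_sub (e f : NatExpr) : (NatExpr.sub e f).eval s = e.eval s - f.eval s := rfl

@[simp] theorem eval_const_real (c : ℚ) : (RealExpr.const c).eval s = c := rfl

@[simp] theorem eval_get_real (a : ℕ) (e f : NatExpr) :
    (RealExpr.get a e f).eval s = s.realArray a (e.eval s) (f.eval s) := rfl

@[simp] theorem eval_add_real (x y : RealExpr) :
    (RealExpr.add x y).eval s = x.eval s + y.eval s := rfl

@[simp] theorem holds_natLe (e f : NatExpr) :
    (Test.natLe e f).Holds s ↔ e.eval s ≤ f.eval s := Iff.rfl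

@[simp] theorem holds_realLe (x y : RealExpr) :
    (Test.realLe x y).Holds s ↔ x.eval s ≤ y.eval s := Iff.rfl

@[simp] theorem holds_not (b : Test) : (Test.not b).Holds s ↔ ¬ b.Holds s := Iff.rfl

@[simp] theorem holds_and (b c : Test) : (Test.and b c).Holds s ↔ b.Holds s ∧ c.Holds s := Iff.rfl

@[simp] theorem holds_natEq (e f : NatExpr) :
    (Test.natEq e f).Holds s ↔ e.eval s = f.eval s := by
  simp [Test.natEq, le_antisymm_iff]

end Expressions

open Code

/-! ### The removal phase as a program

Variables: 0 and 1 hold the numbers of agents and items, 2 holds `r`, 5 the result of a search, 6 and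
7 the agents `i'` and `i`. Arrays of natural numbers: 3 holds the candidate sets, one in each row,
4 a working set. Arrays of real numbers: 0 holds the utilities; entry `(0, 0)` of 1, 2 and 3
the threshold `τ`, the product `r * τ`, and a sum. -/

/-- The memory contains the problem instance. -/
structure HasInstance {n m : ℕ} (u : Fin n → Fin m → ℝ) (s : Memory) : Prop where
  agents : s.var 0 = n
  items : s.var 1 = m
  utility : ∀ (i : Fin n) (j : Fin m), s.realArray 0 i j = u i j

theorem HasInstance.of_sameOff {n m : ℕ} {u : Fin n → Fin m → ℝ} {c : Code} {s s' : Memory}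
    (hs : HasInstance u s) (h : SameOff c s s')
    (hc : 0 ∉ c.modVars ∧ 1 ∉ c.modVars ∧ 0 ∉ c.modReals) : HasInstance u s' :=
  ⟨(h.var 0 hc.1).trans hs.agents, (h.var 1 hc.2.1).trans hs.items,
    fun i j => by rw [h.real 0 hc.2.2, hs.utility]⟩

/-- The set that is stored in row `i` of array `a`. -/
def rowSet (m : ℕ) (s : Memory) (a i : ℕ) : Finset (Fin m) :=
  Finset.univ.filter fun j => s.natArray a i j = 1

theorem mem_rowSet {m : ℕ} {s : Memory} {a i : ℕ} {j : Fin m} :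
    j ∈ rowSet m s a i ↔ s.natArray a i j = 1 := by
  simp [rowSet]

theorem rowSet_congr {m : ℕ} {s s' : Memory} {a a' i i' : ℕ}
    (h : ∀ j : Fin m, s.natArray a i j = s'.natArray a' i' j) :
    rowSet m s a i = rowSet m s' a' i' := by
  ext j
  rw [mem_rowSet, mem_rowSet, h]

theorem rowSet_setNat_zero {m : ℕ} (s : Memory) (a i : ℕ) (j : Fin m) :
    rowSet m (s.setNat a i j 0) a i = (rowSet m s a i).erase j := by
  ext k
  rw [Finset.mem_erase, mem_rowSet, mem_rowSet]
  by_cases h : k = j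
  · simp [h]
  · simp [h, Fin.val_inj]

/-! ### Searching and copying item sets -/

section Search

variable {n m : ℕ} {u : Fin n → Fin m → ℝ}

/-- Search the working set for an item that agent `i'` values most. -/
def findMax : Code :=
  .setVar 5 (.var 1) ;;
  .loop 4 1 (.ite (.and (.natEq (.get 4 (.const 0) (.var 4)) (.const 1))
    (.not (.and (.not (.natEq (.var 5) (.var 1)))
      (.not (.realLe (.get 0 (.var 6) (.var 5)) (.get 0 (.var 6) (.var 4)))))))
    (.setVar 5 (.var 4)) .skip)

/-- The value m, which is no item, stands for "nothing found yet". The tests have no disjunction,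
hence the nested negations: an item is taken if there is no candidate yet or it is at least as good
as the candidate. -/
theorem run_findMax {s : Memory} (hs : HasInstance u s) {i' : Fin n} (hi' : s.var 6 = i') :
    ((findMax.run s).var 5 = m ∧ rowSet m s 4 0 = ∅) ∨
      ∃ j ∈ rowSet m s 4 0, (findMax.run s).var 5 = j ∧ ∀ k ∈ rowSet m s 4 0, u i' k ≤ u i' j := by
  rw [findMax, run_seq]
  set s₁ := (Code.setVar 5 (.var 1)).run s with hs₁
  have hs₁' : HasInstance u s₁ := hs.of_sameOff (sameOff_run _ _) (by decide)
  have hrow : rowSet m s₁ 4 0 = rowSet m s 4 0 := rfl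
  have h := run_loop (x := 4) (y := 1) (c := .ite (.and (.natEq (.get 4 (.const 0) (.var 4))
    (.const 1)) (.not (.and (.not (.natEq (.var 5) (.var 1)))
      (.not (.realLe (.get 0 (.var 6) (.var 5)) (.get 0 (.var 6) (.var 4)))))))
    (.setVar 5 (.var 4)) .skip) s₁ (fun k s' =>
      (s'.var 5 = m ∧ ∀ j : Fin m, (j : ℕ) < k → j ∉ rowSet m s 4 0) ∨
      ∃ j ∈ rowSet m s 4 0, s'.var 5 = j ∧ ∀ l ∈ rowSet m s 4 0, (l : ℕ) < k → u i' l ≤ u i' j)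
    (fun _ _ _ h => h) (Or.inl ⟨hs.items, by simp⟩) ?_
  · rw [hs₁'.items] at h
    rcases h with ⟨h1, h2⟩ | ⟨j, hj, h1, h2⟩
    · exact Or.inl ⟨h1, Finset.eq_empty_of_forall_notMem fun j => h2 j j.2⟩
    · exact Or.inr ⟨j, hj, h1, fun k hk => h2 k hk k.2⟩
  · intro k hk s' hsame hk' hI
    rw [hs₁'.items] at hk
    have hs' : HasInstance u s' := hs₁'.of_sameOff hsame (by decide)
    have hrow' : rowSet m s' 4 0 = rowSet m s 4 0 :=
      rowSet_congr fun j => by rw [hsame.nat 4 (by decide)]; rfl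
    have h6 : s'.var 6 = i' := (hsame.var 6 (by decide)).trans hi'
    have hT : s'.natArray 4 0 k = 1 ↔ (⟨k, hk⟩ : Fin m) ∈ rowSet m s 4 0 := by
      rw [← hrow', mem_rowSet]
    have huk := hs'.utility i' ⟨k, hk⟩
    simp only [run_ite, holds_and, holds_natEq, holds_not, holds_realLe, eval_get, eval_const,
      eval_var, eval_get_real, hk', hs'.items, h6, hT, huk, run_setVar, run_skip]
    have hlt : ∀ l : Fin m, (l : ℕ) < k + 1 → l = ⟨k, hk⟩ ∨ (l : ℕ) < k := by
      intro l hl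
      rcases Nat.lt_succ_iff_lt_or_eq.1 hl with h | h
      · exact Or.inr h
      · exact Or.inl (Fin.ext h)
    split_ifs with hc
    · right
      refine ⟨⟨k, hk⟩, hc.1, by simp, fun l hl hlk => ?_⟩
      rcases hlt l hlk with rfl | hlk
      · exact le_rfl
      rcases hI with ⟨h1, h2⟩ | ⟨j, hj, h1, h2⟩
      · exact absurd hl (h2 l hlk)
      · have h3 := hc.2
        rw [h1, hs'.utility] at h3
        have h4 : (j : ℕ) ≠ m := j.2.ne
        simp only [h4, not_false_eq_true, true_and, not_not] at h3
        exact (h2 l hl hlk).trans h3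
    · rcases hI with ⟨h1, h2⟩ | ⟨j, hj, h1, h2⟩
      · refine Or.inl ⟨h1, fun l hlk => ?_⟩
        rcases hlt l hlk with rfl | hlk
        · exact fun hl => hc ⟨hl, fun h => h.1 h1⟩
        · exact h2 l hlk
      · refine Or.inr ⟨j, hj, h1, fun l hl hlk => ?_⟩
        rcases hlt l hlk with rfl | hlk
        · by_contra h3
          apply hc
          refine ⟨hl, fun h4 => h4.2 ?_⟩
          rw [h1, hs'.utility]
          exact (not_le.1 h3).le
        · exact h2 l hl hlk

/-- Copy the candidate set of agent `i` into the working set. -/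
def copyRow : Code :=
  .loop 4 1 (.setNat 4 (.const 0) (.var 4) (.get 3 (.var 7) (.var 4)))

theorem run_copyRow {s : Memory} (hm : s.var 1 = m) :
    rowSet m (copyRow.run s) 4 0 = rowSet m s 3 (s.var 7) := by
  have h := run_loop (x := 4) (y := 1)
    (c := .setNat 4 (.const 0) (.var 4) (.get 3 (.var 7) (.var 4))) s (fun k s' =>
      ∀ j < k, s'.natArray 4 0 j = s.natArray 3 (s.var 7) j) (fun _ _ _ h => h) (by simp) ?_
  · rw [hm] at h
    exact rowSet_congr fun j => h j j.2
  · intro k _ s' hsame hk hI j hj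
    simp only [run_setNat, eval_const, eval_var, eval_get, hk, Memory.setNat_natArray, true_and,
      hsame.var 7 (by decide), hsame.nat 3 (by decide)]
    split_ifs with hjk
    · rw [hjk]
    · exact hI j (by omega)

end Search

/-! ### Computing the sum of the r largest values -/

section TopSum

variable {n m : ℕ} {u : Fin n → Fin m → ℝ}

/-- Sum the `r` largest utilities for agent `i'` in the candidate set of agent `i`. -/
def topSum : Code :=
  copyRow ;;
  .setReal 3 (.const 0) (.const 0) (.const 0) ;;
  .loop 9 1 (.ite (.natLe (.add (.var 9) (.const 1)) (.var 2))
    (findMax ;;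
      .ite (.natLe (.add (.var 5) (.const 1)) (.var 1))
        (.setReal 3 (.const 0) (.const 0)
            (.add (.get 3 (.const 0) (.const 0)) (.get 0 (.var 6) (.var 5))) ;;
          .setNat 4 (.const 0) (.var 5) (.const 0))
        .skip)
    .skip)

/-- Invariant: the partial sum plus the sum of the r - k largest remaining values is constant, by
`sumTop_succ`. The loop makes m passes and idles once r items are summed, hence r ≤ m. -/
theorem run_topSum {s : Memory} (hs : HasInstance u s) {i' : Fin n} (hi' : s.var 6 = i')
    (hr : s.var 2 ≤ m) :
    (topSum.run s).realArray 3 0 0 = sumTop (s.var 2) (u i') (rowSet m s 3 (s.var 7)) := by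
  set r := s.var 2 with hrdef
  set S := rowSet m s 3 (s.var 7) with hS
  rw [topSum, run_seq, run_seq]
  have hcopy : rowSet m (copyRow.run s) 4 0 = S := run_copyRow hs.items
  set s₁ := copyRow.run s with hs₁
  have hsame₁ : SameOff copyRow s s₁ := sameOff_run _ _
  set s₂ := (Code.setReal 3 (.const 0) (.const 0) (.const 0)).run s₁ with hs₂
  have hs₂' : HasInstance u s₂ := (hs.of_sameOff hsame₁ (by decide)).of_sameOff
    (sameOff_run _ _) (by decide)
  have h2 : s₂.var 2 = r := hsame₁.var 2 (by decide)
  have h6 : s₂.var 6 = i' := (hsame₁.var 6 (by decide)).trans hi'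
  have h := run_loop (x := 9) (y := 1) (c := (.ite (.natLe (.add (.var 9) (.const 1)) (.var 2))
    (findMax ;;
      .ite (.natLe (.add (.var 5) (.const 1)) (.var 1))
        (.setReal 3 (.const 0) (.const 0)
            (.add (.get 3 (.const 0) (.const 0)) (.get 0 (.var 6) (.var 5))) ;;
          .setNat 4 (.const 0) (.var 5) (.const 0))
        .skip)
    .skip)) s₂ (fun k s' => s'.realArray 3 0 0 +
      sumTop (r - k) (u i') (rowSet m s' 4 0) = sumTop r (u i') S) (fun _ _ _ h => h) ?_ ?_
  · rw [hs₂'.items, Nat.sub_eq_zero_of_le hr, sumTop_zero, add_zero] at h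
    exact h
  · have : s₂.realArray 3 0 0 = 0 := by simp [hs₂]
    rw [this, zero_add]
    exact congrArg _ hcopy
  · intro k hk s' hsame hk' hI
    have hs' : HasInstance u s' := hs₂'.of_sameOff hsame (by decide)
    have h2' : s'.var 2 = r := (hsame.var 2 (by decide)).trans h2
    have h6' : s'.var 6 = i' := (hsame.var 6 (by decide)).trans h6
    simp only [run_ite, holds_natLe, eval_add, eval_var, eval_const, hk', h2', run_seq, run_skip]
    split_ifs with hkr hbest
    · have hf := run_findMax hs' h6'
      have hsame₃ := sameOff_run findMax s'
      set s₃ := findMax.run s' with hs₃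
      have hs₃' : HasInstance u s₃ := hs'.of_sameOff hsame₃ (by decide)
      rw [hs₃'.items] at hbest
      rcases hf with ⟨h1, -⟩ | ⟨j, hj, h1, hmax⟩
      · omega
      have hrow : rowSet m s₃ 4 0 = rowSet m s' 4 0 :=
        rowSet_congr fun j => by rw [hsame₃.nat 4 (by decide)]
      simp only [run_setReal, run_setNat, eval_const, eval_var, eval_add_real, eval_get_real,
        Memory.setReal_var, Memory.setNat_realArray, Memory.setReal_realArray, and_self, if_true,
        h1, hsame₃.var 6 (by decide), h6', hs₃'.utility]
      rw [rowSet_setNat_zero, hsame₃.real 3 (by decide)]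
      have hrow' : rowSet m (s₃.setReal 3 0 0 (s'.realArray 3 0 0 + u i' j)) 4 0 =
        rowSet m s' 4 0 := hrow
      rw [hrow', ← hI, show r - k = r - (k + 1) + 1 by omega, sumTop_succ _ hj hmax, add_assoc]
    · have hf := run_findMax hs' h6'
      have hsame₃ := sameOff_run findMax s'
      set s₃ := findMax.run s' with hs₃
      have hs₃' : HasInstance u s₃ := hs'.of_sameOff hsame₃ (by decide)
      rw [hs₃'.items] at hbest
      rcases hf with ⟨-, h1⟩ | ⟨j, hj, h1, hmax⟩
      · have hrow : rowSet m s₃ 4 0 = ∅ := by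
          rw [← h1]
          exact rowSet_congr fun j => by rw [hsame₃.nat 4 (by decide)]
        rw [hrow, sumTop_empty, hsame₃.real 3 (by decide), ← hI, h1, sumTop_empty]
      · have := j.2
        omega
    · rw [show r - (k + 1) = r - k by omega]
      exact hI

end TopSum

/-! ### The removal loops as programs -/

section Removal

variable {n m : ℕ} {u : Fin n → Fin m → ℝ} {r : ℕ} {τ : ℝ}

/-- The memory contains a problem instance for threshold matching with removal. -/
structure HasThreshold (u : Fin n → Fin m → ℝ) (r : ℕ) (τ : ℝ) (s : Memory) : Prop
    extends HasInstance u s where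
  bundleSize : s.var 2 = r
  le_items : r ≤ m
  nonneg : 0 ≤ τ
  threshold : s.realArray 1 0 0 = τ
  bundleThreshold : s.realArray 2 0 0 = r * τ

theorem HasThreshold.of_sameOff {c : Code} {s s' : Memory}
    (hs : HasThreshold u r τ s) (h : SameOff c s s')
    (hc : (0 ∉ c.modVars ∧ 1 ∉ c.modVars ∧ 0 ∉ c.modReals) ∧ 2 ∉ c.modVars ∧ 1 ∉ c.modReals ∧
      2 ∉ c.modReals) : HasThreshold u r τ s' where
  toHasInstance := hs.toHasInstance.of_sameOff h hc.1
  bundleSize := (h.var 2 hc.2.1).trans hs.bundleSize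
  le_items := hs.le_items
  nonneg := hs.nonneg
  threshold := by rw [h.real 1 hc.2.2.1, hs.threshold]
  bundleThreshold := by rw [h.real 2 hc.2.2.2, hs.bundleThreshold]

/-- One iteration of the removal loop. -/
def removeStep : Code :=
  topSum ;;
  .ite (.realLe (.get 3 (.const 0) (.const 0)) (.get 2 (.const 0) (.const 0))) .skip
    (copyRow ;; findMax ;;
      .ite (.natLe (.add (.var 5) (.const 1)) (.var 1))
        (.setNat 3 (.var 7) (.var 5) (.const 0)) .skip)

theorem run_removeStep {s : Memory} (hs : HasThreshold u r τ s) {i' : Fin n}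
    (hi' : s.var 6 = i') :
    (∀ k ≠ s.var 7, (removeStep.run s).natArray 3 k = s.natArray 3 k) ∧
    ((sumTop r (u i') (rowSet m s 3 (s.var 7)) ≤ r * τ ∧
      rowSet m (removeStep.run s) 3 (s.var 7) = rowSet m s 3 (s.var 7)) ∨
    (r * τ < sumTop r (u i') (rowSet m s 3 (s.var 7)) ∧ ∃ j ∈ rowSet m s 3 (s.var 7),
      (∀ k ∈ rowSet m s 3 (s.var 7), u i' k ≤ u i' j) ∧
      rowSet m (removeStep.run s) 3 (s.var 7) = (rowSet m s 3 (s.var 7)).erase j)) := by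
  have hsum := run_topSum hs.toHasInstance hi' (hs.bundleSize.trans_le hs.le_items)
  set i := s.var 7 with hi
  set S := rowSet m s 3 i with hS
  rw [hs.bundleSize] at hsum
  rw [removeStep, run_seq]
  have hsame₁ := sameOff_run topSum s
  set s₁ := topSum.run s with hs₁
  have hs₁' : HasThreshold u r τ s₁ := hs.of_sameOff hsame₁ (by decide)
  have hC₁ : s₁.natArray 3 = s.natArray 3 := hsame₁.nat 3 (by decide)
  have hS₁ : rowSet m s₁ 3 i = S := rowSet_congr fun j => by rw [hC₁]
  simp only [run_ite, holds_realLe, eval_get_real, eval_const, hsum, hs₁'.bundleThreshold,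
    run_skip, run_seq]
  split_ifs with hle hbest
  · exact ⟨fun k _ => by rw [hC₁], Or.inl ⟨hle, hS₁⟩⟩
  all_goals
    have hcopy := run_copyRow (s := s₁) hs₁'.items
    have h7 : s₁.var 7 = i := hsame₁.var 7 (by decide)
    have hsame₂ := sameOff_run copyRow s₁
    set s₂ := copyRow.run s₁ with hs₂
    have hs₂' : HasThreshold u r τ s₂ := hs₁'.of_sameOff hsame₂ (by decide)
    rw [h7, hS₁] at hcopy
    have hf := run_findMax hs₂'.toHasInstance (i' := i')
      ((hsame₂.var 6 (by decide)).trans ((hsame₁.var 6 (by decide)).trans hi'))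
    rw [hcopy] at hf
    have hsame₃ := sameOff_run findMax s₂
    set s₃ := findMax.run s₂ with hs₃
    have hs₃' : HasThreshold u r τ s₃ := hs₂'.of_sameOff hsame₃ (by decide)
    have hC₃ : s₃.natArray 3 = s.natArray 3 :=
      (hsame₃.nat 3 (by decide)).trans ((hsame₂.nat 3 (by decide)).trans hC₁)
    have h7₃ : s₃.var 7 = i := (hsame₃.var 7 (by decide)).trans
      ((hsame₂.var 7 (by decide)).trans h7)
    have hS₃ : rowSet m s₃ 3 i = S := rowSet_congr fun j => by rw [hC₃]
    simp only [holds_natLe, eval_add, eval_var, eval_const, hs₃'.items] at hbest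
  · rcases hf with ⟨h1, -⟩ | ⟨j, hj, h1, hmax⟩
    · omega
    simp only [run_setNat, eval_var, eval_const, h7₃, h1]
    refine ⟨fun k hk => ?_, Or.inr ⟨not_le.1 hle, j, hj, hmax, ?_⟩⟩
    · funext l
      simp [hk, hC₃]
    · rw [rowSet_setNat_zero, hS₃]
  · rcases hf with ⟨-, h1⟩ | ⟨j, hj, h1, hmax⟩
    -- An empty set never exceeds the bound r * τ ≥ 0, so a removal always finds an item.
    · exfalso
      rw [h1, sumTop_empty] at hle
      exact hle (mul_nonneg (Nat.cast_nonneg r) hs.nonneg)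
    · have := j.2
      omega

/-- The removal loop for the agents `i` and `i'`. -/
def removalLoop : Code := .loop 8 1 removeStep

/-- A fixed number m of passes replaces the `while` loop: each pass erases an item until the sum is
small enough, and then nothing changes. The middle clause of the invariant says that every
completion from the current set is a completion from the initial one. -/
theorem run_removalLoop {s : Memory} (hs : HasThreshold u r τ s) {i' : Fin n}
    (hi' : s.var 6 = i') :
    (∀ k ≠ s.var 7, (removalLoop.run s).natArray 3 k = s.natArray 3 k) ∧
      WhileRemoval r τ (u i') (rowSet m s 3 (s.var 7)) (rowSet m (removalLoop.run s) 3 (s.var 7)) := by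
  set i := s.var 7 with hi
  set S := rowSet m s 3 i with hS
  have h := run_loop (x := 8) (y := 1) (c := removeStep) s (fun k s' =>
    (∀ k ≠ i, s'.natArray 3 k = s.natArray 3 k) ∧
    (∀ T, WhileRemoval r τ (u i') (rowSet m s' 3 i) T → WhileRemoval r τ (u i') S T) ∧
    ((rowSet m s' 3 i).card + k ≤ m ∨ sumTop r (u i') (rowSet m s' 3 i) ≤ r * τ))
    (fun _ _ _ h => h) ⟨fun _ _ => rfl, fun _ h => h, Or.inl ?_⟩ ?_
  · obtain ⟨h1, h2, h3⟩ := h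
    refine ⟨h1, h2 _ (.done _ ?_)⟩
    rcases h3 with h3 | h3
    · rw [hs.items] at h3
      have h4 : (rowSet m ((Code.loop 8 1 removeStep).run s) 3 i).card = 0 := by omega
      rw [Finset.card_eq_zero.1 h4, sumTop_empty]
      exact mul_nonneg (Nat.cast_nonneg r) hs.nonneg
    · exact h3
  · simpa using Finset.card_le_univ S
  · rintro k - s' hsame - ⟨h1, h2, h3⟩
    have hs' : HasThreshold u r τ s' := hs.of_sameOff hsame (by decide)
    have hstep := run_removeStep hs' ((hsame.var 6 (by decide)).trans hi')
    rw [hsame.var 7 (by decide), ← hi] at hstep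
    obtain ⟨g1, ⟨g2, g3⟩ | ⟨g2, j, hj, hmax, g3⟩⟩ := hstep
    · refine ⟨fun k hk => (g1 k hk).trans (h1 k hk), ?_, ?_⟩
      · rwa [g3]
      · rw [g3]
        exact Or.inr g2
    · refine ⟨fun k hk => (g1 k hk).trans (h1 k hk), fun T hT => ?_, ?_⟩
      · rw [g3] at hT
        exact h2 T (.remove _ _ j g2 hj hmax hT)
      · rw [g3, Finset.card_erase_of_mem hj]
        have := Finset.card_pos.2 ⟨j, hj⟩
        rcases h3 with h3 | h3
        · exact Or.inl (by omega)
        · exact absurd h3 (not_le.2 g2)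

/-- The removal loops for agent `i` and all other agents. -/
def removalLoops : Code := .loop 6 0 (.ite (.natEq (.var 6) (.var 7)) .skip removalLoop)

theorem run_removalLoops {s : Memory} (hs : HasThreshold u r τ s) {i : Fin n}
    (hi : s.var 7 = i) :
    (∀ k ≠ (i : ℕ), (removalLoops.run s).natArray 3 k = s.natArray 3 k) ∧
      ForRemoval r τ u ((List.finRange n).filter fun i' => i' ≠ i)
        (rowSet m s 3 i) (rowSet m (removalLoops.run s) 3 i) := by
  have h := run_loop (x := 6) (y := 0)
    (c := .ite (.natEq (.var 6) (.var 7)) .skip removalLoop) s (fun k s' =>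
    (∀ k ≠ (i : ℕ), s'.natArray 3 k = s.natArray 3 k) ∧
    ForRemoval r τ u (((List.finRange n).take k).filter fun i' => i' ≠ i)
      (rowSet m s 3 i) (rowSet m s' 3 i)) (fun _ _ _ h => h) ⟨fun _ _ => rfl, .nil _⟩ ?_
  · rw [hs.agents, List.take_of_length_le (by simp)] at h
    exact h
  · rintro k hk s' hsame hk' ⟨h1, h2⟩
    rw [hs.agents] at hk
    have hs' : HasThreshold u r τ s' := hs.of_sameOff hsame (by decide)
    have h7 : s'.var 7 = i := (hsame.var 7 (by decide)).trans hi
    have htake : (List.finRange n).take (k + 1) = (List.finRange n).take k ++ [⟨k, hk⟩] := by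
      rw [List.take_succ_eq_append_getElem (by simpa using hk)]
      simp
    rw [htake, List.filter_append]
    simp only [run_ite, holds_natEq, eval_var, hk', h7, run_skip]
    split_ifs with hki
    · have : (⟨k, hk⟩ : Fin n) = i := Fin.ext hki
      exact ⟨h1, by simpa [this] using h2⟩
    · have hne : (⟨k, hk⟩ : Fin n) ≠ i := fun h => hki (congrArg Fin.val h)
      have hloop := run_removalLoop hs' (i' := ⟨k, hk⟩) hk'
      rw [h7] at hloop
      refine ⟨fun l hl => (hloop.1 l hl).trans (h1 l hl), ?_⟩
      have h3 := h2.append_singleton hloop.2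
      simpa [hne] using h3

/-- Compute the initial candidate set of agent `i`. -/
def initRow : Code :=
  .loop 4 1 (.ite (.realLe (.get 1 (.const 0) (.const 0)) (.get 0 (.var 7) (.var 4)))
    (.setNat 3 (.var 7) (.var 4) (.const 1)) (.setNat 3 (.var 7) (.var 4) (.const 0)))

theorem run_initRow {s : Memory} (hs : HasThreshold u r τ s) {i : Fin n} (hi : s.var 7 = i) :
    (∀ k ≠ (i : ℕ), (initRow.run s).natArray 3 k = s.natArray 3 k) ∧
      ∀ j, j ∈ rowSet m (initRow.run s) 3 i ↔ τ ≤ u i j := by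
  have h := run_loop (x := 4) (y := 1)
    (c := .ite (.realLe (.get 1 (.const 0) (.const 0)) (.get 0 (.var 7) (.var 4)))
    (.setNat 3 (.var 7) (.var 4) (.const 1)) (.setNat 3 (.var 7) (.var 4) (.const 0)))
    s (fun k s' => (∀ k ≠ (i : ℕ), s'.natArray 3 k = s.natArray 3 k) ∧
    ∀ j : Fin m, (j : ℕ) < k → (s'.natArray 3 i j = 1 ↔ τ ≤ u i j))
    (fun _ _ _ h => h) ⟨fun _ _ => rfl, by simp⟩ ?_
  · rw [hs.items] at h
    exact ⟨h.1, fun j => mem_rowSet.trans (h.2 j j.2)⟩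
  · rintro k hk s' hsame hk' ⟨h1, h2⟩
    rw [hs.items] at hk
    have hs' : HasThreshold u r τ s' := hs.of_sameOff hsame (by decide)
    have h7 : s'.var 7 = i := (hsame.var 7 (by decide)).trans hi
    have huk := hs'.utility i ⟨k, hk⟩
    simp only [run_ite, holds_realLe, eval_var, hk', h7, eval_get_real, eval_const, run_setNat,
      hs'.threshold, huk]
    have hlt : ∀ l : Fin m, (l : ℕ) < k + 1 → l ≠ ⟨k, hk⟩ → (l : ℕ) < k := by
      intro l hl hne
      have : (l : ℕ) ≠ k := fun h => hne (Fin.ext h)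
      omega
    split_ifs with hτ
    all_goals
      refine ⟨fun l hl => ?_, fun j hj => ?_⟩
      · funext a
        simp [hl, h1 l hl]
      · by_cases hjk : j = ⟨k, hk⟩
        · simp [hjk, hτ]
        · have hne : (j : ℕ) ≠ k := fun h => hjk (Fin.ext h)
          simpa [hne] using h2 j (hlt j hj hjk)

/-- Compute all candidate sets. -/
def candidateSets : Code := .loop 7 0 (initRow ;; removalLoops)

theorem run_candidateSets {s : Memory} (hs : HasThreshold u r τ s) :
    IsCandidateFamily r τ u fun i => rowSet m (candidateSets.run s) 3 i := by
  classical
  have h := run_loop (x := 7) (y := 0) (c := initRow ;; removalLoops) s (fun k s' =>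
    ∀ i : Fin n, (i : ℕ) < k → ForRemoval r τ u ((List.finRange n).filter fun i' => i' ≠ i)
      (Finset.univ.filter fun j => τ ≤ u i j) (rowSet m s' 3 i)) (fun _ _ _ h => h) (by simp) ?_
  · rw [hs.agents] at h
    intro i
    convert h i i.2 using 1
    rfl
  · intro k hk s' hsame hk' hI i hik
    rw [hs.agents] at hk
    have hs' : HasThreshold u r τ s' := hs.of_sameOff hsame (by decide)
    have hinit := run_initRow hs' (i := ⟨k, hk⟩) hk'
    rw [run_seq]
    have hsame₁ := sameOff_run initRow s'
    set s₁ := initRow.run s' with hs₁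
    have hloops := run_removalLoops (hs'.of_sameOff hsame₁ (by decide)) (i := ⟨k, hk⟩)
      ((hsame₁.var 7 (by decide)).trans hk')
    by_cases hki : i = ⟨k, hk⟩
    · subst hki
      have : (Finset.univ.filter fun j => τ ≤ u ⟨k, hk⟩ j) = rowSet m s₁ 3 k := by
        ext j
        rw [Finset.mem_filter, ← hinit.2 j]
        simp
      rw [this]
      exact hloops.2
    · have hne : (i : ℕ) ≠ k := fun h => hki (Fin.ext h)
      have hrow : rowSet m (removalLoops.run s₁) 3 i = rowSet m s' 3 i :=
        rowSet_congr fun j => by rw [hloops.1 i hne, hinit.1 i hne]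
      rw [hrow]
      exact hI i (by omega)

end Removal

/-! ### Perfect matchings by an auction

Free items bid for slots. The invariant is that an item that holds a slot could not do better by
more than 1 with any other adjacent slot, and that free slots have price 0. -/

section Auction

variable {m : ℕ} {adj : ℕ → ℕ → Prop} {P H Q : ℕ → ℕ}

/-- The invariant of the auction: slot `s` has price `P s`, it is held by item `H s - 1` (and free if
`H s = 0`), and `Q j ≠ 0` if item `j` holds a slot. -/
structure AuctionInvariant (m : ℕ) (adj : ℕ → ℕ → Prop) (P H Q : ℕ → ℕ) : Prop where
  holder_le : ∀ s < m, H s ≤ m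
  holder_injective : ∀ s < m, ∀ s' < m, H s ≠ 0 → H s = H s' → s = s'
  assigned_iff : ∀ j < m, Q j ≠ 0 ↔ ∃ s < m, H s = j + 1
  price_eq_zero : ∀ s < m, H s = 0 → P s = 0
  adj_holder : ∀ s < m, ∀ j, H s = j + 1 → adj s j
  price_le_add_one : ∀ s < m, ∀ j, H s = j + 1 → ∀ s' < m, adj s' j → P s ≤ P s' + 1
  price_le : ∀ s < m, P s ≤ m + 1

theorem AuctionInvariant.init (hP : ∀ s < m, P s = 0) (hH : ∀ s < m, H s = 0)
    (hQ : ∀ s < m, Q s = 0) : AuctionInvariant m adj P H Q where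
  holder_le s hs := by simp [hH s hs]
  holder_injective s hs s' hs' h _ := absurd (hH s hs) h
  assigned_iff j hj := by
    simp only [hQ j hj, ne_eq, not_true_eq_false, false_iff, not_exists, not_and]
    intro s hs
    simp [hH s hs]
  price_eq_zero s hs _ := hP s hs
  adj_holder s hs j h := by simp [hH s hs] at h
  price_le_add_one s hs j h := by simp [hH s hs] at h
  price_le s hs := by simp [hP s hs]

/-- A free item `j` takes the slot `b` from its holder. -/
theorem AuctionInvariant.bid (h : AuctionInvariant m adj P H Q) {j b : ℕ} (hj : j < m)
    (hQ : Q j = 0) (hb : b < m) (hadj : adj b j) (hmin : ∀ s < m, adj s j → P b ≤ P s)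
    (hP : P b ≤ m) {Q' : ℕ → ℕ}
    (hQ' : ∀ k, Q' k = if k = j then 1 else if H b = k + 1 then 0 else Q k) :
    AuctionInvariant m adj (Function.update P b (P b + 1)) (Function.update H b (j + 1)) Q' := by
  have hfree : ∀ s < m, H s ≠ j + 1 := fun s hs hsj =>
    (h.assigned_iff j hj).2 ⟨s, hs, hsj⟩ hQ
  have hPle : ∀ s, P s ≤ Function.update P b (P b + 1) s := by
    intro s
    rw [Function.update_apply]
    split_ifs with hsb
    · rw [hsb]; omega
    · exact le_rfl
  constructor
  · intro s hs
    rw [Function.update_apply]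
    split_ifs
    · omega
    · exact h.holder_le s hs
  · intro s hs s' hs'
    simp only [Function.update_apply]
    split_ifs with h1 h2 h2
    · intros
      rw [h1, h2]
    · exact fun _ h3 => absurd h3.symm (hfree s' hs')
    · exact fun _ h3 => absurd h3 (hfree s hs)
    · exact h.holder_injective s hs s' hs'
  · intro k hk
    rw [hQ']
    by_cases hkj : k = j
    · subst hkj
      simp only [if_true, ne_eq, one_ne_zero, not_false_eq_true, true_iff]
      exact ⟨b, hb, by simp⟩
    rw [if_neg hkj]
    split_ifs with hHb
    · simp only [ne_eq, not_true_eq_false, false_iff, not_exists, not_and]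
      intro s hs
      rw [Function.update_apply]
      split_ifs with hsb
      · omega
      · intro h1
        exact hsb (h.holder_injective s hs b hb (by omega) (by omega))
    · rw [h.assigned_iff k hk]
      refine exists_congr fun s => and_congr_right fun hs => ?_
      rw [Function.update_apply]
      split_ifs with hsb
      · subst hsb
        constructor <;> intro <;> omega
      · rfl
  · intro s hs
    simp only [Function.update_apply]
    split_ifs with hsb
    · intro h0
      omega
    · exact h.price_eq_zero s hs
  · intro s hs k
    simp only [Function.update_apply]
    split_ifs with hsb
    · intro hk
      have : k = j := by omega
      rw [hsb, this]
      exact hadj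
    · exact h.adj_holder s hs k
  · intro s hs k
    rw [Function.update_apply]
    split_ifs with hsb
    · intro hk s' hs' hs'k
      have hkj : k = j := by omega
      -- The slot b was a cheapest one for j, so after the raise it exceeds the others by at most 1.
      -- For other holders, prices elsewhere only rise.
      have h1 := hmin s' hs' (hkj ▸ hs'k)
      have h2 := hPle s'
      rw [hsb, Function.update_self]
      omega
    · intro hk s' hs' hs'k
      have h1 := h.price_le_add_one s hs k hk s' hs' hs'k
      have h2 := hPle s'
      rw [Function.update_of_ne hsb]
      omega
  · intro s hs
    rw [Function.update_apply]
    split_ifs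
    · omega
    · exact h.price_le s hs

/-- If all slots that are adjacent to a free item are too expensive, then Hall's condition fails. -/
theorem AuctionInvariant.exists_obstruction (h : AuctionInvariant m adj P H Q) {j : ℕ} (hj : j < m)
    (hQ : Q j = 0) (hP : ∀ s < m, adj s j → m < P s) :
    ∃ S ⊆ Finset.range m, ∃ Y ⊆ Finset.range m, Y.card = S.card + 1 ∧
      ∀ k ∈ Y, ∀ s < m, adj s k → s ∈ S := by
  -- Pigeonhole: the m slots miss one of the m + 1 price levels 0, …, m.
  obtain ⟨l, hl, hgap⟩ : ∃ l ≤ m, ∀ s < m, P s ≠ l := by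
    have hcard : ((Finset.range m).image P).card < (Finset.range (m + 1)).card := by
      refine Finset.card_image_le.trans_lt ?_
      simp
    obtain ⟨l, hl, hl'⟩ := Finset.exists_mem_notMem_of_card_lt_card hcard
    refine ⟨l, Nat.lt_succ_iff.1 (Finset.mem_range.1 hl), fun s hs hsl => hl' ?_⟩
    exact Finset.mem_image.2 ⟨s, Finset.mem_range.2 hs, hsl⟩
  -- Slots above the gap have positive price, so all are held. Their holders, together with the free
  -- item j, are one more than these slots.
  set S := (Finset.range m).filter fun s => l < P s with hS
  have hSm : ∀ s ∈ S, s < m ∧ l < P s := fun s hs => by simpa [hS] using hs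
  have hSH : ∀ s ∈ S, H s ≠ 0 := fun s hs h0 => by
    have := h.price_eq_zero s (hSm s hs).1 h0
    have := (hSm s hs).2
    omega
  have hjS : j ∉ S.image fun s => H s - 1 := by
    intro hjS
    obtain ⟨s, hs, hsj⟩ := Finset.mem_image.1 hjS
    have := hSH s hs
    exact (h.assigned_iff j hj).2 ⟨s, (hSm s hs).1, by omega⟩ hQ
  refine ⟨S, Finset.filter_subset _ _, insert j (S.image fun s => H s - 1), ?_, ?_, ?_⟩
  · intro k hk
    rw [Finset.mem_range]
    rcases Finset.mem_insert.1 hk with rfl | hk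
    · exact hj
    · obtain ⟨s, hs, rfl⟩ := Finset.mem_image.1 hk
      have h1 := hSH s hs
      have h2 := h.holder_le s (hSm s hs).1
      omega
  · rw [Finset.card_insert_of_notMem hjS, Finset.card_image_of_injOn]
    intro s hs s' hs' hss
    have h1 := hSH s hs
    have h2 := hSH s' hs'
    simp only at hss
    exact h.holder_injective s (hSm s hs).1 s' (hSm s' hs').1 h1 (by omega)
  · intro k hk s hs hsk
    -- A holder of a slot above l has only adjacent slots of price at least l, as it is within 1 of
    -- optimal; since no price equals l, these all lie in S.
    have hlP : l ≤ P s := by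
      rcases Finset.mem_insert.1 hk with rfl | hk
      · exact hl.trans (hP s hs hsk).le
      · obtain ⟨s', hs', rfl⟩ := Finset.mem_image.1 hk
        have h1 := hSH s' hs'
        have h2 := h.price_le_add_one s' (hSm s' hs').1 (H s' - 1) (by omega) s hs hsk
        have h3 := (hSm s' hs').2
        omega
    simp only [hS, Finset.mem_filter, Finset.mem_range]
    exact ⟨hs, lt_of_le_of_ne hlP (hgap s hs).symm⟩

/-- As long as there are free items, there is a free slot, and the sum of the prices is small. -/
theorem AuctionInvariant.sum_price_lt (h : AuctionInvariant m adj P H Q) {j : ℕ} (hj : j < m)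
    (hQ : Q j = 0) : ∑ s ∈ Finset.range m, P s < m * m := by
  -- If all m slots were held, distinct holders would exhaust the m items, including j.
  obtain ⟨s, hs, hHs⟩ : ∃ s < m, H s = 0 := by
    by_contra! hne
    have hsurj : Function.Surjective fun s : Fin m => (⟨H s - 1, by
        have := hne s s.2
        have := h.holder_le s s.2
        omega⟩ : Fin m) := by
      refine Finite.surjective_of_injective fun s s' hss => ?_
      have h1 := hne s s.2
      have h2 := hne s' s'.2
      simp only [Fin.mk.injEq] at hss
      exact Fin.ext (h.holder_injective s s.2 s' s'.2 h1 (by omega))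
    obtain ⟨s, hs⟩ := hsurj ⟨j, hj⟩
    simp only [Fin.mk.injEq] at hs
    have := hne s s.2
    exact (h.assigned_iff j hj).2 ⟨s, s.2, by omega⟩ hQ
  -- The free slot contributes 0 and the others at most m + 1 each, and (m - 1)(m + 1) < m².
  rw [← Finset.add_sum_erase _ _ (Finset.mem_range.2 hs), h.price_eq_zero s hs hHs, zero_add]
  have h1 : ∑ s ∈ (Finset.range m).erase s, P s ≤ ((Finset.range m).erase s).card • (m + 1) :=
    Finset.sum_le_card_nsmul _ _ _ fun t ht =>
      h.price_le t (Finset.mem_range.1 (Finset.mem_of_mem_erase ht))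
  rw [Finset.card_erase_of_mem (Finset.mem_range.2 hs), Finset.card_range, smul_eq_mul] at h1
  obtain ⟨m, rfl⟩ : ∃ k, m = k + 1 := ⟨m - 1, by omega⟩
  refine h1.trans_lt ?_
  rw [Nat.add_sub_cancel]
  nlinarith

end Auction

/-! ### Slots: r copies of each agent -/

section SlotOwner

variable {n r : ℕ}

theorem card_filter_mod_eq (i : Fin n) :
    (Finset.univ.filter fun s : Fin (r * n) => (s : ℕ) % n = i).card = r := by
  have h : (Finset.univ.filter fun s : Fin (r * n) => (s : ℕ) % n = i) =
      (Finset.univ : Finset (Fin r)).map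
        ⟨fun b => blockItem b i, fun b b' h => (blockItem_injective h).1⟩ := by
    ext s
    obtain ⟨⟨b, k⟩, rfl⟩ := finProdFinEquiv.surjective s
    simp only [Finset.mem_filter, Finset.mem_univ, true_and, Finset.mem_map]
    change (k + n * b : ℕ) % n = i ↔ _
    rw [Nat.add_mul_mod_self_left, Nat.mod_eq_of_lt k.2, Fin.val_inj]
    constructor
    · rintro rfl
      exact ⟨b, rfl⟩
    · rintro ⟨b', h⟩
      exact (blockItem_injective (b := b') (b' := b) h).2.symm
  rw [h, Finset.card_map, Finset.card_univ, Fintype.card_fin]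

/-- In a perfect matching the owners I of the items in Y satisfy |Y| ≤ r|I|. All r|I| slots of these
owners are adjacent to items of Y and so lie in S, which contradicts |Y| = |S| + 1. -/
theorem not_exists_isPerfectMatching_of_obstruction (C : Fin n → Finset (Fin (r * n)))
    (hC : ∃ S ⊆ Finset.range (r * n), ∃ Y ⊆ Finset.range (r * n), Y.card = S.card + 1 ∧
      ∀ j ∈ Y, ∀ s < r * n, (∃ (i : Fin n) (k : Fin (r * n)), s % n = i ∧ j = k ∧ k ∈ C i) →
        s ∈ S) :
    ¬ ∃ A, IsPerfectMatching r C A := by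
  classical
  rintro ⟨A, hA, hA'⟩
  obtain ⟨S, hS, Y, hY, hcard, h⟩ := hC
  set Y' : Finset (Fin (r * n)) := Finset.univ.filter fun j => (j : ℕ) ∈ Y with hY'
  have hYc : Y'.card = Y.card := by
    rw [← Finset.card_map Fin.valEmbedding]
    congr 1
    ext j
    simp only [hY', Finset.mem_map, Finset.mem_filter, Finset.mem_univ, true_and,
      Fin.valEmbedding_apply]
    exact ⟨fun ⟨k, hk, hkj⟩ => hkj ▸ hk, fun hj => ⟨⟨j, Finset.mem_range.1 (hY hj)⟩, hj, rfl⟩⟩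
  set I := Y'.image A with hI
  have h1 : Y'.card ≤ r * I.card := by
    refine Finset.card_le_mul_card_image Y' r fun i _ => ?_
    refine (Finset.card_le_card fun j hj => ?_).trans (hA' i).le
    simp only [bundle, Finset.mem_filter, Finset.mem_univ, true_and]
    exact (Finset.mem_filter.1 hj).2
  have h2 : (I.biUnion fun i => (Finset.univ.filter fun s : Fin (r * n) =>
      (s : ℕ) % n = i)).card = I.card * r := by
    rw [Finset.card_biUnion, Finset.sum_congr rfl fun i _ => card_filter_mod_eq i,
      Finset.sum_const, smul_eq_mul]
    intro i _ i' _ hii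
    exact Finset.disjoint_filter.2 fun s _ hs hs' => hii (Fin.ext (hs.symm.trans hs'))
  have h3 : (I.biUnion fun i => (Finset.univ.filter fun s : Fin (r * n) =>
      (s : ℕ) % n = i)).card ≤ S.card := by
    rw [← Finset.card_map Fin.valEmbedding]
    refine Finset.card_le_card fun s hs => ?_
    simp only [Finset.mem_map, Finset.mem_biUnion, Finset.mem_filter, Finset.mem_univ, true_and,
      Fin.valEmbedding_apply, hI, Finset.mem_image] at hs
    obtain ⟨s, ⟨i, ⟨j, hj, rfl⟩, hsi⟩, rfl⟩ := hs
    exact h j (Finset.mem_filter.1 hj).2 s s.2 ⟨A j, j, hsi, rfl, hA j⟩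
  rw [h2] at h3
  have h4 : I.card * r = r * I.card := mul_comm _ _
  omega

/-- An injection of the m items into the m slots is a bijection, and each agent owns exactly r
slots. -/
theorem isPerfectMatching_of_slots (C : Fin n → Finset (Fin (r * n))) {slot : Fin (r * n) → ℕ}
    (hslot : ∀ j, slot j < r * n) (hinj : Function.Injective slot) {A : Allocation n (r * n)}
    (hA : ∀ j, slot j % n = A j) (hC : ∀ j, j ∈ C (A j)) : IsPerfectMatching r C A := by
  refine ⟨hC, fun i => ?_⟩
  let σ : Fin (r * n) → Fin (r * n) := fun j => ⟨slot j, hslot j⟩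
  have hσ : Function.Injective σ := fun j j' h => hinj (congrArg Fin.val h)
  have hσ' : Function.Surjective σ := Finite.surjective_of_injective hσ
  conv_rhs => rw [← card_filter_mod_eq (r := r) i]
  refine Finset.card_bij (fun j _ => σ j) ?_ (fun j _ j' _ h => hσ h) ?_
  · intro j hj
    simp only [bundle, Finset.mem_filter, Finset.mem_univ, true_and] at hj ⊢
    change slot j % n = i
    rw [hA, hj]
  · intro s hs
    obtain ⟨j, rfl⟩ := hσ' s
    refine ⟨j, ?_, rfl⟩
    simp only [bundle, Finset.mem_filter, Finset.mem_univ, true_and] at hs ⊢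
    exact Fin.ext ((hA j).symm.trans hs)

end SlotOwner

/-! ### The auction as a program

Array 1 of natural numbers holds the owner of slot `s` in entry `(0, s)`. Row 0 of the arrays 5, 6
and 7 holds the prices, the holders of the slots and the state of the items. Variable 10 is 1 if
the auction has failed; 11 is a free item, and 12 the slot that it bids for. -/

section AuctionProgram

variable {n r : ℕ} {C : Fin n → Finset (Fin (r * n))}

/-- Agent `s % n`, who owns slot `s`, may receive item `j`. -/
def SlotAdj (C : Fin n → Finset (Fin (r * n))) (s j : ℕ) : Prop :=
  ∃ (i : Fin n) (k : Fin (r * n)), s % n = i ∧ j = k ∧ k ∈ C i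

/-- The memory contains an instance of the matching problem. -/
structure HasSlots (C : Fin n → Finset (Fin (r * n))) (s : Memory) : Prop where
  agents_pos : 0 < n
  items : s.var 1 = r * n
  owner : ∀ t < r * n, s.natArray 1 0 t = t % n
  candidates : ∀ i : Fin n, rowSet (r * n) s 3 i = C i

theorem HasSlots.of_sameOff {c : Code} {s s' : Memory} (hs : HasSlots C s) (h : SameOff c s s')
    (hc : 1 ∉ c.modVars ∧ 1 ∉ c.modNats ∧ 3 ∉ c.modNats) : HasSlots C s' where
  agents_pos := hs.agents_pos
  items := (h.var 1 hc.1).trans hs.items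
  owner t ht := by rw [h.nat 1 hc.2.1, hs.owner t ht]
  candidates i := (rowSet_congr fun j => by rw [h.nat 3 hc.2.2]).trans (hs.candidates i)

theorem HasSlots.adj_iff {s : Memory} (hs : HasSlots C s) {t j : ℕ} (ht : t < r * n)
    (hj : j < r * n) : s.natArray 3 (s.natArray 1 0 t) j = 1 ↔ SlotAdj C t j := by
  rw [hs.owner t ht]
  have h := mem_rowSet (m := r * n) (s := s) (a := 3) (i := t % n) (j := ⟨j, hj⟩)
  have h2 := hs.candidates ⟨t % n, Nat.mod_lt _ hs.agents_pos⟩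
  simp only at h h2
  rw [← h, h2]
  constructor
  · exact fun h => ⟨_, _, rfl, rfl, h⟩
  · rintro ⟨i, k, h1, h2, h3⟩
    have hi : (⟨t % n, Nat.mod_lt _ hs.agents_pos⟩ : Fin n) = i := Fin.ext h1
    have hk : (⟨j, hj⟩ : Fin (r * n)) = k := Fin.ext h2
    rw [hi, hk]
    exact h3

/-- Find a free item. -/
def findFree : Code :=
  .setVar 11 (.var 1) ;;
  .loop 4 1 (.ite (.natEq (.get 7 (.const 0) (.var 4)) (.const 0)) (.setVar 11 (.var 4)) .skip)

theorem run_findFree {s : Memory} {m : ℕ} (hm : s.var 1 = m) :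
    ((findFree.run s).var 11 = m ∧ ∀ j < m, s.natArray 7 0 j ≠ 0) ∨
      ((findFree.run s).var 11 < m ∧ s.natArray 7 0 ((findFree.run s).var 11) = 0) := by
  rw [findFree, run_seq]
  set s₁ := (Code.setVar 11 (.var 1)).run s with hs₁
  have hm₁ : s₁.var 1 = m := hm
  have h := run_loop (x := 4) (y := 1) (c := .ite (.natEq (.get 7 (.const 0) (.var 4)) (.const 0))
    (.setVar 11 (.var 4)) .skip) s₁ (fun k s' =>
      (s'.var 11 = m ∧ ∀ j < k, s.natArray 7 0 j ≠ 0) ∨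
      (s'.var 11 < m ∧ s.natArray 7 0 (s'.var 11) = 0)) (fun _ _ _ h => h)
      (Or.inl ⟨hm, by simp⟩) ?_
  · rwa [hm₁] at h
  · rintro k hk s' hsame hk' hI
    rw [hm₁] at hk
    have h7 : s'.natArray 7 = s.natArray 7 := hsame.nat 7 (by decide)
    simp only [run_ite, holds_natEq, eval_get, eval_const, eval_var, hk', h7, run_setVar, run_skip]
    split_ifs with hc
    · exact Or.inr (by simpa using ⟨hk, hc⟩)
    · rcases hI with ⟨h1, h2⟩ | h1
      · refine Or.inl ⟨h1, fun j hj => ?_⟩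
        rcases Nat.lt_succ_iff_lt_or_eq.1 hj with hj | rfl
        · exact h2 j hj
        · exact hc
      · exact Or.inr h1

/-- Find a cheapest slot for the free item. -/
def findSlot : Code :=
  .setVar 12 (.var 1) ;;
  .loop 4 1 (.ite (.and (.natEq (.get 3 (.get 1 (.const 0) (.var 4)) (.var 11)) (.const 1))
    (.not (.and (.not (.natEq (.var 12) (.var 1)))
      (.not (.natLe (.get 5 (.const 0) (.var 4)) (.get 5 (.const 0) (.var 12)))))))
    (.setVar 12 (.var 4)) .skip)

theorem run_findSlot {s : Memory} (hs : HasSlots C s) {j : ℕ} (hj : j < r * n)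
    (h11 : s.var 11 = j) :
    ((findSlot.run s).var 12 = r * n ∧ ∀ t < r * n, ¬ SlotAdj C t j) ∨
      ((findSlot.run s).var 12 < r * n ∧ SlotAdj C ((findSlot.run s).var 12) j ∧
        ∀ t < r * n, SlotAdj C t j →
          s.natArray 5 0 ((findSlot.run s).var 12) ≤ s.natArray 5 0 t) := by
  rw [findSlot, run_seq]
  set s₁ := (Code.setVar 12 (.var 1)).run s with hs₁
  have hs₁' : HasSlots C s₁ := hs.of_sameOff (sameOff_run _ _) (by decide)
  have h := run_loop (x := 4) (y := 1)
    (c := .ite (.and (.natEq (.get 3 (.get 1 (.const 0) (.var 4)) (.var 11)) (.const 1))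
    (.not (.and (.not (.natEq (.var 12) (.var 1)))
      (.not (.natLe (.get 5 (.const 0) (.var 4)) (.get 5 (.const 0) (.var 12)))))))
    (.setVar 12 (.var 4)) .skip) s₁ (fun k s' =>
      (s'.var 12 = r * n ∧ ∀ t < k, ¬ SlotAdj C t j) ∨
      (s'.var 12 < r * n ∧ SlotAdj C (s'.var 12) j ∧
        ∀ t < k, SlotAdj C t j → s.natArray 5 0 (s'.var 12) ≤ s.natArray 5 0 t))
      (fun _ _ _ h => h) (Or.inl ⟨hs.items, by simp⟩) ?_
  · rwa [hs₁'.items] at h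
  · rintro k hk s' hsame hk' hI
    rw [hs₁'.items] at hk
    have hs' : HasSlots C s' := hs₁'.of_sameOff hsame (by decide)
    have h5 : s'.natArray 5 = s.natArray 5 := hsame.nat 5 (by decide)
    have h11' : s'.var 11 = j := (hsame.var 11 (by decide)).trans h11
    simp only [run_ite, run_setVar, eval_var, hk', run_skip]
    split_ifs with hc <;> simp only [holds_and, holds_not, holds_natEq, holds_natLe, eval_get,
      eval_const, eval_var, hk', h5, h11', hs'.adj_iff hk hj, hs'.items] at hc
    · refine Or.inr ?_
      simp only [Memory.setVar_var, if_true]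
      refine ⟨hk, hc.1, fun t ht hadj => ?_⟩
      rcases Nat.lt_succ_iff_lt_or_eq.1 ht with ht | rfl
      · rcases hI with ⟨-, h2⟩ | ⟨h1, -, h2⟩
        · exact absurd hadj (h2 t ht)
        · have h3 := hc.2
          simp only [h1.ne, not_false_eq_true, true_and, not_not] at h3
          exact h3.trans (h2 t ht hadj)
      · exact le_rfl
    · rcases hI with ⟨h1, h2⟩ | ⟨h1, h2, h3⟩
      · refine Or.inl ⟨h1, fun t ht hadj => ?_⟩
        rcases Nat.lt_succ_iff_lt_or_eq.1 ht with ht | rfl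
        · exact h2 t ht hadj
        · exact hc ⟨hadj, fun h => h.1 h1⟩
      · refine Or.inr ⟨h1, h2, fun t ht hadj => ?_⟩
        rcases Nat.lt_succ_iff_lt_or_eq.1 ht with ht | rfl
        · exact h3 t ht hadj
        · by_contra hlt
          exact hc ⟨hadj, fun h => h.2 (by omega)⟩

/-- The free item takes the slot that it bids for, and the price of the slot rises. -/
def takeSlot : Code :=
  .ite (.natLe (.const 1) (.get 6 (.const 0) (.var 12)))
    (.setNat 7 (.const 0) (.sub (.get 6 (.const 0) (.var 12)) (.const 1)) (.const 0)) .skip ;;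
  .setNat 6 (.const 0) (.var 12) (.add (.var 11) (.const 1)) ;;
  .setNat 7 (.const 0) (.var 11) (.const 1) ;;
  .setNat 5 (.const 0) (.var 12) (.add (.get 5 (.const 0) (.var 12)) (.const 1))

theorem run_takeSlot {s : Memory} {j b : ℕ} (hj : s.var 11 = j) (hb : s.var 12 = b) :
    (takeSlot.run s).natArray 5 0 =
      Function.update (s.natArray 5 0) b (s.natArray 5 0 b + 1) ∧
    (takeSlot.run s).natArray 6 0 = Function.update (s.natArray 6 0) b (j + 1) ∧
    ∀ k, (takeSlot.run s).natArray 7 0 k =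
      if k = j then 1 else if s.natArray 6 0 b = k + 1 then 0 else s.natArray 7 0 k := by
  by_cases h : 1 ≤ s.natArray 6 0 b
  · have hk : ∀ k, (k = s.natArray 6 0 b - 1) = (s.natArray 6 0 b = k + 1) := fun k => by
      rw [eq_iff_iff]
      omega
    refine ⟨funext fun k => ?_, funext fun k => ?_, fun k => ?_⟩ <;>
      simp [takeSlot, hj, hb, h, Function.update_apply, hk]
  · have hk : ∀ k, s.natArray 6 0 b ≠ k + 1 := fun k => by omega
    refine ⟨funext fun k => ?_, funext fun k => ?_, fun k => ?_⟩ <;>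
      simp [takeSlot, hj, hb, h, Function.update_apply, hk]

/-- One bid. -/
def auctionStep : Code :=
  findFree ;;
  .ite (.and (.natLe (.add (.var 11) (.const 1)) (.var 1)) (.natEq (.var 10) (.const 0)))
    (findSlot ;;
      .ite (.and (.natLe (.add (.var 12) (.const 1)) (.var 1))
          (.natLe (.get 5 (.const 0) (.var 12)) (.var 1)))
        takeSlot (.setVar 10 (.const 1)))
    .skip

/-- The state of the auction after `k` steps. -/
def AuctionState (C : Fin n → Finset (Fin (r * n))) (k : ℕ) (s : Memory) : Prop :=
  (s.var 10 = 1 ∧ ¬ ∃ A, IsPerfectMatching r C A) ∨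
  (s.var 10 = 0 ∧ AuctionInvariant (r * n) (SlotAdj C) (s.natArray 5 0) (s.natArray 6 0)
    (s.natArray 7 0) ∧ ((∀ j < r * n, s.natArray 7 0 j ≠ 0) ∨
      k ≤ ∑ t ∈ Finset.range (r * n), s.natArray 5 0 t))

/-- Each successful bid raises the sum of the prices by 1, so this sum counts the steps as long as
items are free. A bid fails only if no adjacent slot has price at most m; then Hall's condition is
violated, and variable 10 records this for good. -/
theorem AuctionState.step {s : Memory} (hs : HasSlots C s) {k : ℕ} (h : AuctionState C k s) :
    AuctionState C (k + 1) (auctionStep.run s) := by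
  rw [auctionStep, run_seq]
  have hf := run_findFree hs.items
  have hsame₁ := sameOff_run findFree s
  set s₁ := findFree.run s with hs₁
  have hs₁' : HasSlots C s₁ := hs.of_sameOff hsame₁ (by decide)
  have h10 : s₁.var 10 = s.var 10 := hsame₁.var 10 (by decide)
  have h5 : s₁.natArray 5 = s.natArray 5 := hsame₁.nat 5 (by decide)
  have h6 : s₁.natArray 6 = s.natArray 6 := hsame₁.nat 6 (by decide)
  have h7 : s₁.natArray 7 = s.natArray 7 := hsame₁.nat 7 (by decide)
  simp only [run_ite, holds_and, holds_natLe, holds_natEq, eval_add, eval_var, eval_const,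
    hs₁'.items, run_skip, h10, run_seq]
  rcases h with ⟨h1, h2⟩ | ⟨h1, h2, h3⟩
  · rw [if_neg (by omega)]
    exact Or.inl ⟨h10.trans h1, h2⟩
  rcases hf with ⟨hf1, hf2⟩ | ⟨hf1, hf2⟩
  · rw [if_neg (by omega)]
    refine Or.inr ⟨h10.trans h1, ?_⟩
    rw [h5, h6, h7]
    exact ⟨h2, Or.inl hf2⟩
  rw [if_pos ⟨hf1, h1⟩]
  have hslot := run_findSlot hs₁' hf1 rfl
  have hsame₂ := sameOff_run findSlot s₁
  set s₂ := findSlot.run s₁ with hs₂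
  have hs₂' : HasSlots C s₂ := hs₁'.of_sameOff hsame₂ (by decide)
  have h11 : s₂.var 11 = s₁.var 11 := hsame₂.var 11 (by decide)
  have g10 : s₂.var 10 = 0 := (hsame₂.var 10 (by decide)).trans (h10.trans h1)
  have g5 : s₂.natArray 5 = s.natArray 5 := (hsame₂.nat 5 (by decide)).trans h5
  have g6 : s₂.natArray 6 = s.natArray 6 := (hsame₂.nat 6 (by decide)).trans h6
  have g7 : s₂.natArray 7 = s.natArray 7 := (hsame₂.nat 7 (by decide)).trans h7
  set j := s₁.var 11 with hj
  set b := s₂.var 12 with hb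
  have hfail : (∀ t < r * n, SlotAdj C t j → r * n < s.natArray 5 0 t) →
      AuctionState C (k + 1) (s₂.setVar 10 1) := fun hlt =>
    Or.inl ⟨by simp, not_exists_isPerfectMatching_of_obstruction C
      (h2.exists_obstruction hf1 hf2 hlt)⟩
  simp only [hs₂'.items, eval_get, eval_const, eval_var, run_setVar, ← hb, g5]
  rw [h5] at hslot
  rcases hslot with ⟨e1, e2⟩ | ⟨e1, e2, e3⟩
  · rw [if_neg (by omega)]
    exact hfail fun t ht hadj => absurd hadj (e2 t ht)
  split_ifs with hc
  · have ht := run_takeSlot h11 hb.symm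
    rw [g5, g6, g7] at ht
    refine Or.inr ⟨((sameOff_run takeSlot s₂).var 10 (by decide)).trans g10, ?_, Or.inr ?_⟩
    · rw [ht.1, ht.2.1]
      exact h2.bid hf1 hf2 e1 e2 e3 hc.2 ht.2.2
    · rw [ht.1, Finset.sum_update_of_mem (Finset.mem_range.2 e1), add_right_comm,
        Finset.sdiff_singleton_eq_erase, Finset.add_sum_erase _ _ (Finset.mem_range.2 e1)]
      rcases h3 with h3 | h3
      · exact absurd hf2 (h3 j hf1)
      · omega
  · have hlt : r * n < s.natArray 5 0 b := by omega
    exact hfail fun t ht hadj => hlt.trans_le (e3 t ht hadj)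

/-- Reset the auction. -/
def auctionInit : Code :=
  .loop 4 1 (.setNat 5 (.const 0) (.var 4) (.const 0) ;;
    .setNat 6 (.const 0) (.var 4) (.const 0) ;; .setNat 7 (.const 0) (.var 4) (.const 0)) ;;
  .setVar 10 (.const 0)

theorem run_auctionInit {s : Memory} (hs : HasSlots C s) :
    AuctionState C 0 (auctionInit.run s) := by
  rw [auctionInit, run_seq]
  have h := run_loop (x := 4) (y := 1) (c := .setNat 5 (.const 0) (.var 4) (.const 0) ;;
    .setNat 6 (.const 0) (.var 4) (.const 0) ;; .setNat 7 (.const 0) (.var 4) (.const 0))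
    s (fun k s' => ∀ t < k, s'.natArray 5 0 t = 0 ∧ s'.natArray 6 0 t = 0 ∧
      s'.natArray 7 0 t = 0) (fun _ _ _ h => h) (by simp) ?_
  · rw [hs.items] at h
    refine Or.inr ⟨by simp, AuctionInvariant.init (fun t ht => (h t ht).1)
      (fun t ht => (h t ht).2.1) (fun t ht => (h t ht).2.2), Or.inr (Nat.zero_le _)⟩
  · rintro k - s' - hk hI t ht
    by_cases htk : t = k
    · simp [htk, hk]
    · simpa [htk, hk] using hI t (by omega)

/-- Find a perfect matching. -/
def auction : Code := auctionInit ;; .loop 14 1 (.loop 15 1 auctionStep)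

/-- Two nested loops make m² steps. If an item were still free, the prices would sum to at least m²,
against `AuctionInvariant.sum_price_lt`. -/
theorem run_auction {s : Memory} (hs : HasSlots C s) :
    ((auction.run s).var 10 = 1 ∧ ¬ ∃ A, IsPerfectMatching r C A) ∨
    ((auction.run s).var 10 = 0 ∧ AuctionInvariant (r * n) (SlotAdj C)
      ((auction.run s).natArray 5 0) ((auction.run s).natArray 6 0) ((auction.run s).natArray 7 0) ∧
      ∀ j < r * n, (auction.run s).natArray 7 0 j ≠ 0) := by
  rw [auction, run_seq]
  have hinit := run_auctionInit hs
  have hsame₁ := sameOff_run auctionInit s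
  set s₁ := auctionInit.run s with hs₁
  have hs₁' : HasSlots C s₁ := hs.of_sameOff hsame₁ (by decide)
  have h := run_loop (x := 14) (y := 1) (c := .loop 15 1 auctionStep) s₁
    (fun k s' => AuctionState C (k * (r * n)) s') (fun _ _ _ h => h) (by simpa using hinit) ?_
  · rw [hs₁'.items] at h
    rcases h with h | ⟨h1, h2, h3⟩
    · exact Or.inl h
    · refine Or.inr ⟨h1, h2, fun j hj hQ => ?_⟩
      rcases h3 with h3 | h3
      · exact h3 j hj hQ
      · exact absurd h3 (not_le.2 (h2.sum_price_lt hj hQ))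
  · rintro k - s' hsame - hI
    have hs' : HasSlots C s' := hs₁'.of_sameOff hsame (by decide)
    have h2 := run_loop (x := 15) (y := 1) (c := auctionStep) s'
      (fun l s' => AuctionState C (k * (r * n) + l) s') (fun _ _ _ h => h) hI
      fun l _ s'' hsame' _ hI' => hI'.step (hs'.of_sameOff hsame' (by decide))
    rwa [hs'.items, ← Nat.succ_mul] at h2

/-- Store the owners of the items in row 0 of array 0, and whether the auction was successful in
variable 16. -/
def readOff : Code :=
  .ite (.natEq (.var 10) (.const 0))
    (.loop 4 1 (.ite (.natLe (.const 1) (.get 6 (.const 0) (.var 4)))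
      (.setNat 0 (.const 0) (.sub (.get 6 (.const 0) (.var 4)) (.const 1))
        (.get 1 (.const 0) (.var 4))) .skip) ;;
      .setVar 16 (.const 1))
    (.setVar 16 (.const 0))

/-- Find a perfect matching, and store it. -/
def matching : Code := auction ;; readOff

theorem run_matching {s : Memory} (hs : HasSlots C s) :
    ((matching.run s).var 16 = 0 ∧ ¬ ∃ A, IsPerfectMatching r C A) ∨
      ((matching.run s).var 16 = 1 ∧ ∃ A, IsPerfectMatching r C A ∧
        ∀ j : Fin (r * n), (matching.run s).natArray 0 0 j = A j) := by
  rw [matching, run_seq]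
  have hauction := run_auction hs
  have hsame₁ := sameOff_run auction s
  set s₁ := auction.run s with hs₁
  have hs₁' : HasSlots C s₁ := hs.of_sameOff hsame₁ (by decide)
  rw [readOff]
  simp only [run_ite, holds_natEq, eval_var, eval_const, run_setVar, run_seq]
  rcases hauction with ⟨h1, h2⟩ | ⟨h1, h2, h3⟩
  · rw [if_neg (by omega)]
    exact Or.inl ⟨by simp, h2⟩
  rw [if_pos h1]
  refine Or.inr ⟨by simp, ?_⟩
  have h := run_loop (x := 4) (y := 1)
    (c := .ite (.natLe (.const 1) (.get 6 (.const 0) (.var 4)))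
      (.setNat 0 (.const 0) (.sub (.get 6 (.const 0) (.var 4)) (.const 1))
        (.get 1 (.const 0) (.var 4))) .skip) s₁
    (fun k s' => ∀ t < r * n, t < k → ∀ j, s₁.natArray 6 0 t = j + 1 →
      s'.natArray 0 0 j = t % n) (fun _ _ _ h => h) (by simp) ?_
  · rw [hs₁'.items] at h
    have hslot : ∀ j : Fin (r * n), ∃ t < r * n, s₁.natArray 6 0 t = j + 1 :=
      fun j => (h2.assigned_iff j j.2).1 (h3 j j.2)
    choose slot hslot1 hslot2 using hslot
    refine ⟨fun j => ⟨slot j % n, Nat.mod_lt _ hs.agents_pos⟩, ?_, fun j => ?_⟩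
    · refine isPerfectMatching_of_slots C hslot1 (fun j j' hjj => ?_) (fun _ => rfl) fun j => ?_
      · have h4 := hslot2 j
        rw [hjj, hslot2 j'] at h4
        exact Fin.ext (by omega)
      · obtain ⟨i, k, h4, h5, h6⟩ := h2.adj_holder _ (hslot1 j) j (hslot2 j)
        have hi : (⟨slot j % n, Nat.mod_lt _ hs.agents_pos⟩ : Fin n) = i := Fin.ext h4
        have hk : j = k := Fin.ext h5
        rw [hi, hk]
        exact h6
    · simpa using h (slot j) (hslot1 j) (hslot1 j) j (hslot2 j)
  · rintro k hk s' hsame hk' hI t ht htk j hj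
    rw [hs₁'.items] at hk
    have hs' : HasSlots C s' := hs₁'.of_sameOff hsame (by decide)
    have h6 : s'.natArray 6 = s₁.natArray 6 := hsame.nat 6 (by decide)
    simp only [run_ite, holds_natLe, eval_const, eval_get, eval_var, hk', h6, run_setNat, eval_sub,
      run_skip, hs'.owner k hk]
    have hlt : t ≠ k → s'.natArray 0 0 j = t % n := fun hne => hI t ht (by omega) j hj
    by_cases htk' : t = k
    · subst htk'
      rw [if_pos (by omega)]
      simp [hj]
    -- Distinct held slots have distinct holders, so this write does not touch the entry of j.
    · split_ifs with hc
      · have hne : j ≠ s₁.natArray 6 0 k - 1 := fun h =>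
          htk' (h2.holder_injective t ht k hk (by omega) (by omega))
        simpa [hne] using hlt htk'
      · exact hlt htk'

end AuctionProgram

/-! ### The programs -/

section Division

variable {n r m : ℕ}

/-- Divide the number of items by the number of agents: variable 2 is the quotient and variable 3 the
remainder. Also store all `t % n` and `t / n` in the arrays 1 and 2. -/
def divMod : Code :=
  .setVar 2 (.const 0) ;; .setVar 3 (.const 0) ;;
  .loop 4 1 (.setNat 1 (.const 0) (.var 4) (.var 3) ;; .setNat 2 (.const 0) (.var 4) (.var 2) ;;
    .setVar 3 (.add (.var 3) (.const 1)) ;;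
    .ite (.natEq (.var 3) (.var 0))
      (.setVar 3 (.const 0) ;; .setVar 2 (.add (.var 2) (.const 1))) .skip)

/-- The machine has no division, so quotient and remainder are obtained by counting modulo n. Their
intermediate values give the tables of slot owners and trading pairs. -/
theorem run_divMod {s : Memory} (hn : 0 < n) (h0 : s.var 0 = n) (h1 : s.var 1 = m) :
    (divMod.run s).var 2 = m / n ∧ (divMod.run s).var 3 = m % n ∧
      ∀ t < m, (divMod.run s).natArray 1 0 t = t % n ∧ (divMod.run s).natArray 2 0 t = t / n := by
  rw [divMod, run_seq, run_seq]
  have h := run_loop (x := 4) (y := 1) (c := .setNat 1 (.const 0) (.var 4) (.var 3) ;;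
    .setNat 2 (.const 0) (.var 4) (.var 2) ;; .setVar 3 (.add (.var 3) (.const 1)) ;;
    .ite (.natEq (.var 3) (.var 0))
      (.setVar 3 (.const 0) ;; .setVar 2 (.add (.var 2) (.const 1))) .skip)
    ((Code.setVar 3 (.const 0)).run ((Code.setVar 2 (.const 0)).run s))
    (fun k s' => s'.var 2 = k / n ∧ s'.var 3 = k % n ∧
      ∀ t < k, s'.natArray 1 0 t = t % n ∧ s'.natArray 2 0 t = t / n)
    (fun _ _ _ h => h) (by simp) ?_
  · have h1' : ((Code.setVar 3 (.const 0)).run ((Code.setVar 2 (.const 0)).run s)).var 1 = m := h1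
    rwa [h1'] at h
  · rintro k - s' hsame hk ⟨g2, g3, g⟩
    have g0 : s'.var 0 = n := (hsame.var 0 (by decide)).trans h0
    have key : ∀ t < k + 1,
        (if t = k then k % n else s'.natArray 1 0 t) = t % n ∧
        (if t = k then k / n else s'.natArray 2 0 t) = t / n := by
      intro t ht
      split_ifs with htk
      · rw [htk]
        exact ⟨rfl, rfl⟩
      · exact g t (by omega)
    by_cases hc : k % n + 1 = n
    · have hdvd : n ∣ k + 1 := by
        rw [Nat.dvd_iff_mod_eq_zero, Nat.add_mod]
        by_cases hn1 : n = 1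
        · simp [hn1, Nat.mod_one]
        · rw [Nat.mod_eq_of_lt (by omega : 1 < n), hc, Nat.mod_self]
      have hdiv : (k + 1) / n = k / n + 1 := Nat.succ_div_of_dvd hdvd
      have hmod : (k + 1) % n = 0 := Nat.mod_eq_zero_of_dvd hdvd
      simpa [hk, g0, g2, g3, hc, hdiv, hmod] using key
    · have hlt := Nat.mod_lt k hn
      have hdvd : ¬ n ∣ k + 1 := by
        intro h
        have h3 := Nat.div_add_mod k n
        rw [Nat.dvd_iff_mod_eq_zero, ← h3, add_assoc, Nat.mul_add_mod,
          Nat.mod_eq_of_lt (by omega)] at h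
        omega
      have hdiv : (k + 1) / n = k / n := Nat.succ_div_of_not_dvd hdvd
      have hmod : (k + 1) % n = k % n + 1 := by
        have h3 := Nat.div_add_mod k n
        have h4 := Nat.div_add_mod (k + 1) n
        rw [hdiv] at h4
        omega
      simpa [hk, g0, g2, g3, hc, hdiv, hmod] using key

/-- The memory contains the results of `divMod`, where the remainder was 0. -/
structure HasBundleSize (n r : ℕ) (s : Memory) : Prop where
  agents_pos : 0 < n
  bundleSize : s.var 2 = r
  mod : ∀ t < r * n, s.natArray 1 0 t = t % n
  div : ∀ t < r * n, s.natArray 2 0 t = t / n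

theorem HasBundleSize.of_sameOff {c : Code} {s s' : Memory} (hs : HasBundleSize n r s)
    (h : SameOff c s s') (hc : 2 ∉ c.modVars ∧ 1 ∉ c.modNats ∧ 2 ∉ c.modNats) :
    HasBundleSize n r s' where
  agents_pos := hs.agents_pos
  bundleSize := (h.var 2 hc.1).trans hs.bundleSize
  mod t ht := by rw [h.nat 1 hc.2.1, hs.mod t ht]
  div t ht := by rw [h.nat 2 hc.2.2, hs.div t ht]

theorem hasBundleSize_run_divMod {s : Memory} (hn : 0 < n) (h0 : s.var 0 = n)
    (h1 : s.var 1 = r * n) : HasBundleSize n r (divMod.run s) := by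
  obtain ⟨h2, -, h3⟩ := run_divMod hn h0 h1
  exact ⟨hn, h2.trans (Nat.mul_div_cancel r hn), fun t ht => (h3 t ht).1, fun t ht => (h3 t ht).2⟩

end Division

/-! ### The complete threshold matching program -/

section ThresholdMatching

variable {n r : ℕ} {u : Fin n → Fin (r * n) → ℝ} {τ : ℝ}

/-- Compute `r * τ`. -/
def bundleThreshold : Code :=
  .setReal 2 (.const 0) (.const 0) (.const 0) ;;
  .loop 4 1 (.ite (.natLe (.add (.var 4) (.const 1)) (.var 2))
    (.setReal 2 (.const 0) (.const 0)
      (.add (.get 2 (.const 0) (.const 0)) (.get 1 (.const 0) (.const 0)))) .skip)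

/-- Multiplication is not available, so τ is added up; the sum after k passes is min(k, r) times τ,
and the loop has m ≥ r passes. -/
theorem run_bundleThreshold {s : Memory} {m : ℕ} (h1 : s.var 1 = m) (h2 : s.var 2 = r)
    (hr : r ≤ m) (hτ : s.realArray 1 0 0 = τ) :
    (bundleThreshold.run s).realArray 2 0 0 = r * τ := by
  rw [bundleThreshold, run_seq]
  have h := run_loop (x := 4) (y := 1) (c := .ite (.natLe (.add (.var 4) (.const 1)) (.var 2))
    (.setReal 2 (.const 0) (.const 0)
      (.add (.get 2 (.const 0) (.const 0)) (.get 1 (.const 0) (.const 0)))) .skip)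
    ((Code.setReal 2 (.const 0) (.const 0) (.const 0)).run s)
    (fun k s' => s'.realArray 2 0 0 = (min k r : ℕ) * τ) (fun _ _ _ h => h) (by simp) ?_
  · have h1' : ((Code.setReal 2 (.const 0) (.const 0) (.const 0)).run s).var 1 = m := h1
    rwa [h1', min_eq_right hr] at h
  · rintro k - s' hsame hk hI
    have g2 : s'.var 2 = r := (hsame.var 2 (by decide)).trans h2
    have gτ : s'.realArray 1 0 0 = τ := by
      rw [hsame.real 1 (by decide)]
      simpa using hτ
    by_cases hc : k + 1 ≤ r
    · simp only [run_ite, holds_natLe, eval_add, eval_var, eval_const, hk, g2, hc, if_true,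
        run_setReal, eval_add_real, eval_get_real, Memory.setReal_realArray, and_self, hI, gτ]
      rw [min_eq_left hc, min_eq_left (by omega : k ≤ r)]
      push_cast
      ring
    · simp only [run_ite, holds_natLe, eval_add, eval_var, eval_const, hk, g2, hc, if_false,
        run_skip, hI]
      rw [min_eq_right (by omega), min_eq_right (by omega)]

/-- Threshold matching with removal. -/
def thresholdMatching : Code := bundleThreshold ;; candidateSets ;; matching

theorem run_thresholdMatching {s : Memory} (hs : HasInstance u s) (hs' : HasBundleSize n r s)
    (h0 : 0 ≤ τ) (hτ : s.realArray 1 0 0 = τ) :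
    ∃ C, IsCandidateFamily r τ u C ∧
      (((thresholdMatching.run s).var 16 = 0 ∧ ¬ ∃ A, IsPerfectMatching r C A) ∨
      ((thresholdMatching.run s).var 16 = 1 ∧ ∃ A, IsPerfectMatching r C A ∧
        ∀ j : Fin (r * n), (thresholdMatching.run s).natArray 0 0 j = A j)) := by
  rw [thresholdMatching, run_seq, run_seq]
  have hr : r ≤ r * n := Nat.le_mul_of_pos_right r hs'.agents_pos
  have hb := run_bundleThreshold hs.items hs'.bundleSize hr hτ
  have hsame₁ := sameOff_run bundleThreshold s
  set s₁ := bundleThreshold.run s with hs₁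
  have ht : HasThreshold u r τ s₁ :=
    ⟨hs.of_sameOff hsame₁ (by decide), (hsame₁.var 2 (by decide)).trans hs'.bundleSize, hr, h0,
      by rw [hsame₁.real 1 (by decide), hτ], hb⟩
  have hs₁' := hs'.of_sameOff hsame₁ (by decide)
  have hsame₂ := sameOff_run candidateSets s₁
  have ht₂ := ht.of_sameOff hsame₂ (by decide)
  have hs₂' := hs₁'.of_sameOff hsame₂ (by decide)
  exact ⟨_, run_candidateSets ht, run_matching ⟨hs'.agents_pos, ht₂.items, hs₂'.mod, fun _ => rfl⟩⟩

end ThresholdMatching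

/-! ### The block allocation as a program -/

section BlockTrades

variable {n r : ℕ} {u : Fin n → Fin (r * n) → ℝ}

/-- Compute the allocation from the trades in blocks. -/
def blockTrades : Code :=
  .loop 4 1 (.setNat 0 (.const 0) (.var 4) (.get 1 (.const 0) (.var 4))) ;;
  .setVar 24 (.const 0) ;;
  .loop 23 1 (.ite (.natLe (.add (.var 23) (.const 1)) (.var 2))
    (.setVar 25 (.get 1 (.const 0) (.get 2 (.const 0) (.var 23))) ;;
      .setVar 26 (.get 1 (.const 0) (.var 23)) ;;
      .ite (.realLe (.get 0 (.var 25) (.add (.var 26) (.var 24)))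
          (.get 0 (.var 25) (.add (.var 25) (.var 24)))) .skip
        (.setNat 0 (.const 0) (.add (.var 25) (.var 24)) (.var 26) ;;
          .setNat 0 (.const 0) (.add (.var 26) (.var 24)) (.var 25)) ;;
      .setVar 24 (.add (.var 24) (.var 0)))
    .skip)

theorem blockItem_eq_iff {b b' : Fin r} {k k' : Fin n} :
    (blockItem b k : ℕ) = blockItem b' k' ↔ b = b' ∧ k = k' := by
  rw [Fin.val_inj]
  exact ⟨blockItem_injective, by rintro ⟨rfl, rfl⟩; rfl⟩

/-- Invariant: the trades of the blocks before k have been made, and variable 24 holds the offset nk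
of block k, maintained by addition. Passes beyond r do nothing. -/
theorem run_blockTrades {s : Memory} (hs : HasInstance u s) (hs' : HasBundleSize n r s) :
    ∀ j : Fin (r * n), (blockTrades.run s).natArray 0 0 j =
      blockAllocation hs'.agents_pos u j := by
  have hn := hs'.agents_pos
  rw [blockTrades, run_seq, run_seq]
  have hinit := run_loop (x := 4) (y := 1)
    (c := .setNat 0 (.const 0) (.var 4) (.get 1 (.const 0) (.var 4))) s
    (fun k s' => ∀ t < r * n, t < k → s'.natArray 0 0 t = t % n) (fun _ _ _ h => h) (by simp) ?_
  swap
  · rintro k - s' hsame hk hI t ht htk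
    have h1 : s'.natArray 1 = s.natArray 1 := hsame.nat 1 (by decide)
    by_cases h : t = k
    · subst h
      simp [hk, h1, hs'.mod t ht]
    · simpa [hk, h] using hI t ht (by omega)
  rw [hs.items] at hinit
  have hsame₁ := sameOff_run
    (.loop 4 1 (.setNat 0 (.const 0) (.var 4) (.get 1 (.const 0) (.var 4)))) s
  set s₁ := (Code.loop 4 1 (.setNat 0 (.const 0) (.var 4) (.get 1 (.const 0) (.var 4)))).run s
    with hs₁
  have hi₁ : HasInstance u s₁ := hs.of_sameOff hsame₁ (by decide)
  have hb₁ : HasBundleSize n r s₁ := hs'.of_sameOff hsame₁ (by decide)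
  have hsame₂ := sameOff_run (.setVar 24 (.const 0)) s₁
  set s₂ := (Code.setVar 24 (.const 0)).run s₁ with hs₂
  have hi₂ : HasInstance u s₂ := hi₁.of_sameOff hsame₂ (by decide)
  have hb₂ : HasBundleSize n r s₂ := hb₁.of_sameOff hsame₂ (by decide)
  have h := run_loop (x := 23) (y := 1) (c := .ite (.natLe (.add (.var 23) (.const 1)) (.var 2))
    (.setVar 25 (.get 1 (.const 0) (.get 2 (.const 0) (.var 23))) ;;
      .setVar 26 (.get 1 (.const 0) (.var 23)) ;;
      .ite (.realLe (.get 0 (.var 25) (.add (.var 26) (.var 24)))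
          (.get 0 (.var 25) (.add (.var 25) (.var 24)))) .skip
        (.setNat 0 (.const 0) (.add (.var 25) (.var 24)) (.var 26) ;;
          .setNat 0 (.const 0) (.add (.var 26) (.var 24)) (.var 25)) ;;
      .setVar 24 (.add (.var 24) (.var 0)))
    .skip) s₂ (fun k s' => (k ≤ r → s'.var 24 = n * k) ∧ ∀ (b : Fin r) (a : Fin n),
      s'.natArray 0 0 (blockItem b a) =
        if (b : ℕ) < k then (blockPerm hn u b a : ℕ) else a) (fun _ _ _ h => h) ?_ ?_
  · rw [hi₂.items] at h
    intro j
    obtain ⟨⟨b, a⟩, rfl⟩ := finProdFinEquiv.surjective j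
    have h1 := h.2 b a
    rw [if_pos (b.2.trans_le (Nat.le_mul_of_pos_right r hn))] at h1
    rw [blockAllocation, Equiv.symm_apply_apply]
    exact h1
  · refine ⟨fun _ => by simp [hs₂], fun b a => ?_⟩
    rw [if_neg (Nat.not_lt_zero _)]
    have h1 := hinit (blockItem b a) (blockItem b a).2 (blockItem b a).2
    rw [blockItem_val, Nat.add_mul_mod_self_left, Nat.mod_eq_of_lt a.2] at h1
    exact h1
  · rintro k - s' hsame hk ⟨h1, h2⟩
    have hi' : HasInstance u s' := hi₂.of_sameOff hsame (by decide)
    have hb' : HasBundleSize n r s' := hb₂.of_sameOff hsame (by decide)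
    by_cases hkr : k + 1 ≤ r
    · have hkm : k < r * n := lt_of_lt_of_le hkr (Nat.le_mul_of_pos_right r hn)
      have h24 := h1 (by omega)
      obtain ⟨b₀, rfl⟩ : ∃ b₀ : Fin r, (b₀ : ℕ) = k := ⟨⟨k, hkr⟩, rfl⟩
      set p := tradingPair hn b₀ with hp
      have hp1 : b₀ / n % n = p.1 := rfl
      have hp2 : b₀ % n = p.2 := rfl
      have hitem : ∀ a : Fin n, (a : ℕ) + n * b₀ = blockItem b₀ a := fun a => rfl
      have hperm : blockPerm hn u b₀ = if u p.1 (blockItem b₀ p.2) ≤ u p.1 (blockItem b₀ p.1) then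
          1 else Equiv.swap p.1 p.2 := by
        unfold blockPerm
        change (if u p.1 (blockItem b₀ p.1) < u p.1 (blockItem b₀ p.2) then _ else _) = _
        by_cases hle : u p.1 (blockItem b₀ p.2) ≤ u p.1 (blockItem b₀ p.1)
        · rw [if_neg (not_lt.2 hle), if_pos hle]
        · rw [if_pos (not_le.1 hle), if_neg hle]
      have hlt : ∀ b : Fin r, b ≠ b₀ → ((b : ℕ) < b₀ + 1 ↔ (b : ℕ) < b₀) := by
        intro b hb
        have : (b : ℕ) ≠ b₀ := fun h => hb (Fin.ext h)
        omega
      have hdiv : b₀ / n < r * n := (Nat.div_le_self b₀ n).trans_lt hkm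
      by_cases hle : u p.1 (blockItem b₀ p.2) ≤ u p.1 (blockItem b₀ p.1)
      · rw [if_pos hle] at hperm
        simp only [run_ite, holds_natLe, eval_add, eval_var, eval_const, hk, hb'.bundleSize, hkr,
          if_true, run_seq, run_setVar, eval_get, Memory.setVar_natArray, hb'.mod _ hkm,
          hb'.div _ hkm, hb'.mod _ hdiv, holds_realLe, eval_get_real, Memory.setVar_var, h24, hp1,
          hp2, Memory.setVar_realArray, hitem, hi'.utility, hle, run_skip, Nat.reduceEqDiff,
          if_false, hi'.agents, OfNat.zero_ne_ofNat]
        refine ⟨fun _ => by ring, fun b a => ?_⟩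
        rw [h2 b a]
        by_cases hb : b = b₀
        · simp [hb, hperm]
        · simp only [hlt b hb]
      · rw [if_neg hle] at hperm
        simp only [run_ite, holds_natLe, eval_add, eval_var, eval_const, hk, hb'.bundleSize, hkr,
          if_true, run_seq, run_setVar, eval_get, Memory.setVar_natArray, hb'.mod _ hkm,
          hb'.div _ hkm, hb'.mod _ hdiv, holds_realLe, eval_get_real, Memory.setVar_var, h24, hp1,
          hp2, Memory.setVar_realArray, hitem, hi'.utility, hle, Nat.reduceEqDiff, if_false,
          hi'.agents, OfNat.zero_ne_ofNat, run_setNat, Memory.setNat_var,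
          Memory.setNat_natArray, blockItem_eq_iff, true_and]
        refine ⟨fun _ => by ring, fun b a => ?_⟩
        rw [h2 b a]
        by_cases hb : b = b₀
        · subst hb
          simp only [true_and, hperm, Nat.lt_succ_self, if_true, lt_self_iff_false, if_false]
          rw [Equiv.swap_apply_def]
          by_cases ha1 : a = p.1
          · by_cases ha2 : a = p.2
            · rw [if_pos ha2, if_pos ha1, ← ha1, ← ha2]
            · rw [if_neg ha2, if_pos ha1, if_pos ha1]
          · by_cases ha2 : a = p.2
            · rw [if_pos ha2, if_neg ha1, if_pos ha2]
            · rw [if_neg ha2, if_neg ha1, if_neg ha1, if_neg ha2]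
        · simp only [hb, false_and, if_false, hlt b hb]
    · simp only [run_ite, holds_natLe, eval_add, eval_var, eval_const, hk, hb'.bundleSize, hkr,
        if_false, run_skip]
      refine ⟨fun h => h.elim, fun b a => ?_⟩
      have hbr := b.2
      rw [h2 b a, if_pos (by omega), if_pos (by omega)]

end BlockTrades

/-! ### Checking an allocation for envy -/

section EnvyCheck

variable {n m : ℕ} {u : Fin n → Fin m → ℝ} {A : Allocation n m}

/-- Store in entry `(0, 0)` of real array `a` the utility of the agent in variable 25 for the bundle
of the agent in variable `x`. -/
def sumBundle (a x : ℕ) : Code :=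
  .setReal a (.const 0) (.const 0) (.const 0) ;;
  .loop 4 1 (.ite (.natEq (.get 0 (.const 0) (.var 4)) (.var x))
    (.setReal a (.const 0) (.const 0)
      (.add (.get a (.const 0) (.const 0)) (.get 0 (.var 25) (.var 4)))) .skip)

/-- The conditions on a and x keep the accumulator away from the utilities and the agent away from
the loop counter. -/
theorem run_sumBundle {a x : ℕ} (ha : a ≠ 0) (hx : x ≠ 4) {s : Memory} (hs : HasInstance u s)
    (hA : ∀ j : Fin m, s.natArray 0 0 j = A j) {i i' : Fin n} (hi : s.var 25 = i) (hi' : s.var x = i') :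
    ((sumBundle a x).run s).realArray a 0 0 = ∑ j ∈ bundle A i', u i j := by
  rw [sumBundle, run_seq]
  set g : ℕ → ℝ := fun t => if h : t < m then (if A ⟨t, h⟩ = i' then u i ⟨t, h⟩ else 0) else 0
    with hg
  set s₁ := (Code.setReal a (.const 0) (.const 0) (.const 0)).run s with hs₁
  have h := run_loop (x := 4) (y := 1) (c := .ite (.natEq (.get 0 (.const 0) (.var 4)) (.var x))
    (.setReal a (.const 0) (.const 0)
      (.add (.get a (.const 0) (.const 0)) (.get 0 (.var 25) (.var 4)))) .skip) s₁
    (fun k s' => s'.realArray a 0 0 = ∑ t ∈ Finset.range k, g t) (fun _ _ _ h => h)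
    (by simp [hs₁]) ?_
  · have h1 : s₁.var 1 = m := hs.items
    rw [h1, Finset.sum_range] at h
    rw [h, bundle, Finset.sum_filter]
    simp [hg]
  · intro k hk s' hsame hk' hI
    have hkm : k < m := hk.trans_eq hs.items
    have g25 : s'.var 25 = i := (hsame.var 25 (by simp [modVars])).trans hi
    have gx : s'.var x = i' := (hsame.var x (by simp [modVars, hx])).trans hi'
    have gA : s'.natArray 0 0 k = A ⟨k, hkm⟩ := by
      rw [hsame.nat 0 (by simp [modNats])]
      exact hA ⟨k, hkm⟩
    have gu : s'.realArray 0 i k = u i ⟨k, hkm⟩ := by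
      rw [hsame.real 0 (by simp [modReals, ha.symm])]
      have := hs.utility i ⟨k, hkm⟩
      simpa [hs₁, ha.symm] using this
    have gk : g k = if A ⟨k, hkm⟩ = i' then u i ⟨k, hkm⟩ else 0 := by
      simp only [hg, hkm, dif_pos]
    rw [Finset.sum_range_succ, ← hI, gk]
    by_cases hc : A ⟨k, hkm⟩ = i'
    · simp [hk', gA, gx, g25, gu, hc]
    · have hc' : (A ⟨k, hkm⟩ : ℕ) ≠ i' := fun h => hc (Fin.ext h)
      simp [hk', gA, gx, hc, hc']

/-- Set variable 20 to 0 if the agent in variable 25 envies another one. -/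
def envyCheckRow : Code :=
  .loop 26 0 (sumBundle 3 25 ;; sumBundle 4 26 ;;
    .ite (.realLe (.get 4 (.const 0) (.const 0)) (.get 3 (.const 0) (.const 0))) .skip
      (.setVar 20 (.const 0)))

open Classical in
theorem run_envyCheckRow {s : Memory} (hs : HasInstance u s)
    (hA : ∀ j : Fin m, s.natArray 0 0 j = A j) {i : Fin n} (hi : s.var 25 = i) {Q : Prop} [Decidable Q]
    (hQ : s.var 20 = if Q then 1 else 0) :
    (envyCheckRow.run s).var 20 =
      if Q ∧ ∀ i', ∑ j ∈ bundle A i', u i j ≤ ∑ j ∈ bundle A i, u i j then 1 else 0 := by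
  have h := run_loop (x := 26) (y := 0) (c := sumBundle 3 25 ;; sumBundle 4 26 ;;
    .ite (.realLe (.get 4 (.const 0) (.const 0)) (.get 3 (.const 0) (.const 0))) .skip
      (.setVar 20 (.const 0))) s
    (fun k s' => s'.var 20 = if Q ∧ ∀ i' : Fin n, (i' : ℕ) < k →
      ∑ j ∈ bundle A i', u i j ≤ ∑ j ∈ bundle A i, u i j then 1 else 0)
    (fun _ _ _ h => h) (by simpa using hQ) ?_
  · rw [hs.agents] at h
    rw [envyCheckRow, h]
    simp
  · intro k hk s' hsame hk' hI
    have hkn : k < n := hk.trans_eq hs.agents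
    have hs' : HasInstance u s' := hs.of_sameOff hsame (by decide)
    have hi₁ : s'.var 25 = i := (hsame.var 25 (by decide)).trans hi
    have hA₁ : ∀ j : Fin m, s'.natArray 0 0 j = A j := fun j => by
      rw [hsame.nat 0 (by decide), hA]
    obtain ⟨i', rfl⟩ : ∃ i' : Fin n, (i' : ℕ) = k := ⟨⟨k, hkn⟩, rfl⟩
    have hsum₁ := run_sumBundle (a := 3) (by decide) (by decide) hs' hA₁ hi₁ hi₁
    rw [run_seq, run_seq]
    have hsame₁ := sameOff_run (sumBundle 3 25) s'
    set s₁ := (sumBundle 3 25).run s' with hs₁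
    have hsum₂ := run_sumBundle (a := 4) (x := 26) (by decide) (by decide)
      (hs'.of_sameOff hsame₁ (by decide)) (fun j => by rw [hsame₁.nat 0 (by decide), hA₁])
      ((hsame₁.var 25 (by decide)).trans hi₁) ((hsame₁.var 26 (by decide)).trans hk')
    have hsame₂ := sameOff_run (sumBundle 4 26) s₁
    set s₂ := (sumBundle 4 26).run s₁ with hs₂
    have h20 : s₂.var 20 = s'.var 20 :=
      (hsame₂.var 20 (by decide)).trans (hsame₁.var 20 (by decide))
    have hsum₃ : s₂.realArray 3 0 0 = ∑ j ∈ bundle A i, u i j := by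
      rw [hsame₂.real 3 (by decide), hsum₁]
    have hiff : (∀ a : Fin n, (a : ℕ) < i' + 1 →
        ∑ j ∈ bundle A a, u i j ≤ ∑ j ∈ bundle A i, u i j) ↔
        (∀ a : Fin n, (a : ℕ) < i' → ∑ j ∈ bundle A a, u i j ≤ ∑ j ∈ bundle A i, u i j) ∧
          ∑ j ∈ bundle A i', u i j ≤ ∑ j ∈ bundle A i, u i j := by
      refine ⟨fun h => ⟨fun a ha => h a (by omega), h i' (by omega)⟩, fun h a ha => ?_⟩
      rcases Nat.lt_succ_iff_lt_or_eq.1 ha with ha | ha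
      · exact h.1 a ha
      · rw [Fin.ext ha]
        exact h.2
    simp only [run_ite, holds_realLe, eval_get_real, eval_const, hsum₂, hsum₃, run_skip,
      run_setVar, hiff]
    by_cases hc : ∑ j ∈ bundle A i', u i j ≤ ∑ j ∈ bundle A i, u i j
    · simp only [hc, if_true, h20, hI, and_true]
    · simp only [hc, if_false, Memory.setVar_var, if_true, and_false]

/-- Set variable 20 to 1 if the allocation in array 0 is envy-free, and to 0 otherwise. -/
def envyCheck : Code := .setVar 20 (.const 1) ;; .loop 25 0 envyCheckRow

open Classical in
theorem run_envyCheck {s : Memory} (hs : HasInstance u s) (hA : ∀ j : Fin m, s.natArray 0 0 j = A j) :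
    (envyCheck.run s).var 20 = if EnvyFree u A then 1 else 0 := by
  rw [envyCheck, run_seq]
  have hsame₁ := sameOff_run (.setVar 20 (.const 1)) s
  set s₁ := (Code.setVar 20 (.const 1)).run s with hs₁
  have hs₁' : HasInstance u s₁ := hs.of_sameOff hsame₁ (by decide)
  have h := run_loop (x := 25) (y := 0) (c := envyCheckRow) s₁
    (fun k s' => s'.var 20 = if (∀ i : Fin n, (i : ℕ) < k → ∀ i',
      ∑ j ∈ bundle A i', u i j ≤ ∑ j ∈ bundle A i, u i j) then 1 else 0)
    (fun _ _ _ h => h) (by simp [hs₁]) ?_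
  · rw [hs₁'.agents] at h
    rw [h]
    exact if_congr (by simp [EnvyFree]) rfl rfl
  · intro k hk s' hsame hk' hI
    have hkn : k < n := hk.trans_eq hs₁'.agents
    obtain ⟨i, rfl⟩ : ∃ i : Fin n, (i : ℕ) = k := ⟨⟨k, hkn⟩, rfl⟩
    rw [run_envyCheckRow (hs₁'.of_sameOff hsame (by decide))
      (fun j => by rw [hsame.nat 0 (by decide), hsame₁.nat 0 (by decide), hA]) hk' hI]
    refine if_congr ⟨fun h a ha => ?_, fun h => ⟨fun a ha => h a (by omega), h i (by omega)⟩⟩ rfl rfl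
    rcases Nat.lt_succ_iff_lt_or_eq.1 ha with ha | ha
    · exact h.1 a ha
    · rw [Fin.ext ha]
      exact h.2

end EnvyCheck

/-! ### Trying all utilities as thresholds -/

section Search

variable {n r : ℕ} {u : Fin n → Fin (r * n) → ℝ}

/-- Threshold matching with removal can return NULL. -/
def CanFail (r : ℕ) (τ : ℝ) (u : Fin n → Fin (r * n) → ℝ) : Prop :=
  ∃ C, IsCandidateFamily r τ u C ∧ ¬ ∃ A, IsPerfectMatching r C A

/-- Array 0 contains an envy-free balanced allocation. -/
def HoldsFair (u : Fin n → Fin (r * n) → ℝ) (s : Memory) : Prop :=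
  ∃ A, EnvyFree u A ∧ IsBalanced A ∧ ∀ j : Fin (r * n), s.natArray 0 0 j = A j

/-- If no allocation has been found, try the utility in variables 21 and 22 as a threshold. -/
def tryThreshold : Code :=
  .ite (.and (.natEq (.var 20) (.const 0)) (.realLe (.const 0) (.get 0 (.var 21) (.var 22))))
    (.setReal 1 (.const 0) (.const 0) (.get 0 (.var 21) (.var 22)) ;; thresholdMatching ;;
      .setVar 20 (.var 16)) .skip

/-- Q carries what has been learned from earlier failures. Negative utilities are skipped because
the removal program is only correct for τ ≥ 0. -/
theorem run_tryThreshold {s : Memory} (hs : HasInstance u s) (hs' : HasBundleSize n r s)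
    {i : Fin n} {j : Fin (r * n)} (hi : s.var 21 = i) (hj : s.var 22 = j) {Q : Prop}
    (h : (s.var 20 = 1 ∧ HoldsFair u s) ∨ (s.var 20 = 0 ∧ Q)) :
    ((tryThreshold.run s).var 20 = 1 ∧ HoldsFair u (tryThreshold.run s)) ∨
      ((tryThreshold.run s).var 20 = 0 ∧ Q ∧ (0 ≤ u i j → CanFail r (u i j) u)) := by
  rcases h with ⟨h20, h⟩ | ⟨h20, hQ⟩
  · simp only [tryThreshold, run_ite, holds_and, holds_natEq, eval_var, eval_const, h20,
      one_ne_zero, false_and, if_false, run_skip]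
    exact Or.inl ⟨trivial, h⟩
  · simp only [tryThreshold, run_ite, holds_and, holds_natEq, eval_var, eval_const, h20, true_and,
      holds_realLe, eval_const_real, eval_get_real, hi, hj, hs.utility, Rat.cast_zero, run_skip]
    split_ifs with h0
    · rw [run_seq, run_seq]
      have hsame := sameOff_run (.setReal 1 (.const 0) (.const 0) (.get 0 (.var 21) (.var 22))) s
      have hτ : ((Code.setReal 1 (.const 0) (.const 0) (.get 0 (.var 21) (.var 22))).run s).realArray
          1 0 0 = u i j := by
        simp [hi, hj, hs.utility]
      obtain ⟨C, hC, ⟨h16, hA⟩ | ⟨h16, A, hA, hst⟩⟩ := run_thresholdMatching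
        (hs.of_sameOff hsame (by decide)) (hs'.of_sameOff hsame (by decide)) h0 hτ
      · exact Or.inr ⟨by simpa using h16, hQ, fun _ => ⟨C, hC, hA⟩⟩
      · exact Or.inl ⟨by simpa using h16, A, hC.envyFree hA, hA.isBalanced, hst⟩
    · exact Or.inr ⟨h20, hQ, fun h => absurd h h0⟩

/-- Try all utilities as thresholds. -/
def searchThresholds : Code := .loop 21 0 (.loop 22 1 tryThreshold)

theorem run_searchThresholds {s : Memory} (hs : HasInstance u s) (hs' : HasBundleSize n r s)
    {Q : Prop} (h : (s.var 20 = 1 ∧ HoldsFair u s) ∨ (s.var 20 = 0 ∧ Q)) :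
    ((searchThresholds.run s).var 20 = 1 ∧ HoldsFair u (searchThresholds.run s)) ∨
      ((searchThresholds.run s).var 20 = 0 ∧ Q ∧ ∀ i j, 0 ≤ u i j → CanFail r (u i j) u) := by
  have key := run_loop (x := 21) (y := 0) (c := .loop 22 1 tryThreshold) s
    (fun k s' => (s'.var 20 = 1 ∧ HoldsFair u s') ∨ (s'.var 20 = 0 ∧ Q ∧
      ∀ i : Fin n, (i : ℕ) < k → ∀ j, 0 ≤ u i j → CanFail r (u i j) u))
    (fun _ _ _ h => h) (by simpa using h) ?_
  · rw [hs.agents] at key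
    exact key.imp_right fun h => ⟨h.1, h.2.1, fun i => h.2.2 i i.2⟩
  · intro k hk s₁ hsame₁ hk₁ hI₁
    have hkn : k < n := hk.trans_eq hs.agents
    obtain ⟨i, rfl⟩ : ∃ i : Fin n, (i : ℕ) = k := ⟨⟨k, hkn⟩, rfl⟩
    have hs₁ : HasInstance u s₁ := hs.of_sameOff hsame₁ (by decide)
    have hs₁' : HasBundleSize n r s₁ := hs'.of_sameOff hsame₁ (by decide)
    have key := run_loop (x := 22) (y := 1) (c := tryThreshold) s₁
      (fun k s' => (s'.var 20 = 1 ∧ HoldsFair u s') ∨ (s'.var 20 = 0 ∧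
        ((Q ∧ ∀ a : Fin n, (a : ℕ) < i → ∀ j, 0 ≤ u a j → CanFail r (u a j) u) ∧
        ∀ j : Fin (r * n), (j : ℕ) < k → 0 ≤ u i j → CanFail r (u i j) u)))
      (fun _ _ _ h => h) (by simpa using hI₁) ?_
    · rw [hs₁.items] at key
      refine key.imp_right fun h => ⟨h.1, h.2.1.1, fun a ha => ?_⟩
      rcases Nat.lt_succ_iff_lt_or_eq.1 ha with ha | ha
      · exact h.2.1.2 a ha
      · rw [Fin.ext ha]
        exact fun j => h.2.2 j j.2
    · intro k hk s₂ hsame₂ hk₂ hI₂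
      have hkm : k < r * n := hk.trans_eq hs₁.items
      obtain ⟨j, rfl⟩ : ∃ j : Fin (r * n), (j : ℕ) = k := ⟨⟨k, hkm⟩, rfl⟩
      refine (run_tryThreshold (hs₁.of_sameOff hsame₂ (by decide))
        (hs₁'.of_sameOff hsame₂ (by decide)) ((hsame₂.var 21 (by decide)).trans hk₁) hk₂
        hI₂).imp_right fun h => ⟨h.1, h.2.1.1, fun b hb => ?_⟩
      rcases Nat.lt_succ_iff_lt_or_eq.1 hb with hb | hb
      · exact h.2.1.2 b hb
      · rw [Fin.ext hb]
        exact h.2.2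

end Search

/-! ### The final programs and their guarantees -/

section Main

/-- Try the allocation obtained from trades in blocks, and threshold matching with removal for all
thresholds that are utilities. -/
def fairAllocation : Code :=
  divMod ;;
  .ite (.and (.natLe (.const 1) (.var 0)) (.natEq (.var 3) (.const 0)))
    (blockTrades ;; envyCheck ;; searchThresholds) (.setVar 20 (.const 0))

/-- The program gives up only after all attempts have failed, so one attempt that cannot fail
guarantees success. -/
theorem run_fairAllocation {n r : ℕ} {u : Fin n → Fin (r * n) → ℝ} {s : Memory}
    (hs : HasInstance u s) (hn : 0 < n) :
    ((fairAllocation.run s).var 20 = 1 ∧ HoldsFair u (fairAllocation.run s)) ∨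
      ((fairAllocation.run s).var 20 = 0 ∧ ¬ EnvyFree u (blockAllocation hn u) ∧
        ∀ i j, 0 ≤ u i j → CanFail r (u i j) u) := by
  classical
  rw [fairAllocation, run_seq]
  have h3 : (divMod.run s).var 3 = 0 :=
    (run_divMod hn hs.agents hs.items).2.1.trans (Nat.mul_mod_left r n)
  have hb₁ := hasBundleSize_run_divMod hn hs.agents hs.items
  have hsame₁ := sameOff_run divMod s
  set s₁ := divMod.run s with hs₁
  have hs₁' : HasInstance u s₁ := hs.of_sameOff hsame₁ (by decide)
  rw [run_ite, if_pos (by simpa [h3, hs₁'.agents] using Nat.succ_le_of_lt hn)]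
  rw [run_seq, run_seq]
  have hA := run_blockTrades hs₁' hb₁
  have hsame₂ := sameOff_run blockTrades s₁
  set s₂ := blockTrades.run s₁ with hs₂
  have hs₂' : HasInstance u s₂ := hs₁'.of_sameOff hsame₂ (by decide)
  have hsame₃ := sameOff_run envyCheck s₂
  have hE := run_envyCheck hs₂' hA
  refine run_searchThresholds (hs₂'.of_sameOff hsame₃ (by decide))
    ((hb₁.of_sameOff hsame₂ (by decide)).of_sameOff hsame₃ (by decide)) ?_
  split_ifs at hE with h
  · refine Or.inl ⟨hE, _, h, fun i i' => ?_, fun j => ?_⟩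
    · rw [card_bundle_blockAllocation, card_bundle_blockAllocation]
    · rw [hsame₃.nat 0 (by decide), hA]
  · exact Or.inr ⟨hE, h⟩

theorem run_fairAllocation_of_not_dvd {s : Memory} (h : ¬ (1 ≤ s.var 0 ∧ s.var 0 ∣ s.var 1)) :
    (fairAllocation.run s).var 20 = 0 := by
  rw [fairAllocation, run_seq, run_ite, if_neg, run_setVar]
  · simp
  · intro hc
    have h0 : (divMod.run s).var 0 = s.var 0 := (sameOff_run divMod s).var 0 (by decide)
    simp only [holds_and, holds_natLe, eval_const, eval_var, h0, holds_natEq] at hc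
    refine h ⟨hc.1, Nat.dvd_of_mod_eq_zero ?_⟩
    rw [← (run_divMod hc.1 rfl rfl).2.1]
    exact hc.2

variable {n m : ℕ} {u : Fin n → Fin m → ℝ}

theorem hasInstance_inputMemory (x : ℝ) : HasInstance u (inputMemory n m x u) where
  agents := rfl
  items := rfl
  utility i j := by simp [inputMemory]

/-- Run `c` and return variable `k`. -/
def Code.program (c : Code) (k : ℕ) : Program := .seq c.compile (.setVar 0 (.var k))

theorem computesWithin_program {c : Code} (hc : c.wellFormed = true) {k : ℕ} {x : ℝ}
    {out : Option (Allocation n m)}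
    (h : HasOutput ((c.run (inputMemory n m x u)).setVar 0 ((c.run (inputMemory n m x u)).var k))
      out) : ComputesWithin (c.program k) ((c.cost + 1).eval (n + m)) x u out := by
  obtain ⟨t, ht, hex⟩ := exec_compile c hc (B := n + m) (inputMemory n m x u)
    (show n ≤ n + m by omega) (show m ≤ n + m by omega)
  refine ⟨t + 1, ?_, _, .seq _ _ _ _ _ _ _ hex (.setVar _ 0 (.var k)), h⟩
  rw [Polynomial.eval_add, Polynomial.eval_one]
  omega

theorem computesWithin_fairAllocation_some {n r : ℕ} {u : Fin n → Fin (r * n) → ℝ} (hn : 0 < n)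
    (h : EnvyFree u (blockAllocation hn u) ∨ ∃ i j, 0 ≤ u i j ∧ ¬ CanFail r (u i j) u) :
    ∃ A, ComputesWithin (fairAllocation.program 20) ((fairAllocation.cost + 1).eval (n + r * n)) 0 u
      (some A) ∧ EnvyFree u A ∧ IsBalanced A := by
  rcases run_fairAllocation (hasInstance_inputMemory (u := u) 0) hn with
    ⟨h1, A, hA, hA', hst⟩ | ⟨-, h1, h2⟩
  · exact ⟨A, computesWithin_program (by decide) ⟨by simpa using h1, hst⟩, hA, hA'⟩
  · rcases h with h | ⟨i, j, h0, h⟩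
    · exact absurd h h1
    · exact absurd (h2 i j h0) h

theorem exists_computesWithin_fairAllocation (u : Fin n → Fin m → ℝ) : ∃ out,
    ComputesWithin (fairAllocation.program 20) ((fairAllocation.cost + 1).eval (n + m)) 0 u out ∧
      ∀ A, out = some A → EnvyFree u A ∧ IsBalanced A := by
  by_cases h : 1 ≤ n ∧ n ∣ m
  · obtain ⟨hn, r, hr⟩ := h
    obtain rfl : m = r * n := hr.trans (Nat.mul_comm n r)
    rcases run_fairAllocation (hasInstance_inputMemory (u := u) 0) hn with
      ⟨h1, A, hA, hA', hst⟩ | ⟨h1, -⟩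
    · refine ⟨some A, computesWithin_program (by decide) ⟨by simpa using h1, hst⟩, ?_⟩
      rintro _ ⟨⟩
      exact ⟨hA, hA'⟩
    · exact ⟨none, computesWithin_program (by decide) (by simpa [HasOutput] using h1), by simp⟩
  · refine ⟨none, computesWithin_program (by decide) ?_, by simp⟩
    have := run_fairAllocation_of_not_dvd (s := inputMemory n m 0 u) h
    simpa [HasOutput] using this

theorem exists_computesWithin_thresholdMatching {n r : ℕ} {τ : ℝ} (u : Fin n → Fin (r * n) → ℝ)
    (hn : 0 < n) (hτ : 0 ≤ τ) : ∃ out,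
    ComputesWithin ((divMod ;; thresholdMatching).program 16)
      (((divMod ;; thresholdMatching).cost + 1).eval (n + r * n)) τ u out ∧
      ThresholdMatchingWithRemoval r τ u out := by
  have hs := hasInstance_inputMemory (u := u) τ
  have hsame := sameOff_run divMod (inputMemory n (r * n) τ u)
  obtain ⟨C, hC, ⟨h16, hA⟩ | ⟨h16, A, hA, hst⟩⟩ := run_thresholdMatching
    (hs.of_sameOff hsame (by decide)) (hasBundleSize_run_divMod hn hs.agents hs.items) hτ
    (by rw [hsame.real 1 (by decide)]; simp [inputMemory])
  · exact ⟨none, computesWithin_program (by decide) (by simpa [HasOutput] using h16), C, hC, hA⟩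
  · exact ⟨some A, computesWithin_program (by decide) ⟨by simpa using h16, hst⟩, C, hC, hA⟩

end Main

/-! ### From probability bounds to high probability -/

section WithHighProbability

variable {U : Measure ℝ} {r : ℕ → ℕ} {E E' : (n : ℕ) → (Fin n → Fin (r n * n) → ℝ) → Prop}

theorem withHighProbability_of_real_le [IsProbabilityMeasure U] {f : ℕ → ℝ}
    (hf : Tendsto f atTop (𝓝 0))
    (h : ∀ᶠ n in atTop, (utilityLaw U n (r n * n)).real {ω | ¬ E n (Function.curry ω)} ≤ f n) :
    WithHighProbability U r E := by
  have hf' : Tendsto (fun n => ENNReal.ofReal (f n)) atTop (𝓝 0) := by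
    simpa [Function.comp_def] using (ENNReal.continuous_ofReal.tendsto 0).comp hf
  refine tendsto_of_tendsto_of_tendsto_of_le_of_le' tendsto_const_nhds hf'
    (Eventually.of_forall fun _ => zero_le) ?_
  filter_upwards [h] with n hn
  rw [← ofReal_measureReal (measure_ne_top _ _)]
  exact ENNReal.ofReal_le_ofReal hn

theorem WithHighProbability.mono (h : WithHighProbability U r E)
    (hE : ∀ n u, E n u → E' n u) : WithHighProbability U r E' :=
  tendsto_of_tendsto_of_tendsto_of_le_of_le tendsto_const_nhds h (fun _ => zero_le)
    fun n => measure_mono fun _ hω hω' => hω (hE n _ hω')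

end WithHighProbability

theorem IsTypical.not_canFail {n r : ℕ} {α τ : ℝ} {u : Fin n → Fin (r * n) → ℝ}
    (h : IsTypical r α τ u) (hr : 2 ≤ r) (hα : 0 < α) (hα' : 3 * α ≤ 1) (hτ : 1 - α ≤ τ) :
    ¬ CanFail r τ u :=
  fun ⟨_, hC, hA⟩ => hA (h.exists_isPerfectMatching hr hα hα' hτ hC)

/-- For each n one of the two regimes of r(n) applies, so the maximum of the two error bounds works.
The program tries both strategies and need not know the regime. -/
theorem withHighProbability_computesWithin_fairAllocation {U : Measure ℝ}
    (hU : IsUtilityDistribution U) (hU' : PolyBoundedAtOne U) {r : ℕ → ℕ} (hr : ∀ n, 2 ≤ r n) :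
    WithHighProbability U r fun n u => ∃ A,
      ComputesWithin (fairAllocation.program 20) ((fairAllocation.cost + 1).eval (n + r n * n)) 0 u
        (some A) ∧ EnvyFree u A ∧ IsBalanced A := by
  have := hU.1
  obtain ⟨θl, hθl, θu, -, q, hq, hl, hu⟩ := id hU'
  obtain ⟨f, hf, hf'⟩ := eventually_isTypical hU hθl hq hl hu
  obtain ⟨g, hg, hg'⟩ := eventually_envyFree_blockAllocation hU hU'
  refine withHighProbability_of_real_le (f := fun n => max (f n) (g n))
    (by simpa using hf.max hg) ?_
  filter_upwards [hf', hg', eventually_gt_atTop 0] with n hfn hgn hn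
  rcases le_or_gt ((r n : ℝ)) (Real.exp ((n : ℝ) ^ (0.1 : ℝ))) with hrn | hrn
  · obtain ⟨hα, hα', hfn⟩ := hfn (r n) (hr n) hrn
    refine (utilityLaw_real_mono fun ω => mt fun h => ?_).trans (hfn.trans (le_max_left _ _))
    obtain ⟨i, j, hij, h'⟩ := h.exists_utility_threshold (by have := hr n; omega) hn
    have hij' : 1 - thresholdGap θl q n (r n) ≤ Function.curry ω i j := hij
    exact computesWithin_fairAllocation_some hn
      (Or.inr ⟨i, j, by linarith, h'.not_canFail (hr n) hα hα' hij'⟩)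
  · refine (utilityLaw_real_mono fun ω => mt fun h => ?_).trans
      ((hgn hn (r n) hrn).trans (le_max_right _ _))
    exact computesWithin_fairAllocation_some hn (Or.inl h)

theorem withHighProbability_thresholdMatchingWithRemoval {U : Measure ℝ} {θl θu q : ℝ}
    (hU : IsUtilityDistribution U) (hθl : 0 < θl) (hq : 0 < q) (hl : PolyBoundedBelowAtOne U θl q)
    (hu : PolyBoundedAboveAtOne U θu q) {r : ℕ → ℕ} (hr : ∀ n, 2 ≤ r n)
    (hr' : ∀ᶠ n : ℕ in atTop, (r n : ℝ) ≤ Real.exp ((n : ℝ) ^ (0.1 : ℝ))) :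
    WithHighProbability U r fun n u =>
      (∃ out, ThresholdMatchingWithRemoval (r n) (threshold θl q n (r n)) u out) ∧
      ∀ out, ThresholdMatchingWithRemoval (r n) (threshold θl q n (r n)) u out →
        ∃ A, out = some A ∧ EnvyFree u A ∧ IsBalanced A := by
  have := hU.1
  obtain ⟨f, hf, hf'⟩ := eventually_isTypical hU hθl hq hl hu
  refine withHighProbability_of_real_le hf ?_
  filter_upwards [hf', hr'] with n hfn hrn
  obtain ⟨hα, hα', hfn⟩ := hfn (r n) (hr n) hrn
  refine (utilityLaw_real_mono fun ω => mt fun h => ?_).trans hfn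
  have hτ : threshold θl q n (r n) = 1 - thresholdGap θl q n (r n) := rfl
  refine ⟨exists_thresholdMatchingWithRemoval _ (by linarith) _, ?_⟩
  rintro (_ | A) ⟨C, hC, hA⟩
  · exact absurd ⟨C, hC, hA⟩ (h.not_canFail (hr n) hα hα' hτ.ge)
  · exact ⟨A, rfl, hC.envyFree hA, hA.isBalanced⟩

end FairDivision

theorem theorem1 :
    -- existence
    (∀ (U : Measure ℝ), IsUtilityDistribution U → PolyBoundedAtOne U →
      ∀ r : ℕ → ℕ, (∀ n, 2 ≤ r n) →
        WithHighProbability U r fun _ u => ∃ A, EnvyFree u A) ∧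
    -- a polynomial-time algorithm, the same for all distributions and all numbers of items, which
    -- is only given the utilities (the real parameter of the input is 0)
    (∃ (c : Program) (p : Polynomial ℕ),
      (∀ (n m : ℕ) (u : Fin n → Fin m → ℝ), ∃ out,
        ComputesWithin c (p.eval (n + m)) 0 u out ∧
          ∀ A, out = some A → EnvyFree u A ∧ IsBalanced A) ∧
      ∀ (U : Measure ℝ), IsUtilityDistribution U → PolyBoundedAtOne U →
        ∀ r : ℕ → ℕ, (∀ n, 2 ≤ r n) →
          WithHighProbability U r fun n u => ∃ A,
            ComputesWithin c (p.eval (n + r n * n)) 0 u (some A) ∧ EnvyFree u A ∧ IsBalanced A) ∧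
    -- threshold matching with removal runs in polynomial time
    (∃ (c : Program) (p : Polynomial ℕ),
      ∀ (n r : ℕ) (τ : ℝ) (u : Fin n → Fin (r * n) → ℝ), 0 < n → 0 ≤ τ → ∃ out,
        ComputesWithin c (p.eval (n + r * n)) τ u out ∧
          ThresholdMatchingWithRemoval r τ u out) ∧
    -- and, however its ties are broken, it finds a balanced envy-free allocation
    (∀ (U : Measure ℝ) (θl θu q : ℝ), IsUtilityDistribution U → 0 < θl → 0 < θu → 0 < q →
      PolyBoundedBelowAtOne U θl q → PolyBoundedAboveAtOne U θu q →
      ∀ r : ℕ → ℕ, (∀ n, 2 ≤ r n) →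
        (∀ᶠ n : ℕ in atTop, (r n : ℝ) ≤ Real.exp ((n : ℝ) ^ (0.1 : ℝ))) →
          WithHighProbability U r fun n u =>
            (∃ out, ThresholdMatchingWithRemoval (r n) (threshold θl q n (r n)) u out) ∧
            ∀ out, ThresholdMatchingWithRemoval (r n) (threshold θl q n (r n)) u out →
              ∃ A, out = some A ∧ EnvyFree u A ∧ IsBalanced A) := by
  refine ⟨fun U hU hU' r hr => ?_, ⟨fairAllocation.program 20, fairAllocation.cost + 1,
      fun n m u => exists_computesWithin_fairAllocation u, fun U hU hU' r hr =>
        withHighProbability_computesWithin_fairAllocation hU hU' hr⟩,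
    ⟨(divMod ;; thresholdMatching).program 16, (divMod ;; thresholdMatching).cost + 1,
      fun n r τ u hn hτ => exists_computesWithin_thresholdMatching u hn hτ⟩,
    fun U θl θu q hU hθl _ hq hl hu r hr hr' =>
      withHighProbability_thresholdMatchingWithRemoval hU hθl hq hl hu hr hr'⟩
  exact (withHighProbability_computesWithin_fairAllocation hU hU' hr).mono
    fun n u ⟨A, _, hA, _⟩ => ⟨A, hA⟩
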